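/- Let $G=\mathrm{GL}_3(\mathbb R)$ and $H=\mathrm{GL}_2(\mathbb R)$, embedded in $G$ by $h\mapsto\operatorname{diag}(h,1)$, and let $P_G$, $P_H$ be their subgroups of upper triangular matrices. For $\varepsilon\in\mathbb Z/2\mathbb Z$, $\mu\in\mathbb C$ and $x\in\mathbb R^\times$ put $|x|^\mu_\varepsilon=\operatorname{sgn}(x)^\varepsilon|x|^\mu$. For $\xi\in(\mathbb Z/2\mathbb Z)^3$, $\lambda\in\mathbb C^3$ let $\pi_{\xi,\lambda}$ be the space of $f\in C^\infty(G)$ with $$f(gp)=|p_{11}|_{\xi_1}^{-\lambda_1-1}\,|p_{22}|_{\xi_2}^{-\lambda_2}\,|p_{33}|_{\xi_3}^{-\lambda_3+1}f(g)\qquad(g\in G,\ p\in P_G),$$ and for $\eta\in(\mathbb Z/2\mathbb Z)^2$, $\nu\in\mathbb C^2$ let $\tau_{\eta,\nu}$ be the space of $f\in C^\infty(H)$ with $$f(hp)=|p_{11}|_{\eta_1}^{-\nu_1-\frac12}\,|p_{22}|_{\eta_2}^{-\nu_2+\frac12}f(h)\qquad(h\in H,\ p\in P_H);$$ both carry the left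 regular action, and their elements are regarded as sections of line bundles over $G/P_G$ and $H/P_H$. Let $$x_1=\begin{pmatrix}1&0&0\\0&0&1\\0&1&0\end{pmatrix},\qquad \overline n(x,y,z)=\begin{pmatrix}1&0&0\\x&1&0\\z&y&1\end{pmatrix},\qquad p_1:H/P_H\to G/P_G,\quad p_1(hP_H)=hx_1P_G .$$ Let $\mathrm{DSBO}_1(\pi_{\xi,\lambda},\tau_{\eta,\nu})$ be the space of linear $H$-intertwining maps $T:\pi_{\xi,\lambda}\to\tau_{\eta,\nu}$ that are $p_1$-differential, i.e. $p_1(\operatorname{supp}Tf)\subset\operatorname{supp}f$ for all $f\in\pi_{\xi,\lambda}$, where the supports are those of the sections. A distribution $K$ on $\mathbb R^3$ supported at the origin is called the distribution kernel of $T$ if $Tf(h)=\langle K,\ (x,y,z)\mapsto f(h\,x_1\,\overline n(x,y,z))\rangle$ for all $f\in\pi_{\xi,\lambda}$ and $h\in H$. Put $n_1=\nu_1-\lambda_1-\tfrac12$ and $n_2=\lambda_3-\nu_2-\tfrac12$ and, when $n_1,n_2\in\mathbb N=\{0,1,2,\dots\}$, $N=\min(n_1,n_2)$. For $n\in\mathbb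 N$ let $[n]$ be its class mod $2$. Let $(a)_j=a(a+1)\cdots(a+j-1)$, and let $(a)_j^*$ be the product of the non-zero ones among the factors $a,a+1,\dots,a+j-1$. **Proposition.** The following three cases are exhaustive. (1) Suppose that $n_1,n_2\in\mathbb N$, $\eta_1=\xi_1+[n_1]$, $\eta_2=\xi_3+[n_2]$, and that there are no integers $0\le k_0\le\ell_0\le N-1$ with $\lambda_1-\lambda_3+n_1+n_2-\ell_0=\lambda_2-\lambda_3+n_2-k_0=0$. Then $\dim\mathrm{DSBO}_1(\pi_{\xi,\lambda},\tau_{\eta,\nu})=1$. If $\lambda_1-\lambda_3+n_1+n_2-\ell\ne0$ for all integers $0\le\ell\le N-1$, the distribution kernel of a basis is $$\sum_{j=0}^N(-1)^j\frac{(-n_1)_j(-n_2)_j(\lambda_3-\lambda_2-n_2)_j}{(\lambda_3-\lambda_1-n_1-n_2)_j\,j!}\,\delta^{(n_1-j)}(x)\,\delta^{(n_2-j)}(y)\,\delta^{(j)}(z).$$ If $\lambda_1-\lambda_3+n_1+n_2-\ell_0=0$ for an integer $0\le\ell_0\le N-1$, the distribution kernel of a basis is $$\sum_{j=\ell_0+1}^N(-1)^j\frac{(-n_1)_j(-n_2)_j(\lambda_3-\lambda_2-n_2)_j}{(\lambda_3-\lambda_1-n_1-n_2)_j^*\,j!}\,\delta^{(n_1-j)}(x)\,\delta^{(n_2-j)}(y)\,\delta^{(j)}(z).$$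 (2) Suppose that $n_1,n_2\in\mathbb N$, $\eta_1=\xi_1+[n_1]$, $\eta_2=\xi_3+[n_2]$, and that there are integers $0\le k_0\le\ell_0\le N-1$ with $\lambda_1-\lambda_3+n_1+n_2-\ell_0=\lambda_2-\lambda_3+n_2-k_0=0$. Then $\dim\mathrm{DSBO}_1(\pi_{\xi,\lambda},\tau_{\eta,\nu})=2$, and the distribution kernels of a basis are $$\sum_{j=\ell_0+1}^N(-1)^j\frac{(-n_1)_j(-n_2)_j(\lambda_3-\lambda_2-n_2)_j^*}{(\lambda_3-\lambda_1-n_1-n_2)_j^*\,j!}\,\delta^{(n_1-j)}(x)\,\delta^{(n_2-j)}(y)\,\delta^{(j)}(z)$$ and $$\sum_{j=0}^{k_0}(-1)^j\frac{(-n_1)_j(-n_2)_j(\lambda_3-\lambda_2-n_2)_j}{(\lambda_3-\lambda_1-n_1-n_2)_j\,j!}\,\delta^{(n_1-j)}(x)\,\delta^{(n_2-j)}(y)\,\delta^{(j)}(z).$$ (3) In all other cases, that is, unless $n_1,n_2\in\mathbb N$, $\eta_1=\xi_1+[n_1]$ and $\eta_2=\xi_3+[n_2]$, one has $\dim\mathrm{DSBO}_1(\pi_{\xi,\lambda},\tau_{\eta,\nu})=0$.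 -/

import Mathlib

open scoped ContDiff

noncomputable section

namespace SymBreak

/-- The real general linear group `GL_n(ℝ)`. -/
abbrev GLR (n : ℕ) : Type := Matrix.GeneralLinearGroup (Fin n) ℝ

/-- Extension by zero of a function on `GL_n(ℝ)` to the space of all real `n × n` arrays. -/
def extendZero {n : ℕ} (f : GLR n → ℂ) (A : Fin n → Fin n → ℝ) : ℂ :=
  open Classical in
  if h : (Matrix.of A).det ≠ 0 then
    f (Matrix.GeneralLinearGroup.mkOfDetNeZero (Matrix.of A) h) else 0

/-- `f ∈ C^∞(GL_n(ℝ))`, where `GL_n(ℝ)` is regarded as the open subset `det ≠ 0` of `ℝ^(n × n)`. -/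
def IsSmooth {n : ℕ} (f : GLR n → ℂ) : Prop :=
  ContDiffOn ℝ ∞ (extendZero f) {A : Fin n → Fin n → ℝ | (Matrix.of A).det ≠ 0}

/-- The minimal parabolic subgroup of upper triangular matrices in `GL_n(ℝ)`. -/
def borel (n : ℕ) : Subgroup (GLR n) where
  carrier := {p | (p : Matrix (Fin n) (Fin n) ℝ).BlockTriangular id}
  mul_mem' := by
    intro a b ha hb
    simpa using Matrix.BlockTriangular.mul ha hb
  one_mem' := by
    simpa using Matrix.blockTriangular_one
  inv_mem' := by
    intro a ha
    have h := Matrix.blockTriangular_inv_of_blockTriangular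
      (M := (a : Matrix (Fin n) (Fin n) ℝ)) (b := id) ha
    simpa using h

/-- `|x|_ε^μ = sgn(x)^ε |x|^μ` for `x ≠ 0`, `ε ∈ ℤ/2ℤ`, `μ ∈ ℂ`. -/
def signedPow (ε : ZMod 2) (μ : ℂ) (x : ℝ) : ℂ :=
  (if ε = 0 then 1 else ((Real.sign x : ℝ) : ℂ)) * ((|x| : ℝ) : ℂ) ^ μ

/-- The entries of the half sum of positive roots `ρ = ½(n-1, n-3, …, 1-n)`. -/
def rho (n : ℕ) (i : Fin n) : ℂ := ((n : ℂ) - 1 - 2 * ((i : ℕ) : ℂ)) / 2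

/-- The character `ξ(m)⁻¹ a^(-λ-ρ)` of the upper triangular matrix `p = man`: the diagonal entries
of `p` are those of `ma`, and `ξ(m)⁻¹ = ξ(m)`. -/
def inducingFactor {n : ℕ} (ξ : Fin n → ZMod 2) (lam : Fin n → ℂ) (p : GLR n) : ℂ :=
  ∏ i, signedPow (ξ i) (-lam i - rho n i) ((p : Matrix (Fin n) (Fin n) ℝ) i i)

lemma extendZero_add {n : ℕ} (f g : GLR n → ℂ) :
    extendZero (f + g) = extendZero f + extendZero g := by
  funext A
  simp only [extendZero, Pi.add_apply]
  split_ifs <;> simp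

lemma extendZero_smul {n : ℕ} (c : ℂ) (f : GLR n → ℂ) :
    extendZero (c • f) = c • extendZero f := by
  funext A
  simp only [extendZero, Pi.smul_apply]
  split_ifs <;> simp

/-- The space of the smooth normalized principal series `Ind_P^G(ξ ⊗ e^λ ⊗ 1)` of `GL_n(ℝ)`. -/
def principalSeries (n : ℕ) (ξ : Fin n → ZMod 2) (lam : Fin n → ℂ) :
    Submodule ℂ (GLR n → ℂ) where
  carrier := {f | IsSmooth f ∧
    ∀ (g p : GLR n), p ∈ borel n → f (g * p) = inducingFactor ξ lam p * f g}
  add_mem' := by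
    rintro f g ⟨hf, hf'⟩ ⟨hg, hg'⟩
    refine ⟨?_, fun x p hp => ?_⟩
    · unfold IsSmooth
      rw [extendZero_add]
      exact ContDiffOn.add hf hg
    · simp only [Pi.add_apply, hf' x p hp, hg' x p hp]
      ring
  zero_mem' := by
    refine ⟨?_, fun x p hp => by simp⟩
    have : extendZero (0 : GLR n → ℂ) = fun _ => 0 := by
      funext A
      simp [extendZero]
    unfold IsSmooth
    rw [this]
    exact contDiffOn_const
  smul_mem' := by
    rintro c f ⟨hf, hf'⟩
    refine ⟨?_, fun x p hp => ?_⟩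
    · unfold IsSmooth
      rw [extendZero_smul]
      exact ContDiffOn.const_smul c hf
    · simp only [Pi.smul_apply, hf' x p hp, smul_eq_mul]
      ring

lemma isSmooth_translate {n : ℕ} (h : GLR n) {f : GLR n → ℂ} (hf : IsSmooth f) :
    IsSmooth (fun g => f (h * g)) := by
  let m : (Fin n → Fin n → ℝ) → (Fin n → Fin n → ℝ) := fun A i j =>
    ∑ k, (h : Matrix (Fin n) (Fin n) ℝ) i k * A k j
  have hm : ContDiff ℝ ∞ m := by
    refine contDiff_pi.2 fun i => contDiff_pi.2 fun j => ?_
    refine ContDiff.sum fun k _ => contDiff_const.mul ?_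
    exact contDiff_apply_apply ℝ ℝ k j
  have hmo : ∀ A, Matrix.of (m A) = (h : Matrix (Fin n) (Fin n) ℝ) * Matrix.of A := by
    intro A
    ext i j
    simp [m, Matrix.mul_apply]
  have hdet : (h : Matrix (Fin n) (Fin n) ℝ).det ≠ 0 :=
    Matrix.GeneralLinearGroup.det_ne_zero h
  have hmaps : Set.MapsTo m {A | (Matrix.of A).det ≠ 0} {A | (Matrix.of A).det ≠ 0} := by
    intro A hA
    simp only [Set.mem_ofPred_eq, hmo, Matrix.det_mul] at hA ⊢
    exact mul_ne_zero hdet hA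
  refine (ContDiffOn.comp hf hm.contDiffOn hmaps).congr ?_
  intro A hA
  have hA' := hmaps hA
  simp only [Set.mem_ofPred_eq] at hA hA'
  simp only [Function.comp, extendZero, dif_pos hA, dif_pos hA']
  congr 1
  apply Units.ext
  exact (hmo A).symm

/-- The left regular representation `(π(g) f)(x) = f(g⁻¹ x)` on the principal series. -/
def leftRegular (n : ℕ) (ξ : Fin n → ZMod 2) (lam : Fin n → ℂ) :
    Representation ℂ (GLR n) (principalSeries n ξ lam) where
  toFun g :=
    { toFun := fun f => ⟨fun x => (f : GLR n → ℂ) (g⁻¹ * x),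
        isSmooth_translate g⁻¹ f.2.1, fun x p hp => by
          simpa only [mul_assoc] using f.2.2 (g⁻¹ * x) p hp⟩
      map_add' := fun _ _ => rfl
      map_smul' := fun _ _ => rfl }
  map_one' := by
    ext f x
    simp
  map_mul' a b := by
    ext f x
    simp [mul_assoc]

/-- The support, in the flag variety `G/P_G`, of the section of the line bundle which corresponds
to an equivariant function on `G = GL_n(ℝ)`. -/
def sectionSupport {n : ℕ} (f : GLR n → ℂ) : Set (GLR n ⧸ borel n) :=
  closure ((fun g : GLR n => (g : GLR n ⧸ borel n)) '' Function.support f)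

/-- The multiplicative map `h ↦ diag(h, 1)` on matrices. -/
def blockHom : Matrix (Fin 2) (Fin 2) ℝ →* Matrix (Fin 3) (Fin 3) ℝ where
  toFun A := !![A 0 0, A 0 1, 0; A 1 0, A 1 1, 0; 0, 0, 1]
  map_one' := by
    ext i j
    fin_cases i <;> fin_cases j <;> simp
  map_mul' A B := by
    ext i j
    fin_cases i <;> fin_cases j <;> simp [Matrix.mul_apply, Fin.sum_univ_succ]

/-- The embedding `h ↦ diag(h, 1)` of `H = GL_2(ℝ)` in `G = GL_3(ℝ)`. -/
def embed : GLR 2 →* GLR 3 := Units.map blockHom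

/-- The base point `x_1`, the permutation matrix that exchanges the last two coordinates. -/
def x1 : GLR 3 :=
  Matrix.GeneralLinearGroup.mkOfDetNeZero !![1, 0, 0; 0, 0, 1; 0, 1, 0]
    (by simp [Matrix.det_fin_three])

lemma x1_mul_x1 : x1 * x1 = 1 := by
  apply Units.ext
  change (!![1, 0, 0; 0, 0, 1; 0, 1, 0] : Matrix (Fin 3) (Fin 3) ℝ) *
    !![1, 0, 0; 0, 0, 1; 0, 1, 0] = 1
  ext i j
  fin_cases i <;> fin_cases j <;> simp [Matrix.mul_apply, Fin.sum_univ_succ]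

lemma conj_x1_mem {p : GLR 2} (hp : p ∈ borel 2) : x1⁻¹ * embed p * x1 ∈ borel 3 := by
  rw [inv_eq_of_mul_eq_one_right x1_mul_x1]
  have h10 : (p : Matrix (Fin 2) (Fin 2) ℝ) 1 0 = 0 := hp (by decide)
  change ((!![1, 0, 0; 0, 0, 1; 0, 1, 0] : Matrix (Fin 3) (Fin 3) ℝ) *
    blockHom (p : Matrix (Fin 2) (Fin 2) ℝ) * !![1, 0, 0; 0, 0, 1; 0, 1, 0]).BlockTriangular id
  intro i j hij
  fin_cases i <;> fin_cases j <;>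
    simp_all [blockHom, Matrix.mul_apply, Fin.sum_univ_succ]

/-- The `H`-equivariant map `p_1 : H/P_H → G/P_G`, `h P_H ↦ h x_1 P_G`. -/
def p1 : GLR 2 ⧸ borel 2 → GLR 3 ⧸ borel 3 :=
  Quotient.map' (fun h => embed h * x1) (by
    intro a b hab
    rw [QuotientGroup.leftRel_apply] at hab ⊢
    have := conj_x1_mem hab
    simpa [mul_assoc] using this)

/-- `DSBO_1(π_{ξ,λ}, τ_{η,ν})`: the linear maps from the principal series `π_{ξ,λ}` of `GL_3(ℝ)` to
the principal series `τ_{η,ν}` of `GL_2(ℝ)` that commute with the action of `GL_2(ℝ)` and are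
`p_1`-differential, that is, `p_1(supp T f) ⊆ supp f` for all `f`. -/
def DSBO1 (ξ : Fin 3 → ZMod 2) (lam : Fin 3 → ℂ) (η : Fin 2 → ZMod 2) (ν : Fin 2 → ℂ) :
    Submodule ℂ (principalSeries 3 ξ lam →ₗ[ℂ] principalSeries 2 η ν) where
  carrier := {T |
    (∀ h : GLR 2, T ∘ₗ leftRegular 3 ξ lam (embed h) = leftRegular 2 η ν h ∘ₗ T) ∧
    ∀ f : principalSeries 3 ξ lam,
      p1 '' sectionSupport (T f : GLR 2 → ℂ) ⊆ sectionSupport (f : GLR 3 → ℂ)}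
  add_mem' := by
    rintro S T ⟨hS, hS'⟩ ⟨hT, hT'⟩
    refine ⟨fun h => ?_, fun f => ?_⟩
    · rw [LinearMap.add_comp, LinearMap.comp_add, hS h, hT h]
    · have hsub : sectionSupport ((S + T) f : GLR 2 → ℂ) ⊆
          sectionSupport (S f : GLR 2 → ℂ) ∪ sectionSupport (T f : GLR 2 → ℂ) := by
        unfold sectionSupport
        rw [← closure_union, ← Set.image_union]
        exact closure_mono (Set.image_mono (Function.support_add _ _))
      refine (Set.image_mono hsub).trans ?_
      rw [Set.image_union]
      exact Set.union_subset (hS' f) (hT' f)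
  zero_mem' := by
    refine ⟨fun h => by simp, fun f => ?_⟩
    simp [sectionSupport]
  smul_mem' := by
    rintro c T ⟨hT, hT'⟩
    refine ⟨fun h => ?_, fun f => ?_⟩
    · rw [LinearMap.smul_comp, LinearMap.comp_smul, hT h]
    · refine (Set.image_mono ?_).trans (hT' f)
      unfold sectionSupport
      exact closure_mono (Set.image_mono (Function.support_const_smul_subset c _))

/-- The lower triangular unipotent matrix with coordinates `x, y, z`. -/
def nbar (x y z : ℝ) : GLR 3 :=
  Matrix.GeneralLinearGroup.mkOfDetNeZero !![1, 0, 0; x, 1, 0; z, y, 1]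
    (by simp [Matrix.det_fin_three])

/-- The distribution `δ^(a)(x) δ^(b)(y) δ^(c)(z)` on `ℝ³`, which is supported at the origin, paired
with a smooth function `φ`. -/
def deltaDeriv (a b c : ℕ) (φ : ℝ → ℝ → ℝ → ℂ) : ℂ :=
  (-1) ^ (a + b + c) *
    iteratedDeriv a (fun x => iteratedDeriv b (fun y => iteratedDeriv c (fun z => φ x y z) 0) 0) 0

/-- The distribution `∑_{j ∈ J} c_j δ^(n₁-j)(x) δ^(n₂-j)(y) δ^(j)(z)`, used for `J` contained in
`{0, …, min(n₁, n₂)}`. -/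
def deltaSum (n₁ n₂ : ℕ) (J : Finset ℕ) (c : ℕ → ℂ) (φ : ℝ → ℝ → ℝ → ℂ) : ℂ :=
  ∑ j ∈ J, c j * deltaDeriv (n₁ - j) (n₂ - j) j φ

/-- `T` is given by the distribution kernel `K` supported at `x_1 P_G`, where `K` is written in the
coordinates `(x, y, z) ↦ x_1 n̄(x, y, z) P_G` around this point:
`T f(h) = ⟨K, f(h x_1 n̄(x, y, z))⟩` for all `f` and all `h ∈ H`. -/
def HasKernel {ξ : Fin 3 → ZMod 2} {lam : Fin 3 → ℂ} {η : Fin 2 → ZMod 2} {ν : Fin 2 → ℂ}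
    (T : principalSeries 3 ξ lam →ₗ[ℂ] principalSeries 2 η ν)
    (K : (ℝ → ℝ → ℝ → ℂ) → ℂ) : Prop :=
  ∀ (f : principalSeries 3 ξ lam) (h : GLR 2),
    (T f : GLR 2 → ℂ) h = K (fun x y z => (f : GLR 3 → ℂ) (embed h * x1 * nbar x y z))

/-- The Pochhammer symbol `(a)_j = a (a+1) ⋯ (a+j-1)`. -/
def poch (a : ℂ) (j : ℕ) : ℂ := ∏ i ∈ Finset.range j, (a + i)

/-- The Pochhammer symbol with its vanishing factor, if there is one, left out. -/
def pochStar (a : ℂ) (j : ℕ) : ℂ :=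
  open Classical in
  ∏ i ∈ Finset.range j, if a + i = 0 then 1 else a + i

end SymBreak

end

/-! By equivariance, `T` is determined by the functional `f ↦ Tf(1)`, and the support condition
makes this functional depend only on the germ of `f` at `x_1 P_G`. In the coordinates `(x, y, z)` it
is a linear functional `L` on germs at the origin of `ℝ³` (`apply_eq_functionalOf`); what remains is
its covariance under `P_H`.

Continuity of `T` is not assumed; homogeneity replaces it. The element `diag(2, 1/2)` acts by the
contraction `(x/2, y/2, z/4)`, and a functional on germs that is homogeneous under it kills `x^k ψ`,
`y^k ψ`, `z^k ψ` for large `k`. By Taylor's formula `L` is a finite combination of derivatives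
(`exists_eq_sum_jets`). The whole torus then allows only monomials `x^a y^b z^c` with `a + c = n₁`,
`b + c = n₂` and fixes the parities (`weights_of_functionalOf_mono_ne_zero`). If no such `n₁, n₂`
exist, `L = 0`; otherwise the numbers `d_j = L(x^(n₁-j) y^(n₂-j) z^j)`, `0 ≤ j ≤ N`, determine `L`.

Unipotent invariance is tested infinitesimally. The generator sends a monomial to a combination of
two monomials (`generator_mono`), so invariance is the recurrence `(A + j) d_(j+1) = (B + j) d_j`
for `0 ≤ j < N`, with `A = λ₃ - λ₁ - n₁ - n₂` and `B = λ₃ - λ₂ - n₂`. Every solution comes from an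
operator (`exists_equiv_solutionSpace`).

If no `A + l` vanishes, then `d_j` is proportional to `(B)_j / (A)_j`. If `A + l = 0`, the step `j =
l` only says `(B + l) d_l = 0`. When `B + k ≠ 0` for all `k ≤ l`, this propagates down to `d_0 = … =
d_l = 0` and leaves `d_(l+1)` free. When `B + k = 0` for some `k ≤ l`, the blocks `[0, k]` and
`[l+1, N]` carry independent solutions. Factorials and signs convert `d_j` into coefficients of
delta derivatives (`coefficient_mul`). -/

noncomputable section

namespace SymBreak

/-! ### Iterated derivatives depending smoothly on parameters -/

section ParametricDerivatives

variable {E : Type} [NormedAddCommGroup E] [NormedSpace ℝ E]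

theorem contDiffOn_iteratedDeriv_param {U : Set E} (hU : IsOpen U) {F : E → ℝ → ℂ}
    (hF : ContDiffOn ℝ ∞ (fun p : E × ℝ => F p.1 p.2) (U ×ˢ Set.univ)) (n : ℕ) :
    ContDiffOn ℝ ∞ (fun p : E × ℝ => iteratedDeriv n (F p.1) p.2) (U ×ˢ Set.univ) := by
  induction n with
  | zero => simpa using hF
  | succ n ih =>
    have hO : IsOpen (U ×ˢ (Set.univ : Set ℝ)) := hU.prod isOpen_univ
    have h1 : ContDiffOn ℝ ∞ (fun p : E × ℝ =>
        fderiv ℝ (fun p : E × ℝ => iteratedDeriv n (F p.1) p.2) p (0, 1))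
        (U ×ˢ (Set.univ : Set ℝ)) :=
      (ih.fderiv_of_isOpen hO (by simp)).clm_apply contDiffOn_const
    refine h1.congr ?_
    rintro ⟨e, t⟩ ⟨he, -⟩
    have hd := ((ih.contDiffAt (hO.mem_nhds ⟨he, Set.mem_univ t⟩)).differentiableAt
      (by simp)).hasFDerivAt
    have hl : HasDerivAt (fun t : ℝ => ((e, t) : E × ℝ)) (0, 1) t :=
      (hasDerivAt_const t e).prodMk (hasDerivAt_id t)
    simp only [iteratedDeriv_succ]
    exact (hd.comp_hasDerivAt t hl).deriv

theorem contDiffOn_iteratedDeriv_param_at {U : Set E} (hU : IsOpen U) {F : E → ℝ → ℂ}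
    (hF : ContDiffOn ℝ ∞ (fun p : E × ℝ => F p.1 p.2) (U ×ˢ Set.univ)) (n : ℕ) (t : ℝ) :
    ContDiffOn ℝ ∞ (fun e : E => iteratedDeriv n (F e) t) U :=
  (contDiffOn_iteratedDeriv_param hU hF n).comp (f := fun e : E => (e, t))
    (contDiff_id.prodMk contDiff_const).contDiffOn (fun _ he => ⟨he, Set.mem_univ _⟩)

theorem contDiff_iteratedDeriv_param_at {F : E → ℝ → ℂ}
    (hF : ContDiff ℝ ∞ (fun p : E × ℝ => F p.1 p.2)) (n : ℕ) (t : ℝ) :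
    ContDiff ℝ ∞ (fun e : E => iteratedDeriv n (F e) t) :=
  contDiffOn_univ.1 (contDiffOn_iteratedDeriv_param_at isOpen_univ hF.contDiffOn n t)

theorem deriv_deriv_comm {F : ℝ → ℝ → ℂ} (hF : ContDiff ℝ ∞ (fun p : ℝ × ℝ => F p.1 p.2))
    (s t : ℝ) :
    deriv (fun s => deriv (fun t => F s t) t) s = deriv (fun t => deriv (fun s => F s t) s) t := by
  obtain ⟨Φ, hΦ⟩ : ∃ Φ : ℝ × ℝ → ℂ, Φ = fun p => F p.1 p.2 := ⟨_, rfl⟩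
  have hFΦ : ∀ s t, F s t = Φ (s, t) := fun s t => by rw [hΦ]
  rw [← hΦ] at hF
  simp only [hFΦ]
  have hd : ∀ p, HasFDerivAt Φ (fderiv ℝ Φ p) p :=
    fun p => (hF.differentiable (by simp) p).hasFDerivAt
  have hl1 : ∀ s t : ℝ, HasDerivAt (fun s : ℝ => ((s, t) : ℝ × ℝ)) (1, 0) s := fun s t =>
    (hasDerivAt_id s).prodMk (hasDerivAt_const s t)
  have hl2 : ∀ s t : ℝ, HasDerivAt (fun t : ℝ => ((s, t) : ℝ × ℝ)) (0, 1) t := fun s t =>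
    (hasDerivAt_const t s).prodMk (hasDerivAt_id t)
  have e1 : ∀ s t, deriv (fun t => Φ (s, t)) t = fderiv ℝ Φ (s, t) (0, 1) := fun s t =>
    HasDerivAt.deriv (f := fun t => Φ (s, t)) ((hd (s, t)).comp_hasDerivAt t (hl2 s t))
  have e2 : ∀ s t, deriv (fun s => Φ (s, t)) s = fderiv ℝ Φ (s, t) (1, 0) := fun s t =>
    HasDerivAt.deriv (f := fun s => Φ (s, t)) ((hd (s, t)).comp_hasDerivAt s (hl1 s t))
  simp only [e1, e2]
  have hdd : HasFDerivAt (fderiv ℝ Φ) (fderiv ℝ (fderiv ℝ Φ) (s, t)) (s, t) :=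
    ((hF.fderiv_right (m := ∞) (by simp)).differentiable (by simp) (s, t)).hasFDerivAt
  have h1 : HasDerivAt (fun s => fderiv ℝ Φ (s, t)) (fderiv ℝ (fderiv ℝ Φ) (s, t) (1, 0)) s :=
    hdd.comp_hasDerivAt s (hl1 s t)
  have h2 : HasDerivAt (fun t => fderiv ℝ Φ (s, t)) (fderiv ℝ (fderiv ℝ Φ) (s, t) (0, 1)) t :=
    hdd.comp_hasDerivAt t (hl2 s t)
  have h1' := (h1.clm_apply (hasDerivAt_const s ((0, 1) : ℝ × ℝ))).deriv
  have h2' := (h2.clm_apply (hasDerivAt_const t ((1, 0) : ℝ × ℝ))).deriv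
  rw [h1', h2', map_zero, add_zero, add_zero]
  exact second_derivative_symmetric hd hdd _ _

theorem deriv_iteratedDeriv_comm {F : ℝ → ℝ → ℂ}
    (hF : ContDiff ℝ ∞ (fun p : ℝ × ℝ => F p.1 p.2)) (n : ℕ) (s t : ℝ) :
    deriv (fun s => iteratedDeriv n (F s) t) s =
      iteratedDeriv n (fun t => deriv (fun s => F s t) s) t := by
  induction n generalizing t with
  | zero => simp
  | succ n ih =>
    have hn : ContDiff ℝ ∞ (fun p : ℝ × ℝ => iteratedDeriv n (F p.1) p.2) := by
      rw [← contDiffOn_univ, ← Set.univ_prod_univ]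
      exact contDiffOn_iteratedDeriv_param isOpen_univ hF.contDiffOn n
    simp only [iteratedDeriv_succ]
    rw [deriv_deriv_comm hn]
    congr 1
    funext t
    exact ih t

end ParametricDerivatives

/-! ### Hadamard's lemma and Taylor's formula with parameters -/

section Hadamard

/-- The derivative in `e` is an integral of the same kind with values in `E →L[ℝ] F`. The target
space therefore has to vary in the induction on the order of differentiability. -/
theorem contDiff_parametric_integral_nat {E : Type} [NormedAddCommGroup E] [NormedSpace ℝ E]
    [ProperSpace E] (n : ℕ) : ∀ {F : Type} [NormedAddCommGroup F] [NormedSpace ℝ F]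
    [CompleteSpace F] {H : E × ℝ → F}, ContDiff ℝ ∞ H →
    ContDiff ℝ n (fun e : E => ∫ s in (0 : ℝ)..1, H (e, s)) := by
  induction n with
  | zero =>
    intro F _ _ _ H hH
    refine contDiff_zero.2 ?_
    exact intervalIntegral.continuous_parametric_intervalIntegral_of_continuous'
      (f := fun e s => H (e, s)) (by simpa [Function.uncurry_def] using hH.continuous) 0 1
  | succ n ih =>
    intro F _ _ _ H hH
    set H' : E × ℝ → E →L[ℝ] F := fun p =>
      (fderiv ℝ H p).comp (ContinuousLinearMap.inl ℝ E ℝ) with hH'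
    have hH's : ContDiff ℝ ∞ H' := (hH.fderiv_right (by simp)).clm_comp contDiff_const
    have hder : ∀ e s, HasFDerivAt (fun e => H (e, s)) (H' (e, s)) e := by
      intro e s
      have hd := (hH.differentiable (by simp) (e, s)).hasFDerivAt
      exact hd.comp e (hasFDerivAt_prodMk_left e s)
    have key : ∀ e, HasFDerivAt (fun e : E => ∫ s in (0 : ℝ)..1, H (e, s))
        (∫ s in (0 : ℝ)..1, H' (e, s)) e := by
      intro e
      obtain ⟨C, hC⟩ := ((isCompact_closedBall e 1).prod
        (isCompact_Icc (a := (0 : ℝ)) (b := 1))).exists_bound_of_continuousOn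
        hH's.continuous.continuousOn
      have cH : ∀ e : E, Continuous fun s : ℝ => H (e, s) := fun e =>
        hH.continuous.comp (by fun_prop)
      have cH' : ∀ e : E, Continuous fun s : ℝ => H' (e, s) := fun e =>
        hH's.continuous.comp (by fun_prop)
      refine (intervalIntegral.hasFDerivAt_integral_of_dominated_of_fderiv_le
        (s := Metric.ball e 1) (bound := fun _ => C) (F := fun e s => H (e, s))
        (F' := fun e s => H' (e, s)) (Metric.ball_mem_nhds e one_pos)
        (Filter.Eventually.of_forall fun e => (cH e).aestronglyMeasurable)
        ((cH e).intervalIntegrable _ _) (cH' e).aestronglyMeasurable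
        (Filter.Eventually.of_forall fun s hs x hx => ?_) (by simp)
        (Filter.Eventually.of_forall fun s _ x _ => hder x s))
      rw [Set.uIoc_of_le zero_le_one] at hs
      exact hC (x, s) ⟨Metric.ball_subset_closedBall hx, hs.1.le, hs.2⟩
    have := contDiff_succ_iff_hasFDerivAt (𝕜 := ℝ) (n := n)
      (f := fun e : E => ∫ s in (0 : ℝ)..1, H (e, s))
    push_cast
    exact this.2 ⟨_, ih hH's, key⟩

theorem contDiff_parametric_integral {E F : Type} [NormedAddCommGroup E] [NormedSpace ℝ E]
    [ProperSpace E] [NormedAddCommGroup F] [NormedSpace ℝ F] [CompleteSpace F] {H : E × ℝ → F}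
    (hH : ContDiff ℝ ∞ H) : ContDiff ℝ ∞ (fun e : E => ∫ s in (0 : ℝ)..1, H (e, s)) :=
  contDiff_infty.2 fun n => contDiff_parametric_integral_nat n hH

/-- Hadamard's lemma with parameters. -/
theorem exists_smooth_quotient {E : Type} [NormedAddCommGroup E] [NormedSpace ℝ E]
    [ProperSpace E] {F : E → ℝ → ℂ} (hF : ContDiff ℝ ∞ (fun p : E × ℝ => F p.1 p.2)) :
    ∃ G : E → ℝ → ℂ, ContDiff ℝ ∞ (fun p : E × ℝ => G p.1 p.2) ∧
      ∀ e t, F e t = F e 0 + t * G e t := by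
  set F' : E × ℝ → ℂ := fun p => iteratedDeriv 1 (F p.1) p.2 with hF'
  have hF's : ContDiff ℝ ∞ F' := by
    rw [← contDiffOn_univ, ← Set.univ_prod_univ]
    exact contDiffOn_iteratedDeriv_param isOpen_univ hF.contDiffOn 1
  refine ⟨fun e t => ∫ s in (0 : ℝ)..1, F' (e, s * t), ?_, fun e t => ?_⟩
  · have h2 : ContDiff ℝ ∞ (fun q : (E × ℝ) × ℝ => F' (q.1.1, q.2 * q.1.2)) :=
      hF's.comp (by fun_prop)
    exact contDiff_parametric_integral h2
  · have hFe : ContDiff ℝ ∞ (F e) := hF.comp (contDiff_const.prodMk contDiff_id)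
    have hd : ∀ s : ℝ, HasDerivAt (fun s : ℝ => F e (s * t)) (t * F' (e, s * t)) s := by
      intro s
      have h1 := (hFe.differentiable (by simp) (s * t)).hasDerivAt
      have h2 := h1.scomp s ((hasDerivAt_id s).mul_const t)
      simpa [hF', iteratedDeriv_one, Function.comp_def] using h2
    have hc : Continuous fun s : ℝ => (t : ℂ) * F' (e, s * t) :=
      continuous_const.mul (hF's.continuous.comp (by fun_prop))
    have := intervalIntegral.integral_eq_sub_of_hasDerivAt (a := 0) (b := 1)
      (fun s _ => hd s) (hc.intervalIntegrable _ _)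
    rw [intervalIntegral.integral_const_mul] at this
    rw [this]
    simp

/-- Leibniz's rule with a linear factor has two terms, and the one that carries `t` dies at the
origin. This relates the Taylor coefficients of a function to those of its Hadamard quotient. -/
theorem iteratedDeriv_id_mul_zero {g : ℝ → ℂ} (hg : ContDiff ℝ ∞ g) (n : ℕ) :
    iteratedDeriv (n + 1) (fun t : ℝ => (t : ℂ) * g t) 0 = (n + 1) * iteratedDeriv n g 0 := by
  have key : ∀ n : ℕ, ∀ t : ℝ, iteratedDeriv (n + 1) (fun t : ℝ => (t : ℂ) * g t) t =
      (n + 1) * iteratedDeriv n g t + t * iteratedDeriv (n + 1) g t := by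
    have hD : ∀ n : ℕ, ∀ t, HasDerivAt (iteratedDeriv n g) (iteratedDeriv (n + 1) g t) t := by
      intro n t
      rw [iteratedDeriv_succ]
      exact (hg.differentiable_iteratedDeriv n (by exact_mod_cast WithTop.coe_lt_top _) t).hasDerivAt
    have hid : ∀ t : ℝ, HasDerivAt (fun t : ℝ => (t : ℂ)) 1 t := fun t =>
      (hasDerivAt_id t).ofReal_comp
    intro n
    induction n with
    | zero =>
      intro t
      rw [iteratedDeriv_one]
      have := ((hid t).mul (hD 0 t)).deriv
      simp only [iteratedDeriv_zero] at this
      rw [show (fun t : ℝ => (t : ℂ) * g t) = (fun t : ℝ => (t : ℂ)) * g from rfl, this]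
      simp
    | succ n ih =>
      intro t
      rw [iteratedDeriv_succ, funext ih]
      have := (((hD n t).const_mul ((n : ℂ) + 1)).add ((hid t).mul (hD (n + 1) t))).deriv
      have e : (fun t : ℝ => ((n : ℂ) + 1) * iteratedDeriv n g t + t * iteratedDeriv (n + 1) g t) =
        (fun t : ℝ => ((n : ℂ) + 1) * iteratedDeriv n g t) +
          (fun t : ℝ => (t : ℂ)) * iteratedDeriv (n + 1) g := rfl
      rw [e, this]
      push_cast
      ring
  simp [key n 0]

/-- Hadamard's quotient is taken `k` times. The point of this form is that the remainder factor is
smooth jointly in the parameter and in `t`. -/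
theorem exists_taylor_param {E : Type} [NormedAddCommGroup E] [NormedSpace ℝ E]
    [ProperSpace E] (k : ℕ) {F : E → ℝ → ℂ}
    (hF : ContDiff ℝ ∞ (fun p : E × ℝ => F p.1 p.2)) :
    ∃ R : E → ℝ → ℂ, ContDiff ℝ ∞ (fun p : E × ℝ => R p.1 p.2) ∧
      ∀ e t, F e t = ∑ c ∈ Finset.range k,
        ((t : ℂ) ^ c / (c.factorial : ℂ)) * iteratedDeriv c (F e) 0 + (t : ℂ) ^ k * R e t := by
  induction k generalizing F with
  | zero => exact ⟨F, hF, fun e t => by simp⟩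
  | succ k ih =>
    obtain ⟨G, hG, hFG⟩ := exists_smooth_quotient hF
    obtain ⟨R, hR, hGR⟩ := ih hG
    refine ⟨R, hR, fun e t => ?_⟩
    have hGe : ContDiff ℝ ∞ (G e) := hG.comp (contDiff_const.prodMk contDiff_id)
    have hder : ∀ c : ℕ, iteratedDeriv (c + 1) (F e) 0 = (c + 1) * iteratedDeriv c (G e) 0 := by
      intro c
      rw [← iteratedDeriv_id_mul_zero hGe, funext (hFG e)]
      rw [iteratedDeriv_const_add c.succ_pos]
    rw [Finset.sum_range_succ', hFG e t, hGR e t]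
    simp only [hder, iteratedDeriv_zero]
    rw [mul_add, Finset.mul_sum, pow_succ]
    have : ∀ c ∈ Finset.range k, (t : ℂ) * ((t : ℂ) ^ c / (c.factorial : ℂ) *
        iteratedDeriv c (G e) 0) = (t : ℂ) ^ (c + 1) / ((c + 1).factorial : ℂ) *
        ((c + 1) * iteratedDeriv c (G e) 0) := by
      intro c _
      have h1 : (c.factorial : ℂ) ≠ 0 := by exact_mod_cast c.factorial_ne_zero
      have h2 : (c : ℂ) + 1 ≠ 0 := by exact_mod_cast c.succ_ne_zero
      rw [Nat.factorial_succ]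
      push_cast
      field_simp
      ring
    rw [Finset.sum_congr rfl this]
    simp
    ring

end Hadamard

/-! ### Jets at the origin of `ℝ³` and the Taylor expansion in monomials -/

section Jets

/-- The algebra `C^∞(ℝ³)`. -/
def Smooth3 : Subalgebra ℂ (ℝ × ℝ × ℝ → ℂ) where
  carrier := {φ | ContDiff ℝ ∞ φ}
  mul_mem' {a b} ha hb := by
    have ha : ContDiff ℝ ∞ a := ha
    have hb : ContDiff ℝ ∞ b := hb
    exact ha.mul hb
  add_mem' {a b} ha hb := by
    have ha : ContDiff ℝ ∞ a := ha
    have hb : ContDiff ℝ ∞ b := hb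
    exact ha.add hb
  algebraMap_mem' r := by
    have : ContDiff ℝ ∞ (fun _ : ℝ × ℝ × ℝ => r) := contDiff_const
    exact this

theorem mem_smooth3 {φ : ℝ × ℝ × ℝ → ℂ} : φ ∈ Smooth3 ↔ ContDiff ℝ ∞ φ := Iff.rfl

/-- The iterated partial derivative `∂_x^a ∂_y^b ∂_z^c φ (0)`. -/
def jetFun (a b c : ℕ) (φ : ℝ × ℝ × ℝ → ℂ) : ℂ :=
  iteratedDeriv a (fun x => iteratedDeriv b (fun y => iteratedDeriv c (fun z => φ (x, y, z)) 0) 0) 0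

theorem contDiff_inner_jet {φ : ℝ × ℝ × ℝ → ℂ} (hφ : ContDiff ℝ ∞ φ) (c : ℕ) :
    ContDiff ℝ ∞ (fun p : ℝ × ℝ => iteratedDeriv c (fun z => φ (p.1, p.2, z)) 0) :=
  contDiff_iteratedDeriv_param_at (F := fun (p : ℝ × ℝ) z => φ (p.1, p.2, z))
    (hφ.comp (by fun_prop)) c 0

theorem contDiff_middle_jet {φ : ℝ × ℝ × ℝ → ℂ} (hφ : ContDiff ℝ ∞ φ) (b c : ℕ) :
    ContDiff ℝ ∞ (fun x : ℝ =>
      iteratedDeriv b (fun y => iteratedDeriv c (fun z => φ (x, y, z)) 0) 0) :=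
  contDiff_iteratedDeriv_param_at
    (F := fun (x : ℝ) y => iteratedDeriv c (fun z => φ (x, y, z)) 0) (contDiff_inner_jet hφ c) b 0

theorem contDiff_slice_z {φ : ℝ × ℝ × ℝ → ℂ} (hφ : ContDiff ℝ ∞ φ) (x y : ℝ) :
    ContDiff ℝ ∞ (fun z => φ (x, y, z)) := hφ.comp (by fun_prop)

theorem contDiff_slice_y {φ : ℝ × ℝ × ℝ → ℂ} (hφ : ContDiff ℝ ∞ φ) (c : ℕ) (x : ℝ) :
    ContDiff ℝ ∞ (fun y => iteratedDeriv c (fun z => φ (x, y, z)) 0) :=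
  (contDiff_inner_jet hφ c).comp (g := fun p : ℝ × ℝ => iteratedDeriv c (fun z => φ (p.1, p.2, z)) 0)
    (f := fun y => (x, y)) (by fun_prop)

theorem _root_.ContDiff.contDiffAt_nat {f : ℝ → ℂ} (hf : ContDiff ℝ ∞ f) (n : ℕ) (t : ℝ) :
    ContDiffAt ℝ n f t := (hf.of_le (by exact_mod_cast le_top)).contDiffAt

/-- `φ ↦ ∂_x^a ∂_y^b ∂_z^c φ (0)` as a linear functional on `C^∞(ℝ³)`. -/
def jet (a b c : ℕ) : Smooth3 →ₗ[ℂ] ℂ where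
  toFun φ := jetFun a b c φ
  map_add' φ ψ := by
    have hφ : ContDiff ℝ ∞ φ.1 := φ.2
    have hψ : ContDiff ℝ ∞ ψ.1 := ψ.2
    simp only [jetFun]
    have h1 : ∀ x y, iteratedDeriv c (fun z => (φ + ψ).1 (x, y, z)) 0 =
        iteratedDeriv c (fun z => φ.1 (x, y, z)) 0 + iteratedDeriv c (fun z => ψ.1 (x, y, z)) 0 :=
      fun x y => iteratedDeriv_fun_add ((contDiff_slice_z hφ x y).contDiffAt_nat c 0)
        ((contDiff_slice_z hψ x y).contDiffAt_nat c 0)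
    simp only [h1]
    have h2 := fun x => iteratedDeriv_fun_add ((contDiff_slice_y hφ c x).contDiffAt_nat b 0)
        ((contDiff_slice_y hψ c x).contDiffAt_nat b 0)
    simp only [h2]
    exact iteratedDeriv_fun_add ((contDiff_middle_jet hφ b c).contDiffAt_nat a 0)
        ((contDiff_middle_jet hψ b c).contDiffAt_nat a 0)
  map_smul' r φ := by
    simp only [jetFun, RingHom.id_apply, smul_eq_mul]
    have : ∀ v, (r • φ).1 v = r * φ.1 v := fun v => rfl
    simp only [this, iteratedDeriv_const_mul_field]

theorem jet_apply (a b c : ℕ) (φ : Smooth3) : jet a b c φ = jetFun a b c φ := rfl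

theorem jetFun_congr {φ ψ : ℝ × ℝ × ℝ → ℂ} (h : φ =ᶠ[nhds 0] ψ) (a b c : ℕ) :
    jetFun a b c φ = jetFun a b c ψ := by
  have h0 : ∀ᶠ p : ℝ × ℝ × ℝ in nhds ((0 : ℝ), (0 : ℝ), (0 : ℝ)), φ p = ψ p := h
  have h1 := (nhds_prod_eq (X := ℝ) (Y := ℝ × ℝ) ▸ h0).curry
  refine Filter.EventuallyEq.iteratedDeriv_eq a ?_
  filter_upwards [h1] with x hx
  have h2 := (nhds_prod_eq (X := ℝ) (Y := ℝ) ▸ hx).curry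
  refine Filter.EventuallyEq.iteratedDeriv_eq b ?_
  filter_upwards [h2] with y hy
  exact Filter.EventuallyEq.iteratedDeriv_eq c hy

theorem jet_congr {φ ψ : Smooth3} (h : φ.1 =ᶠ[nhds 0] ψ.1) (a b c : ℕ) :
    jet a b c φ = jet a b c ψ := jetFun_congr h a b c

/-- The coordinate function `x`. -/
def coordX : Smooth3 :=
  ⟨fun v => (v.1 : ℂ), mem_smooth3.2 (Complex.ofRealCLM.contDiff.comp contDiff_fst)⟩

/-- The coordinate function `y`. -/
def coordY : Smooth3 :=
  ⟨fun v => (v.2.1 : ℂ), mem_smooth3.2 (Complex.ofRealCLM.contDiff.comp (contDiff_fst.comp contDiff_snd))⟩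

/-- The coordinate function `z`. -/
def coordZ : Smooth3 :=
  ⟨fun v => (v.2.2 : ℂ), mem_smooth3.2 (Complex.ofRealCLM.contDiff.comp (contDiff_snd.comp contDiff_snd))⟩

/-- The monomial `x^a y^b z^c`. -/
def mono (a b c : ℕ) : Smooth3 := coordX ^ a * coordY ^ b * coordZ ^ c

theorem mono_apply (a b c : ℕ) (v : ℝ × ℝ × ℝ) :
    (mono a b c).1 v = (v.1 : ℂ) ^ a * (v.2.1 : ℂ) ^ b * (v.2.2 : ℂ) ^ c := rfl

theorem iteratedDeriv_ofReal_pow_zero (n m : ℕ) :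
    iteratedDeriv n (fun t : ℝ => (t : ℂ) ^ m) 0 = if n = m then (n.factorial : ℂ) else 0 := by
  induction m generalizing n with
  | zero =>
    cases n with
    | zero => simp
    | succ n => simp [iteratedDeriv_const]
  | succ m ih =>
    cases n with
    | zero => simp
    | succ n =>
      have : ContDiff ℝ ∞ (fun t : ℝ => (t : ℂ) ^ m) := Complex.ofRealCLM.contDiff.pow m
      have h := iteratedDeriv_id_mul_zero this n
      simp only [← pow_succ'] at h
      rw [h, ih]
      by_cases hnm : n = m
      · simp [hnm, Nat.factorial_succ]
      · simp [hnm]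

theorem jet_mono (a b c a' b' c' : ℕ) : jet a b c (mono a' b' c') =
    if a = a' ∧ b = b' ∧ c = c' then (a.factorial : ℂ) * b.factorial * c.factorial else 0 := by
  simp only [jet_apply, jetFun, mono_apply, iteratedDeriv_const_mul_field,
    iteratedDeriv_mul_const_field, iteratedDeriv_ofReal_pow_zero]
  by_cases h1 : a = a' <;> by_cases h2 : b = b' <;> by_cases h3 : c = c' <;> simp [h1, h2, h3]

/-- Expand in `z`, then the coefficients in `y`, then theirs in `x`. Truncating each exponent
separately leaves a remainder in the ideal generated by `x^k, y^k, z^k`, and each of these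
generators is an eigenvector of the dilations. -/
theorem exists_taylor3 (k : ℕ) (φ : Smooth3) : ∃ ψ₁ ψ₂ ψ₃ : Smooth3,
    φ = ∑ c ∈ Finset.range k, ∑ b ∈ Finset.range k, ∑ a ∈ Finset.range k,
      (jet a b c φ / ((a.factorial : ℂ) * b.factorial * c.factorial)) • mono a b c +
      coordX ^ k * ψ₁ + coordY ^ k * ψ₂ + coordZ ^ k * ψ₃ := by
  have hφ : ContDiff ℝ ∞ φ.1 := φ.2
  obtain ⟨R₃, hR₃, h₃⟩ := exists_taylor_param k (F := fun (p : ℝ × ℝ) z => φ.1 (p.1, p.2, z))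
    (hφ.comp (by fun_prop))
  have hy := fun c => exists_taylor_param k
    (F := fun (x : ℝ) y => iteratedDeriv c (fun z => φ.1 (x, y, z)) 0) (contDiff_inner_jet hφ c)
  choose R₂ hR₂ h₂ using hy
  -- No parameter is left at this stage; a dummy real one is carried along and later set to `0`.
  have hx := fun b c => exists_taylor_param k (F := fun (_ : ℝ) x =>
    iteratedDeriv b (fun y => iteratedDeriv c (fun z => φ.1 (x, y, z)) 0) 0)
    ((contDiff_middle_jet hφ b c).comp contDiff_snd)
  choose R₁ hR₁ h₁ using hx
  have cre : ContDiff ℝ ∞ (fun t : ℝ => (t : ℂ)) := Complex.ofRealCLM.contDiff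
  refine ⟨⟨fun v => ∑ c ∈ Finset.range k, ∑ b ∈ Finset.range k,
      (v.2.1 : ℂ) ^ b / (b.factorial : ℂ) * ((v.2.2 : ℂ) ^ c / (c.factorial : ℂ)) *
        R₁ b c 0 v.1, ?_⟩,
    ⟨fun v => ∑ c ∈ Finset.range k, (v.2.2 : ℂ) ^ c / (c.factorial : ℂ) * R₂ c v.1 v.2.1, ?_⟩,
    ⟨fun v => R₃ (v.1, v.2.1) v.2.2, ?_⟩, ?_⟩
  · refine mem_smooth3.2 (ContDiff.sum fun c _ => ContDiff.sum fun b _ => ?_)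
    refine ContDiff.mul (ContDiff.mul ?_ ?_) ?_
    · exact ((cre.comp (contDiff_fst.comp contDiff_snd)).pow b).div_const _
    · exact ((cre.comp (contDiff_snd.comp contDiff_snd)).pow c).div_const _
    · exact (hR₁ b c).comp (contDiff_const.prodMk contDiff_fst)
  · refine mem_smooth3.2 (ContDiff.sum fun c _ => ?_)
    refine ContDiff.mul ?_ ?_
    · exact ((cre.comp (contDiff_snd.comp contDiff_snd)).pow c).div_const _
    · exact (hR₂ c).comp (f := fun v : ℝ × ℝ × ℝ => (v.1, v.2.1)) (by fun_prop)
  · exact hR₃.comp (f := fun v : ℝ × ℝ × ℝ => ((v.1, v.2.1), v.2.2)) (by fun_prop)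
  · apply Subtype.ext
    funext ⟨x, y, z⟩
    have e0 : φ.1 (x, y, z) = ∑ c ∈ Finset.range k, ((z : ℂ) ^ c / (c.factorial : ℂ)) *
        (∑ b ∈ Finset.range k, ((y : ℂ) ^ b / (b.factorial : ℂ)) *
          (∑ a ∈ Finset.range k, ((x : ℂ) ^ a / (a.factorial : ℂ)) * jet a b c φ +
            (x : ℂ) ^ k * R₁ b c 0 x) + (y : ℂ) ^ k * R₂ c x y) +
        (z : ℂ) ^ k * R₃ (x, y) z := by
      refine (h₃ (x, y) z).trans ?_
      congr 1
      refine Finset.sum_congr rfl fun c _ => ?_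
      congr 1
      refine (h₂ c x y).trans ?_
      congr 1
      refine Finset.sum_congr rfl fun b _ => ?_
      congr 1
      exact h₁ b c 0 x
    have e1 : ∀ (s : Finset ℕ) (g : ℕ → Smooth3) (v : ℝ × ℝ × ℝ),
        (∑ i ∈ s, g i).1 v = ∑ i ∈ s, (g i).1 v := by
      intro s g v
      have := congrFun (AddSubmonoidClass.coe_finsetSum g s) v
      rwa [Finset.sum_apply] at this
    rw [e0]
    change _ = (∑ c ∈ Finset.range k, ∑ b ∈ Finset.range k, ∑ a ∈ Finset.range k,
      (jet a b c φ / ((a.factorial : ℂ) * b.factorial * c.factorial)) • mono a b c).1 (x, y, z) +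
      (x : ℂ) ^ k * _ + (y : ℂ) ^ k * _ + (z : ℂ) ^ k * _
    simp only [e1]
    have e2 : ∀ (r : ℂ) (g : Smooth3) v, (r • g).1 v = r * g.1 v := fun _ _ _ => rfl
    simp only [e2, mono_apply, mul_add, Finset.sum_add_distrib, Finset.mul_sum]
    congr 1
    congr 1
    · congr 1
      · refine Finset.sum_congr rfl fun c _ => Finset.sum_congr rfl fun b _ =>
          Finset.sum_congr rfl fun a _ => ?_
        ring
      · refine Finset.sum_congr rfl fun c _ => Finset.sum_congr rfl fun b _ => ?_
        ring
    · refine Finset.sum_congr rfl fun c _ => ?_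
      ring

end Jets

/-! ### Local functionals that are homogeneous under a contraction -/

section Homogeneous

/-- The linear map `(x, y, z) ↦ (a x, b y, c z)`. -/
def diagCLM (a b c : ℝ) : ℝ × ℝ × ℝ →L[ℝ] ℝ × ℝ × ℝ :=
  (a • ContinuousLinearMap.id ℝ ℝ).prodMap
    ((b • ContinuousLinearMap.id ℝ ℝ).prodMap (c • ContinuousLinearMap.id ℝ ℝ))

@[simp] theorem diagCLM_apply (a b c : ℝ) (v : ℝ × ℝ × ℝ) :
    diagCLM a b c v = (a * v.1, b * v.2.1, c * v.2.2) := rfl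

/-- Precomposition with `diagCLM a b c` on `C^∞(ℝ³)`. -/
def dilate (a b c : ℝ) : Smooth3 →ₗ[ℂ] Smooth3 where
  toFun φ := ⟨fun v => φ.1 (diagCLM a b c v),
    mem_smooth3.2 ((mem_smooth3.1 φ.2).comp (diagCLM a b c).contDiff)⟩
  map_add' _ _ := rfl
  map_smul' _ _ := rfl

theorem dilate_apply (a b c : ℝ) (φ : Smooth3) (v : ℝ × ℝ × ℝ) :
    (dilate a b c φ).1 v = φ.1 (a * v.1, b * v.2.1, c * v.2.2) := rfl

theorem dilate_mul (a b c : ℝ) (φ ψ : Smooth3) :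
    dilate a b c (φ * ψ) = dilate a b c φ * dilate a b c ψ := rfl

theorem dilate_mono (α β γ : ℝ) (a b c : ℕ) :
    dilate α β γ (mono a b c) = ((α : ℂ) ^ a * (β : ℂ) ^ b * (γ : ℂ) ^ c) • mono a b c := by
  apply Subtype.ext
  funext v
  change (mono a b c).1 (α * v.1, β * v.2.1, γ * v.2.2) =
    ((α : ℂ) ^ a * (β : ℂ) ^ b * (γ : ℂ) ^ c) * (mono a b c).1 v
  simp only [mono_apply]
  push_cast
  ring

/-- A linear functional on `C^∞(ℝ³)` which depends only on the germ at the origin. -/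
def IsLocal (L : Smooth3 →ₗ[ℂ] ℂ) : Prop := ∀ φ : Smooth3, φ.1 =ᶠ[nhds 0] 0 → L φ = 0

theorem IsLocal.congr {L : Smooth3 →ₗ[ℂ] ℂ} (hL : IsLocal L) {φ ψ : Smooth3}
    (h : φ.1 =ᶠ[nhds 0] ψ.1) : L φ = L ψ := by
  rw [← sub_eq_zero, ← map_sub]
  refine hL _ ?_
  filter_upwards [h] with v hv
  change φ.1 v - ψ.1 v = 0
  rw [hv, sub_self]

/-- A fixed cut-off function that is `1` near the origin. -/
def cutoffBump : ContDiffBump (0 : ℝ × ℝ × ℝ) := ⟨1, 2, one_pos, one_lt_two⟩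

/-- The cut-off function as an element of `C^∞(ℝ³)`. -/
def cutoff : Smooth3 := ⟨fun v => (cutoffBump v : ℂ),
  mem_smooth3.2 (Complex.ofRealCLM.contDiff.comp cutoffBump.contDiff)⟩

theorem cutoff_eventuallyEq_one : cutoff.1 =ᶠ[nhds 0] 1 := by
  filter_upwards [cutoffBump.eventuallyEq_one] with v hv
  change (cutoffBump v : ℂ) = 1
  rw [hv]
  simp

theorem cutoff_mul_eventuallyEq (φ : Smooth3) : (cutoff * φ).1 =ᶠ[nhds 0] φ.1 := by
  filter_upwards [cutoff_eventuallyEq_one] with v hv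
  change cutoff.1 v * φ.1 v = φ.1 v
  rw [hv]
  simp

theorem hasCompactSupport_cutoff_mul (φ : Smooth3) : HasCompactSupport (cutoff * φ).1 := by
  have h : HasCompactSupport cutoff.1 :=
    cutoffBump.hasCompactSupport.comp_left (g := fun t : ℝ => (t : ℂ)) (by simp)
  exact h.mul_right

theorem norm_diagCLM_le {a b c : ℝ} (ha : |a| ≤ 1) (hb : |b| ≤ 1) (hc : |c| ≤ 1) :
    ‖diagCLM a b c‖ ≤ 1 := by
  refine ContinuousLinearMap.opNorm_le_bound _ zero_le_one fun v => ?_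
  have h : ∀ s t : ℝ, |s| ≤ 1 → ‖s * t‖ ≤ ‖t‖ := fun s t hs => by
    rw [norm_mul]
    exact mul_le_of_le_one_left (norm_nonneg t) hs
  simp only [diagCLM_apply, one_mul, Prod.norm_def]
  exact max_le_max (h _ _ ha) (max_le_max (h _ _ hb) (h _ _ hc))

/-- The solution is `u = ∑ r^n ψ ∘ δ^n`, where `δ` is the dilation. Compact support bounds every
derivative of `ψ`, and composing with a contraction does not enlarge these bounds, so all
differentiated series are dominated by geometric ones. -/
theorem exists_sum_dilates {ψ : Smooth3} (hψ : HasCompactSupport ψ.1) {r : ℂ} (hr : ‖r‖ < 1) :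
    ∃ u : Smooth3, u = ψ + r • dilate (1 / 2) (1 / 2) (1 / 4) u := by
  set δ : ℕ → (ℝ × ℝ × ℝ →L[ℝ] ℝ × ℝ × ℝ) := fun n =>
    diagCLM ((1 / 2) ^ n) ((1 / 2) ^ n) ((1 / 4) ^ n) with hδ
  have hδn : ∀ n, ‖δ n‖ ≤ 1 := by
    intro n
    have h2 : |((1 : ℝ) / 2) ^ n| ≤ 1 := by
      rw [abs_of_nonneg (by positivity)]; exact pow_le_one₀ (by norm_num) (by norm_num)
    have h4 : |((1 : ℝ) / 4) ^ n| ≤ 1 := by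
      rw [abs_of_nonneg (by positivity)]; exact pow_le_one₀ (by norm_num) (by norm_num)
    exact norm_diagCLM_le h2 h2 h4
  have hψs : ContDiff ℝ ∞ ψ.1 := ψ.2
  have hb : ∀ k : ℕ, ∃ C, ∀ v, ‖iteratedFDeriv ℝ k ψ.1 v‖ ≤ C := fun k =>
    (hψs.continuous_iteratedFDeriv (m := k) (by exact_mod_cast le_top)).bounded_above_of_compact_support
      (hψ.iteratedFDeriv k)
  choose C hC using hb
  set f : ℕ → ℝ × ℝ × ℝ → ℂ := fun n v => r ^ n • ψ.1 (δ n v) with hf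
  have hfs : ∀ n, ContDiff ℝ ∞ (f n) := fun n => (hψs.comp (δ n).contDiff).const_smul _
  have hbound : ∀ (k n : ℕ) (v : ℝ × ℝ × ℝ), ‖iteratedFDeriv ℝ k (f n) v‖ ≤ ‖r‖ ^ n * C k := by
    intro k n v
    have hcd : ContDiff ℝ k (fun v => ψ.1 (δ n v)) :=
      (hψs.comp (δ n).contDiff).of_le (by exact_mod_cast le_top)
    have e1 : iteratedFDeriv ℝ k (f n) v = r ^ n • iteratedFDeriv ℝ k (fun v => ψ.1 (δ n v)) v :=
      iteratedFDeriv_const_smul_apply (a := r ^ n) hcd.contDiffAt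
    rw [e1, norm_smul, norm_pow]
    refine mul_le_mul_of_nonneg_left ?_ (by positivity)
    have e2 := (δ n).iteratedFDeriv_comp_right (i := k) (n := ∞) hψs v (by exact_mod_cast le_top)
    rw [show (fun v => ψ.1 (δ n v)) = ψ.1 ∘ (δ n) from rfl, e2]
    refine (ContinuousMultilinearMap.norm_compContinuousLinearMap_le _ _).trans ?_
    refine (mul_le_of_le_one_right (norm_nonneg _) ?_).trans (hC k _)
    exact Finset.prod_le_one (fun _ _ => norm_nonneg _) fun _ _ => hδn n
  have hsumm : ∀ k : ℕ, Summable fun n => ‖r‖ ^ n * C k := fun k =>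
    (summable_geometric_of_lt_one (norm_nonneg r) hr).mul_right _
  have hu : ContDiff ℝ ∞ (fun v => ∑' n, f n v) :=
    contDiff_tsum (N := ⊤) hfs (fun k _ => hsumm k) (fun k n v _ => hbound k n v)
  refine ⟨⟨_, mem_smooth3.2 hu⟩, ?_⟩
  apply Subtype.ext
  funext v
  change ∑' n, f n v = ψ.1 v + r * ∑' n, f n (diagCLM (1 / 2) (1 / 2) (1 / 4) v)
  have hs : Summable fun n => f n v := by
    refine Summable.of_norm_bounded (hsumm 0) fun n => ?_
    simpa using hbound 0 n v
  rw [hs.tsum_eq_zero_add, ← tsum_mul_left]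
  congr 1
  · simp [hf, hδ]
  · congr 1
    funext n
    simp only [hf, hδ, diagCLM_apply, smul_eq_mul]
    rw [pow_succ']
    rw [mul_assoc]
    congr 2
    refine congrArg ψ.1 (Prod.ext ?_ (Prod.ext ?_ ?_)) <;> simp only [] <;> ring

/-- This is the substitute for continuity. Solve `u = ψ + (t/q) u ∘ δ`, with `ψ` cut off, and
multiply by `q m`: since `t m = m ∘ δ`, the last term becomes `(m u) ∘ δ`, on which `L` has the
value `q L(m u)`. That cancels the left side and leaves `q L(m ψ) = 0`. -/
theorem map_mul_eq_zero_of_homogeneous {L : Smooth3 →ₗ[ℂ] ℂ} (hL : IsLocal L) {q : ℂ} (hq : q ≠ 0)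
    (hδ : ∀ φ, L (dilate (1 / 2) (1 / 2) (1 / 4) φ) = q * L φ) {m : Smooth3} {t : ℂ}
    (hm : dilate (1 / 2) (1 / 2) (1 / 4) m = t • m) (ht : ‖t‖ < ‖q‖) (ψ : Smooth3) :
    L (m * ψ) = 0 := by
  have hr : ‖t / q‖ < 1 := by
    rw [norm_div, div_lt_one (norm_pos_iff.2 hq)]
    exact ht
  obtain ⟨u, hu⟩ := exists_sum_dilates (hasCompactSupport_cutoff_mul ψ) hr
  have h1 : L (m * ψ) = L (m * (cutoff * ψ)) := by
    refine hL.congr ?_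
    filter_upwards [cutoff_mul_eventuallyEq ψ] with v hv
    change m.1 v * ψ.1 v = m.1 v * (cutoff * ψ).1 v
    rw [hv]
  have h2 : q • (m * u) = q • (m * (cutoff * ψ)) + dilate (1 / 2) (1 / 2) (1 / 4) (m * u) := by
    rw [dilate_mul, hm]
    conv_lhs => rw [hu]
    rw [mul_add, smul_add, mul_smul_comm, smul_smul, mul_div_cancel₀ _ hq, smul_mul_assoc]
  have h3 := congrArg L h2
  rw [map_add, hδ, map_smul, map_smul, smul_eq_mul, smul_eq_mul] at h3
  rw [h1]
  have h4 : q * L (m * (cutoff * ψ)) = 0 := by linear_combination -h3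
  exact (mul_eq_zero.1 h4).resolve_left hq

/-- A linear functional on germs at the origin of `ℝ³` that is homogeneous for a contraction is a
combination of finitely many derivatives at the origin. -/
theorem exists_eq_sum_jets {L : Smooth3 →ₗ[ℂ] ℂ} (hL : IsLocal L) {q : ℂ} (hq : q ≠ 0)
    (hδ : ∀ φ, L (dilate (1 / 2) (1 / 2) (1 / 4) φ) = q * L φ) :
    ∃ k₀ : ℕ, ∀ k ≥ k₀, ∀ φ : Smooth3, L φ =
      ∑ c ∈ Finset.range k, ∑ b ∈ Finset.range k, ∑ a ∈ Finset.range k,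
        jet a b c φ / ((a.factorial : ℂ) * b.factorial * c.factorial) * L (mono a b c) := by
  -- From `k₀` on, the eigenvalues `2^(-k)` of `x^k`, `y^k` and `4^(-k)` of `z^k` are smaller than
  -- `‖q‖`.
  obtain ⟨k₀, hk₀⟩ := exists_pow_lt_of_lt_one (norm_pos_iff.2 hq) (by norm_num : (1 : ℝ) / 2 < 1)
  refine ⟨k₀, fun k hkk φ => ?_⟩
  have hk : ((1 : ℝ) / 2) ^ k < ‖q‖ :=
    (pow_le_pow_of_le_one (by norm_num) (by norm_num) hkk).trans_lt hk₀
  obtain ⟨ψ₁, ψ₂, ψ₃, h⟩ := exists_taylor3 k φ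
  have hX : coordX ^ k = mono k 0 0 := by simp [mono]
  have hY : coordY ^ k = mono 0 k 0 := by simp [mono]
  have hZ : coordZ ^ k = mono 0 0 k := by simp [mono]
  have h4 : ((1 : ℝ) / 4) ^ k ≤ (1 / 2) ^ k := pow_le_pow_left₀ (by norm_num) (by norm_num) k
  have h1 : L (coordX ^ k * ψ₁) = 0 := by
    refine map_mul_eq_zero_of_homogeneous hL hq hδ (by rw [hX, dilate_mono]) ?_ ψ₁
    simpa using hk
  have h2 : L (coordY ^ k * ψ₂) = 0 := by
    refine map_mul_eq_zero_of_homogeneous hL hq hδ (by rw [hY, dilate_mono]) ?_ ψ₂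
    simpa using hk
  have h3 : L (coordZ ^ k * ψ₃) = 0 := by
    refine map_mul_eq_zero_of_homogeneous hL hq hδ (by rw [hZ, dilate_mono]) ?_ ψ₃
    have := h4.trans_lt hk
    simpa using this
  conv_lhs => rw [h]
  rw [map_add, map_add, map_add, h1, h2, h3]
  simp only [map_sum, map_smul, smul_eq_mul, add_zero]

end Homogeneous

/-! ### The characters `|x|_ε^μ` of `ℝ^×` -/

section SignedPow

theorem signedPow_mul (ε : ZMod 2) (μ : ℂ) {x y : ℝ} :
    signedPow ε μ (x * y) = signedPow ε μ x * signedPow ε μ y := by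
  have h : ((|x * y| : ℝ) : ℂ) ^ μ = ((|x| : ℝ) : ℂ) ^ μ * ((|y| : ℝ) : ℂ) ^ μ := by
    rw [abs_mul, Complex.ofReal_mul,
      Complex.mul_cpow_ofReal_nonneg (abs_nonneg x) (abs_nonneg y)]
  have hs : Real.sign (x * y) = Real.sign x * Real.sign y := by
    rcases lt_trichotomy x 0 with hx | hx | hx <;> rcases lt_trichotomy y 0 with hy | hy | hy <;>
      simp [hx, hy, Real.sign_of_neg, Real.sign_of_pos, mul_pos_of_neg_of_neg, mul_neg_of_neg_of_pos,
        mul_neg_of_pos_of_neg]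
  unfold signedPow
  rw [h, hs]
  split_ifs
  · ring
  · push_cast; ring

theorem signedPow_one (ε : ZMod 2) (μ : ℂ) : signedPow ε μ 1 = 1 := by
  simp [signedPow]

theorem signedPow_ne_zero (ε : ZMod 2) (μ : ℂ) {x : ℝ} (hx : x ≠ 0) : signedPow ε μ x ≠ 0 := by
  unfold signedPow
  refine mul_ne_zero ?_ ?_
  · split_ifs
    · exact one_ne_zero
    · rcases hx.lt_or_gt with h | h
      · simp [Real.sign_of_neg h]
      · simp [Real.sign_of_pos h]
  · rw [Complex.cpow_ne_zero_iff]
    left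
    exact_mod_cast (abs_pos.2 hx).ne'

theorem signedPow_of_pos (ε : ZMod 2) (μ : ℂ) {x : ℝ} (hx : 0 < x) :
    signedPow ε μ x = Complex.exp (μ * (Real.log x : ℝ)) := by
  unfold signedPow
  rw [Real.sign_of_pos hx, abs_of_pos hx, Complex.cpow_def_of_ne_zero (by exact_mod_cast hx.ne'),
    ← Complex.ofReal_log hx.le, mul_comm μ]
  simp

/-- Multiplicativity moves the question to the positive number `y / x` near `1`, where the character
is `exp(μ log ·)` and the sign plays no role. -/
theorem contDiffAt_signedPow (ε : ZMod 2) (μ : ℂ) {x : ℝ} (hx : x ≠ 0) :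
    ContDiffAt ℝ ∞ (signedPow ε μ) x := by
  have h1 : ContDiffAt ℝ ∞ (fun y : ℝ => signedPow ε μ x * Complex.exp (μ * (Real.log (y / x) : ℝ))) x := by
    refine contDiffAt_const.mul (ContDiffAt.cexp (contDiffAt_const.mul ?_))
    refine Complex.ofRealCLM.contDiff.contDiffAt.comp x ?_
    exact ContDiffAt.log (contDiffAt_id.div_const x) (by simp [hx])
  refine h1.congr_of_eventuallyEq ?_
  have h2 : ∀ᶠ y : ℝ in nhds x, 0 < y / x := by
    have : ContinuousAt (fun y : ℝ => y / x) x := by fun_prop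
    exact this.eventually (lt_mem_nhds (by simp [hx]))
  filter_upwards [h2] with y hy
  rw [← signedPow_of_pos ε μ hy, ← signedPow_mul, mul_div_cancel₀ _ hx]

end SignedPow

/-! ### The open cell `x_1 N̄ P_G` and sections supported in it -/

section BigCell

/-- The leading `2 × 2` minor. -/
def minor2 (A : Matrix (Fin 3) (Fin 3) ℝ) : ℝ := A 0 0 * A 1 1 - A 0 1 * A 1 0

/-- The `2 × 2` minor of the first two columns and the rows `0, 2`. -/
def minor2' (A : Matrix (Fin 3) (Fin 3) ℝ) : ℝ := A 0 0 * A 2 1 - A 0 1 * A 2 0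

/-- The coordinates `(x, y, z)` of `A = n̄(x, y, z) p` with `p` upper triangular. -/
def cellCoord (A : Matrix (Fin 3) (Fin 3) ℝ) : ℝ × ℝ × ℝ :=
  (A 1 0 / A 0 0, minor2' A / minor2 A, A 2 0 / A 0 0)

/-- The character of the principal series at the upper triangular part of `A`. -/
def cellFactor (ξ : Fin 3 → ZMod 2) (lam : Fin 3 → ℂ) (A : Matrix (Fin 3) (Fin 3) ℝ) : ℂ :=
  signedPow (ξ 0) (-lam 0 - rho 3 0) (A 0 0) *
    signedPow (ξ 1) (-lam 1 - rho 3 1) (minor2 A / A 0 0) *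
    signedPow (ξ 2) (-lam 2 - rho 3 2) (A.det / minor2 A)

theorem x1_coe : (x1 : Matrix (Fin 3) (Fin 3) ℝ) = !![1, 0, 0; 0, 0, 1; 0, 1, 0] := rfl

theorem nbar_coe (x y z : ℝ) :
    (nbar x y z : Matrix (Fin 3) (Fin 3) ℝ) = !![1, 0, 0; x, 1, 0; z, y, 1] := rfl

theorem nbar_zero : nbar 0 0 0 = 1 := by
  apply Units.ext
  rw [nbar_coe]
  ext i j
  fin_cases i <;> fin_cases j <;> simp

theorem nbar_inv (x y z : ℝ) : (nbar x y z)⁻¹ = nbar (-x) (-y) (x * y - z) := by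
  rw [inv_eq_iff_mul_eq_one]
  apply Units.ext
  rw [Units.val_mul, nbar_coe, nbar_coe]
  ext i j
  fin_cases i <;> fin_cases j <;> simp [Matrix.mul_apply, Fin.sum_univ_succ]
  ring

theorem continuous_nbar : Continuous fun v : ℝ × ℝ × ℝ => nbar v.1 v.2.1 v.2.2 := by
  have h : Continuous fun v : ℝ × ℝ × ℝ =>
      (!![1, 0, 0; v.1, 1, 0; v.2.2, v.2.1, 1] : Matrix (Fin 3) (Fin 3) ℝ) := by
    refine continuous_matrix fun i j => ?_
    fin_cases i <;> fin_cases j <;> simp <;> fun_prop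
  refine Units.continuous_iff.2 ⟨h, ?_⟩
  simp only [nbar_inv]
  exact h.comp (f := fun v : ℝ × ℝ × ℝ => (-v.1, -v.2.1, v.1 * v.2.1 - v.2.2)) (by fun_prop)

variable {ξ : Fin 3 → ZMod 2} {lam : Fin 3 → ℂ}

/-- This is the LU decomposition of `x1 * g`: the diagonal of the upper triangular factor consists
of quotients of successive leading minors. -/
theorem apply_eq_cellFactor_mul (f : principalSeries 3 ξ lam) {g : GLR 3}
    {A : Matrix (Fin 3) (Fin 3) ℝ} (hA : ((x1 * g : GLR 3) : Matrix (Fin 3) (Fin 3) ℝ) = A)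
    (h1 : A 0 0 ≠ 0) (h2 : minor2 A ≠ 0) :
    f.1 g = cellFactor ξ lam A *
      f.1 (x1 * nbar (cellCoord A).1 (cellCoord A).2.1 (cellCoord A).2.2) := by
  set n := nbar (cellCoord A).1 (cellCoord A).2.1 (cellCoord A).2.2 with hn
  set p : GLR 3 := n⁻¹ * (x1 * g) with hp
  have hg : g = x1 * n * p := by
    rw [hp, mul_assoc, mul_inv_cancel_left, ← mul_assoc, x1_mul_x1, one_mul]
  have hpm : (p : Matrix (Fin 3) (Fin 3) ℝ) =
      !![A 0 0, A 0 1, A 0 2; 0, minor2 A / A 0 0, A 1 2 - A 1 0 / A 0 0 * A 0 2;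
        0, 0, A.det / minor2 A] := by
    have hnP : (n : Matrix (Fin 3) (Fin 3) ℝ) *
        !![A 0 0, A 0 1, A 0 2; 0, minor2 A / A 0 0, A 1 2 - A 1 0 / A 0 0 * A 0 2;
          0, 0, A.det / minor2 A] = A := by
      rw [hn, nbar_coe, Matrix.det_fin_three]
      ext i j
      fin_cases i <;> fin_cases j <;>
        simp [Matrix.mul_apply, Fin.sum_univ_succ, cellCoord] <;>
        field_simp <;> simp only [minor2, minor2'] <;> ring
    rw [hp, Units.val_mul, hA]
    conv_lhs => rw [← hnP]
    rw [← mul_assoc, ← Units.val_mul, inv_mul_cancel, Units.val_one, one_mul]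
  have hpb : p ∈ borel 3 := by
    change (p : Matrix (Fin 3) (Fin 3) ℝ).BlockTriangular id
    rw [hpm]
    intro i j hij
    fin_cases i <;> fin_cases j <;> first | rfl | exact absurd hij (by decide)
  conv_lhs => rw [hg]
  rw [f.2.2 _ _ hpb]
  congr 1
  rw [inducingFactor, Fin.prod_univ_three, hpm]
  rfl

/-- The section with prescribed values on the open cell `n̄(x, y, z) P`, extended by zero. -/
def cellExtend (ξ : Fin 3 → ZMod 2) (lam : Fin 3 → ℂ) (φ : ℝ × ℝ × ℝ → ℂ)
    (A : Matrix (Fin 3) (Fin 3) ℝ) : ℂ :=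
  open Classical in
  if A 0 0 ≠ 0 ∧ minor2 A ≠ 0 then cellFactor ξ lam A * φ (cellCoord A) else 0

theorem contDiff_entry (i j : Fin 3) :
    ContDiff ℝ ∞ fun A : Fin 3 → Fin 3 → ℝ => (Matrix.of A) i j :=
  contDiff_apply_apply ℝ ℝ i j

theorem contDiff_minor2 : ContDiff ℝ ∞ fun A : Fin 3 → Fin 3 → ℝ => minor2 (Matrix.of A) :=
  ((contDiff_entry 0 0).mul (contDiff_entry 1 1)).sub ((contDiff_entry 0 1).mul (contDiff_entry 1 0))

theorem contDiff_minor2' : ContDiff ℝ ∞ fun A : Fin 3 → Fin 3 → ℝ => minor2' (Matrix.of A) :=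
  ((contDiff_entry 0 0).mul (contDiff_entry 2 1)).sub ((contDiff_entry 0 1).mul (contDiff_entry 2 0))

theorem contDiff_det3 : ContDiff ℝ ∞ fun A : Fin 3 → Fin 3 → ℝ => (Matrix.of A).det := by
  simp only [Matrix.det_fin_three, Matrix.of_apply]
  have h := fun i j => contDiff_apply_apply (n := ∞) ℝ ℝ (i : Fin 3) (j : Fin 3)
  fun_prop

/-- The bounds say that the cell coordinates stay bounded, with denominators cleared. Outside the
cell they make the first column zero, or else, by vanishing of both minors, the first two columns
dependent. So invertible matrices outside the cell keep away from sections with compactly supported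
coordinates. -/
theorem det_eq_zero_of_bounds {A : Matrix (Fin 3) (Fin 3) ℝ} {R : ℝ}
    (h10 : |A 1 0| ≤ R * |A 0 0|) (h20 : |A 2 0| ≤ R * |A 0 0|)
    (hn : |minor2' A| ≤ R * |minor2 A|) (h : ¬ (A 0 0 ≠ 0 ∧ minor2 A ≠ 0)) : A.det = 0 := by
  by_cases h0 : A 0 0 = 0
  · rw [h0] at h10 h20
    simp only [abs_zero, mul_zero, abs_nonpos_iff] at h10 h20
    simp [Matrix.det_fin_three, h0, h10, h20]
  · have h2 : minor2 A = 0 := by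
      by_contra h2
      exact h ⟨h0, h2⟩
    rw [h2] at hn
    simp only [abs_zero, mul_zero, abs_nonpos_iff] at hn
    have : A 0 0 * A.det = 0 := by
      rw [Matrix.det_fin_three]
      unfold minor2 at h2
      unfold minor2' at hn
      linear_combination (A 2 2 * A 0 0 - A 2 0 * A 0 2) * h2 +
        (A 1 0 * A 0 2 - A 1 2 * A 0 0) * hn
    exact (mul_eq_zero.1 this).resolve_left h0

theorem contDiffOn_cellExtend {φ : ℝ × ℝ × ℝ → ℂ} (hφ : ContDiff ℝ ∞ φ)
    (hc : HasCompactSupport φ) :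
    ContDiffOn ℝ ∞ (fun A : Fin 3 → Fin 3 → ℝ => cellExtend ξ lam φ (Matrix.of A))
      {A | (Matrix.of A).det ≠ 0} := by
  intro A hA
  have hA : (Matrix.of A).det ≠ 0 := hA
  refine ContDiffAt.contDiffWithinAt ?_
  by_cases h : (Matrix.of A) 0 0 ≠ 0 ∧ minor2 (Matrix.of A) ≠ 0
  · have hev : (fun A : Fin 3 → Fin 3 → ℝ => cellExtend ξ lam φ (Matrix.of A)) =ᶠ[nhds A]
        fun A => cellFactor ξ lam (Matrix.of A) * φ (cellCoord (Matrix.of A)) := by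
      filter_upwards [(contDiff_entry 0 0).continuous.continuousAt.eventually_ne h.1,
        contDiff_minor2.continuous.continuousAt.eventually_ne h.2] with B h1 h2
      exact if_pos ⟨h1, h2⟩
    refine ContDiffAt.congr_of_eventuallyEq ?_ hev
    have e00 := (contDiff_entry 0 0).contDiffAt (x := A)
    have em := contDiff_minor2.contDiffAt (x := A)
    refine ContDiffAt.mul (ContDiffAt.mul (ContDiffAt.mul ?_ ?_) ?_) ?_
    · exact (contDiffAt_signedPow _ _ h.1).comp A e00
    · exact (contDiffAt_signedPow _ _ (div_ne_zero h.2 h.1)).comp A (em.div e00 h.1)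
    · exact (contDiffAt_signedPow _ _ (div_ne_zero hA h.2)).comp A
        (contDiff_det3.contDiffAt.div em h.2)
    · refine hφ.contDiffAt.comp A (ContDiffAt.prodMk ?_ (ContDiffAt.prodMk ?_ ?_))
      · exact (contDiff_entry 1 0).contDiffAt.div e00 h.1
      · exact contDiff_minor2'.contDiffAt.div em h.2
      · exact (contDiff_entry 2 0).contDiffAt.div e00 h.1
  · obtain ⟨R, hR⟩ := hc.isBounded.exists_norm_le
    have hR' : ∀ v, φ v ≠ 0 → ‖v‖ ≤ R := fun v hv => hR v (subset_closure hv)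
    -- This closed set contains every point where the extension is nonzero but not `A`, so the
    -- extension vanishes near `A`.
    have hcl : IsClosed {A : Fin 3 → Fin 3 → ℝ |
        |(Matrix.of A) 1 0| ≤ R * |(Matrix.of A) 0 0| ∧
        |(Matrix.of A) 2 0| ≤ R * |(Matrix.of A) 0 0| ∧
        |minor2' (Matrix.of A)| ≤ R * |minor2 (Matrix.of A)|} := by
      have c := fun i j => (contDiff_entry i j).continuous
      have c2 := contDiff_minor2.continuous
      have c2' := contDiff_minor2'.continuous
      refine (isClosed_le (c 1 0).abs (continuous_const.mul (c 0 0).abs)).inter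
        ((isClosed_le (c 2 0).abs (continuous_const.mul (c 0 0).abs)).inter
        (isClosed_le c2'.abs (continuous_const.mul c2.abs)))
    have hnot := hcl.isOpen_compl.mem_nhds (x := A)
      (fun hm => hA (det_eq_zero_of_bounds hm.1 hm.2.1 hm.2.2 h))
    have hev : (fun A : Fin 3 → Fin 3 → ℝ => cellExtend ξ lam φ (Matrix.of A)) =ᶠ[nhds A]
        fun _ => 0 := by
      filter_upwards [hnot] with B hB
      unfold cellExtend
      split_ifs with hcond
      · by_contra hne
        refine hB ?_
        have hv := hR' _ (right_ne_zero_of_mul hne)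
        have hx : ‖(cellCoord (Matrix.of B)).1‖ ≤ R := (norm_fst_le _).trans hv
        have hy : ‖(cellCoord (Matrix.of B)).2.1‖ ≤ R :=
          ((norm_fst_le _).trans (norm_snd_le _)).trans hv
        have hz : ‖(cellCoord (Matrix.of B)).2.2‖ ≤ R :=
          ((norm_snd_le _).trans (norm_snd_le _)).trans hv
        simp only [cellCoord, Real.norm_eq_abs, abs_div] at hx hy hz
        rw [div_le_iff₀ (abs_pos.2 hcond.1)] at hx hz
        rw [div_le_iff₀ (abs_pos.2 hcond.2)] at hy
        exact ⟨hx, hz, hy⟩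
      · rfl
    exact contDiffAt_const.congr_of_eventuallyEq hev

/-- Right multiplication by an upper triangular matrix scales each minor of initial columns by a
product of diagonal entries. The cell coordinates are ratios of such minors of equal size and do not
change. -/
theorem cellExtend_mul (φ : ℝ × ℝ × ℝ → ℂ) (g p : GLR 3) (hp : p ∈ borel 3) :
    cellExtend ξ lam φ ((g * p : GLR 3) : Matrix (Fin 3) (Fin 3) ℝ) =
      inducingFactor ξ lam p * cellExtend ξ lam φ (g : Matrix (Fin 3) (Fin 3) ℝ) := by
  obtain ⟨A, hA⟩ : ∃ A, A = (g : Matrix (Fin 3) (Fin 3) ℝ) := ⟨_, rfl⟩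
  obtain ⟨B, hB⟩ : ∃ B, B = (p : Matrix (Fin 3) (Fin 3) ℝ) := ⟨_, rfl⟩
  have hpB : B.BlockTriangular id := by rw [hB]; exact hp
  have b10 : B 1 0 = 0 := hpB (by decide)
  have b20 : B 2 0 = 0 := hpB (by decide)
  have b21 : B 2 1 = 0 := hpB (by decide)
  have hdet : B.det ≠ 0 := by rw [hB]; exact Matrix.GeneralLinearGroup.det_ne_zero p
  have hdB : B.det = B 0 0 * B 1 1 * B 2 2 := by
    rw [Matrix.det_fin_three, b10, b20, b21]; ring
  rw [hdB] at hdet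
  have b00 : B 0 0 ≠ 0 := fun h => hdet (by rw [h]; ring)
  have b11 : B 1 1 ≠ 0 := fun h => hdet (by rw [h]; ring)
  have e0 : ∀ i, (A * B) i 0 = A i 0 * B 0 0 := fun i => by
    simp [Matrix.mul_apply, Fin.sum_univ_three, b10, b20]
  have e1 : ∀ i, (A * B) i 1 = A i 0 * B 0 1 + A i 1 * B 1 1 := fun i => by
    simp [Matrix.mul_apply, Fin.sum_univ_three, b21]
  have em : minor2 (A * B) = minor2 A * (B 0 0 * B 1 1) := by
    simp only [minor2, e0, e1]; ring
  have em' : minor2' (A * B) = minor2' A * (B 0 0 * B 1 1) := by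
    simp only [minor2', e0, e1]; ring
  rw [Units.val_mul, ← hA, ← hB]
  unfold cellExtend
  have hiff : ((A * B) 0 0 ≠ 0 ∧ minor2 (A * B) ≠ 0) ↔ (A 0 0 ≠ 0 ∧ minor2 A ≠ 0) := by
    rw [e0, em]
    simp [b00, b11]
  by_cases h : A 0 0 ≠ 0 ∧ minor2 A ≠ 0
  · rw [if_pos (hiff.2 h), if_pos h, ← mul_assoc]
    obtain ⟨h1, h2⟩ := h
    congr 1
    · unfold cellFactor inducingFactor
      rw [e0, em, Matrix.det_mul, hdB, Fin.prod_univ_three, ← hB]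
      have d1 : minor2 A * (B 0 0 * B 1 1) / (A 0 0 * B 0 0) = (minor2 A / A 0 0) * B 1 1 := by
        field_simp
      have d2 : A.det * (B 0 0 * B 1 1 * B 2 2) / (minor2 A * (B 0 0 * B 1 1)) =
          (A.det / minor2 A) * B 2 2 := by
        field_simp
      rw [d1, d2, signedPow_mul, signedPow_mul, signedPow_mul]
      ring
    · congr 1
      simp only [cellCoord, e0, em, em']
      rw [mul_div_mul_right _ _ b00, mul_div_mul_right _ _ b00,
        mul_div_mul_right _ _ (mul_ne_zero b00 b11)]
  · rw [if_neg (mt hiff.1 h), if_neg h, mul_zero]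

theorem extendZero_coe {n : ℕ} (F : Matrix (Fin n) (Fin n) ℝ → ℂ) {A : Fin n → Fin n → ℝ}
    (hA : (Matrix.of A).det ≠ 0) :
    extendZero (fun g : GLR n => F g) A = F (Matrix.of A) := by
  rw [extendZero, dif_pos hA]
  rfl

theorem extendZero_apply_coe {n : ℕ} (f : GLR n → ℂ) (g : GLR n) {A : Fin n → Fin n → ℝ}
    (hA : Matrix.of A = (g : Matrix (Fin n) (Fin n) ℝ)) : extendZero f A = f g := by
  have h : (Matrix.of A).det ≠ 0 := by
    rw [hA]; exact Matrix.GeneralLinearGroup.det_ne_zero g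
  rw [extendZero, dif_pos h]
  congr 1
  exact Units.ext hA

theorem isSmooth_cellExtend {φ : ℝ × ℝ × ℝ → ℂ} (hφ : ContDiff ℝ ∞ φ)
    (hc : HasCompactSupport φ) :
    IsSmooth fun g : GLR 3 => cellExtend ξ lam φ (g : Matrix (Fin 3) (Fin 3) ℝ) :=
  (contDiffOn_cellExtend hφ hc).congr fun _ hA => extendZero_coe _ hA

theorem cellExtend_add (φ ψ : ℝ × ℝ × ℝ → ℂ) (A : Matrix (Fin 3) (Fin 3) ℝ) :
    cellExtend ξ lam (φ + ψ) A = cellExtend ξ lam φ A + cellExtend ξ lam ψ A := by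
  unfold cellExtend
  split_ifs
  · simp [mul_add]
  · simp

theorem cellExtend_smul (c : ℂ) (φ : ℝ × ℝ × ℝ → ℂ) (A : Matrix (Fin 3) (Fin 3) ℝ) :
    cellExtend ξ lam (c • φ) A = c • cellExtend ξ lam φ A := by
  unfold cellExtend
  split_ifs
  · simp; ring
  · simp

variable (ξ lam) in
/-- The section which is equal to `φ`, times a cut-off function, in the coordinates around
`x_1 P_G`. -/
def sectionOf : Smooth3 →ₗ[ℂ] principalSeries 3 ξ lam where
  toFun φ := ⟨fun g => cellExtend ξ lam (cutoff * φ).1 ((x1 * g : GLR 3) : Matrix _ _ ℝ),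
    isSmooth_translate x1 (f := fun g : GLR 3 => cellExtend ξ lam (cutoff * φ).1
      (g : Matrix (Fin 3) (Fin 3) ℝ))
      (isSmooth_cellExtend (mem_smooth3.1 (cutoff * φ).2) (hasCompactSupport_cutoff_mul φ)),
    fun g p hp => by
      simp only [← mul_assoc]
      exact cellExtend_mul _ _ _ hp⟩
  map_add' φ ψ := by
    apply Subtype.ext
    funext g
    change cellExtend ξ lam (cutoff * (φ + ψ)).1 _ =
      cellExtend ξ lam (cutoff * φ).1 _ + cellExtend ξ lam (cutoff * ψ).1 _
    rw [mul_add]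
    exact cellExtend_add _ _ _
  map_smul' c φ := by
    apply Subtype.ext
    funext g
    change cellExtend ξ lam (cutoff * (c • φ)).1 _ = c • cellExtend ξ lam (cutoff * φ).1 _
    rw [mul_smul_comm]
    exact cellExtend_smul _ _ _

theorem sectionOf_apply_nbar (φ : Smooth3) (v : ℝ × ℝ × ℝ) :
    (sectionOf ξ lam φ).1 (x1 * nbar v.1 v.2.1 v.2.2) = (cutoff * φ).1 v := by
  change cellExtend ξ lam (cutoff * φ).1 ((x1 * (x1 * nbar v.1 v.2.1 v.2.2) : GLR 3) :
    Matrix (Fin 3) (Fin 3) ℝ) = _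
  rw [← mul_assoc, x1_mul_x1, one_mul, nbar_coe]
  have hm : minor2 !![1, 0, 0; v.1, 1, 0; v.2.2, v.2.1, 1] = 1 := by simp [minor2]
  have hm' : minor2' !![1, 0, 0; v.1, 1, 0; v.2.2, v.2.1, 1] = v.2.1 := by simp [minor2']
  have hd : (!![1, 0, 0; v.1, 1, 0; v.2.2, v.2.1, 1] : Matrix (Fin 3) (Fin 3) ℝ).det = 1 := by
    simp [Matrix.det_fin_three]
  rw [cellExtend, if_pos (by rw [hm]; simp), cellFactor, cellCoord, hm, hm', hd]
  simp [signedPow_one]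

end BigCell

/-! ### Sections in the coordinates around `h x_1 P_G` -/

section Restriction

/-- The entries of `diag(A, 1) x_1 n̄(x, y, z)`. -/
def familyArray (A : Fin 2 → Fin 2 → ℝ) (v : ℝ × ℝ × ℝ) : Fin 3 → Fin 3 → ℝ :=
  ![![A 0 0 + A 0 1 * v.2.2, A 0 1 * v.2.1, A 0 1], ![A 1 0 + A 1 1 * v.2.2, A 1 1 * v.2.1, A 1 1],
    ![v.1, 1, 0]]

theorem of_familyArray (h : GLR 2) (v : ℝ × ℝ × ℝ) :
    Matrix.of (familyArray (fun i j => (h : Matrix (Fin 2) (Fin 2) ℝ) i j) v) =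
      ((embed h * x1 * nbar v.1 v.2.1 v.2.2 : GLR 3) : Matrix (Fin 3) (Fin 3) ℝ) := by
  rw [Units.val_mul, Units.val_mul, nbar_coe, x1_coe]
  change _ = blockHom (h : Matrix (Fin 2) (Fin 2) ℝ) * _ * _
  ext i j
  fin_cases i <;> fin_cases j <;>
    simp [familyArray, blockHom, Matrix.mul_apply, Fin.sum_univ_succ]

theorem det_familyArray (A : Fin 2 → Fin 2 → ℝ) (v : ℝ × ℝ × ℝ) :
    (Matrix.of (familyArray A v)).det = -(Matrix.of A).det := by
  rw [Matrix.det_fin_three, Matrix.det_fin_two]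
  simp [familyArray]
  ring

theorem contDiff_familyArray :
    ContDiff ℝ ∞ fun p : (Fin 2 → Fin 2 → ℝ) × (ℝ × ℝ × ℝ) => familyArray p.1 p.2 := by
  have h : ∀ i j : Fin 2, ContDiff ℝ ∞ fun p : (Fin 2 → Fin 2 → ℝ) × (ℝ × ℝ × ℝ) => p.1 i j :=
    fun i j => (contDiff_apply_apply ℝ ℝ i j).comp contDiff_fst
  refine contDiff_pi.2 fun i => contDiff_pi.2 fun j => ?_
  fin_cases i <;> fin_cases j <;> simp [familyArray] <;> fun_prop

theorem isOpen_det_ne_zero (n : ℕ) : IsOpen {A : Fin n → Fin n → ℝ | (Matrix.of A).det ≠ 0} := by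
  have h : Continuous fun A : Fin n → Fin n → ℝ => (Matrix.of A).det :=
    Continuous.matrix_det (continuous_id : Continuous fun A : Matrix (Fin n) (Fin n) ℝ => A)
  exact isOpen_ne_fun h continuous_const

variable {ξ : Fin 3 → ZMod 2} {lam : Fin 3 → ℂ}

/-- Joint smoothness in `h` and `(x, y, z)` gives both the smoothness of `T f` and the right to
differentiate along the unipotent subgroup under the derivatives at the origin. -/
theorem contDiffOn_family (f : principalSeries 3 ξ lam) :
    ContDiffOn ℝ ∞ (fun p : (Fin 2 → Fin 2 → ℝ) × (ℝ × ℝ × ℝ) =>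
      extendZero f.1 (familyArray p.1 p.2)) ({A | (Matrix.of A).det ≠ 0} ×ˢ Set.univ) := by
  have hf : ContDiffOn ℝ ∞ (extendZero f.1) {A | (Matrix.of A).det ≠ 0} := f.2.1
  refine hf.comp contDiff_familyArray.contDiffOn ?_
  rintro ⟨A, v⟩ ⟨hA, -⟩
  have hA : (Matrix.of A).det ≠ 0 := hA
  change (Matrix.of (familyArray A v)).det ≠ 0
  rw [det_familyArray]
  exact neg_ne_zero.2 hA

theorem extendZero_familyArray (f : GLR 3 → ℂ) (h : GLR 2) (v : ℝ × ℝ × ℝ) :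
    extendZero f (familyArray (fun i j => (h : Matrix (Fin 2) (Fin 2) ℝ) i j) v) =
      f (embed h * x1 * nbar v.1 v.2.1 v.2.2) :=
  extendZero_apply_coe _ _ (of_familyArray h v)

theorem det_coe_ne_zero {n : ℕ} (h : GLR n) :
    (Matrix.of fun i j => (h : Matrix (Fin n) (Fin n) ℝ) i j).det ≠ 0 :=
  Matrix.GeneralLinearGroup.det_ne_zero h

/-- The restriction `(x, y, z) ↦ f(h x_1 n̄(x, y, z))`. -/
def restrictAt (h : GLR 2) : principalSeries 3 ξ lam →ₗ[ℂ] Smooth3 where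
  toFun f := ⟨fun v => f.1 (embed h * x1 * nbar v.1 v.2.1 v.2.2), mem_smooth3.2 (by
    have := (contDiffOn_family f).comp (s := Set.univ)
      (f := fun v : ℝ × ℝ × ℝ => ((fun i j => (h : Matrix (Fin 2) (Fin 2) ℝ) i j), v))
      (contDiff_const.prodMk contDiff_id).contDiffOn
      (fun v _ => ⟨det_coe_ne_zero h, Set.mem_univ v⟩)
    rw [contDiffOn_univ] at this
    convert this using 1
    funext v
    exact (extendZero_familyArray f.1 h v).symm)⟩
  map_add' _ _ := rfl
  map_smul' _ _ := rfl

theorem restrictAt_apply (h : GLR 2) (f : principalSeries 3 ξ lam) (v : ℝ × ℝ × ℝ) :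
    (restrictAt h f).1 v = f.1 (embed h * x1 * nbar v.1 v.2.1 v.2.2) := rfl

theorem restrictAt_mul (h k : GLR 2) (f : principalSeries 3 ξ lam) :
    restrictAt (h * k) f = restrictAt k (leftRegular 3 ξ lam (embed h⁻¹) f) := by
  apply Subtype.ext
  funext v
  change f.1 _ = f.1 ((embed h⁻¹)⁻¹ * _)
  rw [map_inv, inv_inv, map_mul]
  simp only [mul_assoc]

theorem restrictAt_one_sectionOf (φ : Smooth3) :
    restrictAt 1 (sectionOf ξ lam φ) = cutoff * φ := by
  apply Subtype.ext
  funext v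
  rw [← sectionOf_apply_nbar (ξ := ξ) (lam := lam), restrictAt_apply, map_one, one_mul]

/-- The action of `h` in the cell coordinates. Here `m₁, m₂, d` are the leading minors of `x1 *
(embed h * x1 * nbar x y z)`, so the formula holds as long as this matrix lies in the cell. -/
theorem restrictAt_eq (h : GLR 2) (f : principalSeries 3 ξ lam) {x y z m₁ m₂ d : ℝ}
    (hm₁ : m₁ = h.1 0 0 + h.1 0 1 * z) (hm₂ : m₂ = m₁ - h.1 0 1 * x * y)
    (hd : d = h.1 0 0 * h.1 1 1 - h.1 0 1 * h.1 1 0) (h₁ : m₁ ≠ 0) (h₂ : m₂ ≠ 0) :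
    (restrictAt h f).1 (x, y, z) =
      signedPow (ξ 0) (-lam 0 - rho 3 0) m₁ * signedPow (ξ 1) (-lam 1 - rho 3 1) (m₂ / m₁) *
        signedPow (ξ 2) (-lam 2 - rho 3 2) (d / m₂) *
        (restrictAt 1 f).1 (x / m₁, y * d / m₂, (h.1 1 0 + h.1 1 1 * z) / m₁) := by
  set A : Matrix (Fin 3) (Fin 3) ℝ := !![m₁, h.1 0 1 * y, h.1 0 1; x, 1, 0;
    h.1 1 0 + h.1 1 1 * z, h.1 1 1 * y, h.1 1 1] with hAdef
  have hA : ((x1 * (embed h * x1 * nbar x y z) : GLR 3) : Matrix (Fin 3) (Fin 3) ℝ) = A := by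
    rw [Units.val_mul, ← of_familyArray h (x, y, z), x1_coe, hAdef, hm₁]
    ext i j
    fin_cases i <;> fin_cases j <;>
      simp [familyArray, Matrix.mul_apply, Fin.sum_univ_succ]
  have e2 : minor2 A = m₂ := by
    simp [hAdef, minor2, hm₂]
    ring
  have e2' : minor2' A = y * d := by
    simp [hAdef, minor2', hd, hm₁]
    ring
  have e3 : A.det = d := by
    rw [hAdef, Matrix.det_fin_three, hd, hm₁]
    simp
    ring
  have e0 : A 0 0 = m₁ := rfl
  have e1 : A 1 0 = x := rfl
  have e4 : A 2 0 = h.1 1 0 + h.1 1 1 * z := rfl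
  have key := apply_eq_cellFactor_mul f hA (by rw [e0]; exact h₁) (by rw [e2]; exact h₂)
  rw [restrictAt_apply, key, restrictAt_apply, map_one, one_mul, cellFactor, cellCoord,
    e0, e1, e2, e2', e3, e4]

end Restriction

/-! ### Supports of sections versus germs in coordinates -/

section Support

variable {ξ : Fin 3 → ZMod 2} {lam : Fin 3 → ℂ}

theorem continuous_embed : Continuous embed := by
  refine Continuous.units_map blockHom ?_
  have h : ∀ i j : Fin 2, Continuous fun A : Matrix (Fin 2) (Fin 2) ℝ => A i j :=
    fun i j => continuous_id.matrix_elem i j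
  refine continuous_matrix fun i j => ?_
  fin_cases i <;> fin_cases j <;> simp [blockHom] <;> first | exact continuous_const | exact h _ _

theorem continuous_p1 : Continuous p1 := by
  refine Continuous.quotient_map' ?_ _
  exact continuous_embed.mul continuous_const

theorem restrictAt_eventuallyEq_zero (f : principalSeries 3 ξ lam) (h : GLR 2)
    (hf : ((embed h * x1 : GLR 3) : GLR 3 ⧸ borel 3) ∉ sectionSupport f.1) :
    (restrictAt h f).1 =ᶠ[nhds 0] 0 := by
  have hc : Continuous fun v : ℝ × ℝ × ℝ =>
      ((embed h * x1 * nbar v.1 v.2.1 v.2.2 : GLR 3) : GLR 3 ⧸ borel 3) :=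
    QuotientGroup.continuous_mk.comp (continuous_const.mul continuous_nbar)
  have ho : IsOpen (sectionSupport f.1)ᶜ := isClosed_closure.isOpen_compl
  have h0 : ((embed h * x1 * nbar (0 : ℝ × ℝ × ℝ).1 (0 : ℝ × ℝ × ℝ).2.1 (0 : ℝ × ℝ × ℝ).2.2 : GLR 3) :
      GLR 3 ⧸ borel 3) ∈ (sectionSupport f.1)ᶜ := by
    simpa [nbar_zero] using hf
  filter_upwards [hc.continuousAt.preimage_mem_nhds (ho.mem_nhds h0)] with v hv
  by_contra hne
  exact hv (subset_closure ⟨_, hne, rfl⟩)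

/-- The cell coordinates are continuous near `x1`, so a vanishing germ makes `f` vanish on a
neighbourhood `W` of `x1` in the group. The image of `W` in the flag variety is open, and by
equivariance `f` vanishes on every coset that meets `W`. -/
theorem notMem_sectionSupport (f : principalSeries 3 ξ lam)
    (hf : (restrictAt 1 f).1 =ᶠ[nhds 0] 0) :
    ((x1 : GLR 3) : GLR 3 ⧸ borel 3) ∉ sectionSupport f.1 := by
  have hcoe : Continuous fun g : GLR 3 => ((x1 * g : GLR 3) : Matrix (Fin 3) (Fin 3) ℝ) :=
    Units.continuous_val.comp (continuous_const.mul continuous_id)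
  have hent : ∀ i j, Continuous fun g : GLR 3 => ((x1 * g : GLR 3) : Matrix (Fin 3) (Fin 3) ℝ) i j :=
    fun i j => hcoe.matrix_elem i j
  have hm : Continuous fun g : GLR 3 => minor2 ((x1 * g : GLR 3) : Matrix (Fin 3) (Fin 3) ℝ) :=
    ((hent 0 0).mul (hent 1 1)).sub ((hent 0 1).mul (hent 1 0))
  have hm' : Continuous fun g : GLR 3 => minor2' ((x1 * g : GLR 3) : Matrix (Fin 3) (Fin 3) ℝ) :=
    ((hent 0 0).mul (hent 2 1)).sub ((hent 0 1).mul (hent 2 0))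
  have hx1 : ((x1 * x1 : GLR 3) : Matrix (Fin 3) (Fin 3) ℝ) = 1 := by rw [x1_mul_x1]; rfl
  have h00 : ((x1 * x1 : GLR 3) : Matrix (Fin 3) (Fin 3) ℝ) 0 0 ≠ 0 := by rw [hx1]; simp
  have hmx : minor2 ((x1 * x1 : GLR 3) : Matrix (Fin 3) (Fin 3) ℝ) ≠ 0 := by
    rw [hx1]; simp [minor2]
  have hcc : ContinuousAt (fun g : GLR 3 =>
      cellCoord ((x1 * g : GLR 3) : Matrix (Fin 3) (Fin 3) ℝ)) x1 :=
    ((hent 1 0).continuousAt.div (hent 0 0).continuousAt h00).prodMk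
      ((hm'.continuousAt.div hm.continuousAt hmx).prodMk
        ((hent 2 0).continuousAt.div (hent 0 0).continuousAt h00))
  have hcx : cellCoord ((x1 * x1 : GLR 3) : Matrix (Fin 3) (Fin 3) ℝ) = 0 := by
    rw [hx1]; simp [cellCoord, minor2']
  have hev : ∀ᶠ g : GLR 3 in nhds x1, f.1 g = 0 := by
    have hf' : ∀ᶠ v in nhds (cellCoord ((x1 * x1 : GLR 3) : Matrix (Fin 3) (Fin 3) ℝ)),
        (restrictAt 1 f).1 v = 0 := by rw [hcx]; exact hf
    filter_upwards [hcc.eventually hf', (hent 0 0).continuousAt.eventually_ne h00,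
      hm.continuousAt.eventually_ne hmx] with g hg h1 h2
    rw [apply_eq_cellFactor_mul f rfl h1 h2]
    rw [restrictAt_apply, map_one, one_mul] at hg
    rw [hg, mul_zero]
  obtain ⟨W, hW, hWo, hxW⟩ := eventually_nhds_iff.1 hev
  intro hmem
  have hop : IsOpen ((fun g : GLR 3 => (g : GLR 3 ⧸ borel 3)) '' W) :=
    QuotientGroup.isOpenMap_coe W hWo
  obtain ⟨q, ⟨w, hw, hwq⟩, g, hg, hgq⟩ := mem_closure_iff.1 hmem _ hop ⟨x1, hxW, rfl⟩
  have hwg : (w : GLR 3 ⧸ borel 3) = g := hwq.trans hgq.symm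
  have hp := QuotientGroup.eq.1 hwg
  refine hg ?_
  rw [show g = w * (w⁻¹ * g) by group, f.2.2 _ _ hp, hW w hw, mul_zero]

end Support

/-! ### From operators to local functionals -/

section Functional

variable {ξ : Fin 3 → ZMod 2} {lam : Fin 3 → ℂ} {η : Fin 2 → ZMod 2} {ν : Fin 2 → ℂ}

/-- The functional on `C^∞(ℝ³)` given by the value of `T f` at the identity. -/
def functionalOf (T : principalSeries 3 ξ lam →ₗ[ℂ] principalSeries 2 η ν) :
    Smooth3 →ₗ[ℂ] ℂ where
  toFun φ := (T (sectionOf ξ lam φ)).1 1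
  map_add' φ ψ := by simp
  map_smul' c φ := by simp

theorem apply_one_eq_zero {T : principalSeries 3 ξ lam →ₗ[ℂ] principalSeries 2 η ν}
    (hT : T ∈ DSBO1 ξ lam η ν) {f : principalSeries 3 ξ lam}
    (hf : (restrictAt 1 f).1 =ᶠ[nhds 0] 0) : (T f).1 1 = 0 := by
  by_contra hne
  refine notMem_sectionSupport f hf (hT.2 f ⟨((1 : GLR 2) : GLR 2 ⧸ borel 2), ?_, ?_⟩)
  · exact subset_closure ⟨1, hne, rfl⟩
  · change ((embed 1 * x1 : GLR 3) : GLR 3 ⧸ borel 3) = _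
    rw [map_one, one_mul]

theorem isLocal_functionalOf {T : principalSeries 3 ξ lam →ₗ[ℂ] principalSeries 2 η ν}
    (hT : T ∈ DSBO1 ξ lam η ν) : IsLocal (functionalOf T) := by
  intro φ hφ
  refine apply_one_eq_zero hT ?_
  rw [restrictAt_one_sectionOf]
  exact (cutoff_mul_eventuallyEq φ).trans hφ

/-- At the identity, `f` may be replaced by the cut-off section with the same germ at `x_1 P_G`;
equivariance carries the formula to every `h`. -/
theorem apply_eq_functionalOf {T : principalSeries 3 ξ lam →ₗ[ℂ] principalSeries 2 η ν}
    (hT : T ∈ DSBO1 ξ lam η ν) (f : principalSeries 3 ξ lam) (h : GLR 2) :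
    (T f).1 h = functionalOf T (restrictAt h f) := by
  have h1 : ∀ f : principalSeries 3 ξ lam, (T f).1 1 = functionalOf T (restrictAt 1 f) := by
    intro f
    have : (T (f - sectionOf ξ lam (restrictAt 1 f))).1 1 = 0 := by
      refine apply_one_eq_zero hT ?_
      rw [map_sub, restrictAt_one_sectionOf]
      filter_upwards [cutoff_mul_eventuallyEq (restrictAt 1 f)] with v hv
      change (restrictAt 1 f).1 v - (cutoff * restrictAt 1 f).1 v = 0
      rw [hv, sub_self]
    rw [map_sub] at this
    exact sub_eq_zero.1 this
  have h2 := congrArg (fun F => (F f).1 1) (hT.1 h⁻¹)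
  have h3 : (T f).1 h = (T (leftRegular 3 ξ lam (embed h⁻¹) f)).1 1 := by
    refine Eq.trans ?_ h2.symm
    change (T f).1 h = (T f).1 ((h⁻¹)⁻¹ * 1)
    simp
  rw [h3, h1, ← restrictAt_mul, mul_one]

theorem functionalOf_restrictAt_mul {T : principalSeries 3 ξ lam →ₗ[ℂ] principalSeries 2 η ν}
    (hT : T ∈ DSBO1 ξ lam η ν) (f : principalSeries 3 ξ lam) {p : GLR 2} (hp : p ∈ borel 2) :
    functionalOf T (restrictAt p f) = inducingFactor η ν p * functionalOf T (restrictAt 1 f) := by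
  rw [← apply_eq_functionalOf hT, ← apply_eq_functionalOf hT, ← (T f).2.2 1 p hp, one_mul]

end Functional

/-! ### Torus covariance: homogeneity, weights and the vanishing case -/

section Borel

/-- The diagonal matrix `diag(a, b)`. -/
def torus (a b : ℝ) (ha : a ≠ 0) (hb : b ≠ 0) : GLR 2 :=
  Matrix.GeneralLinearGroup.mkOfDetNeZero !![a, 0; 0, b] (by simp [Matrix.det_fin_two, ha, hb])

/-- The upper triangular unipotent matrix with off-diagonal entry `s`. -/
def unip (s : ℝ) : GLR 2 :=
  Matrix.GeneralLinearGroup.mkOfDetNeZero !![1, s; 0, 1] (by simp [Matrix.det_fin_two])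

theorem torus_coe (a b : ℝ) (ha : a ≠ 0) (hb : b ≠ 0) :
    (torus a b ha hb : Matrix (Fin 2) (Fin 2) ℝ) = !![a, 0; 0, b] := rfl

theorem unip_coe (s : ℝ) : (unip s : Matrix (Fin 2) (Fin 2) ℝ) = !![1, s; 0, 1] := rfl

theorem torus_mem (a b : ℝ) (ha : a ≠ 0) (hb : b ≠ 0) : torus a b ha hb ∈ borel 2 := by
  change (torus a b ha hb : Matrix (Fin 2) (Fin 2) ℝ).BlockTriangular id
  rw [torus_coe]
  intro i j hij
  fin_cases i <;> fin_cases j <;> first | rfl | exact absurd hij (by decide)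

theorem unip_mem (s : ℝ) : unip s ∈ borel 2 := by
  change (unip s : Matrix (Fin 2) (Fin 2) ℝ).BlockTriangular id
  rw [unip_coe]
  intro i j hij
  fin_cases i <;> fin_cases j <;> first | rfl | exact absurd hij (by decide)

theorem unip_zero : unip 0 = 1 := by
  apply Units.ext
  rw [unip_coe]
  ext i j
  fin_cases i <;> fin_cases j <;> simp

theorem unip_add (s t : ℝ) : unip (s + t) = unip s * unip t := by
  apply Units.ext
  rw [Units.val_mul, unip_coe, unip_coe, unip_coe]
  ext i j
  fin_cases i <;> fin_cases j <;> simp [Matrix.mul_apply, Fin.sum_univ_succ, add_comm]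

theorem exists_eq_unip_mul_torus {p : GLR 2} (hp : p ∈ borel 2) :
    ∃ s a b, ∃ (ha : a ≠ 0) (hb : b ≠ 0), p = unip s * torus a b ha hb := by
  have h10 : p.1 1 0 = 0 := hp (by decide)
  have hd : p.1.det ≠ 0 := Matrix.GeneralLinearGroup.det_ne_zero p
  rw [Matrix.det_fin_two, h10, mul_zero, sub_zero] at hd
  have hb := right_ne_zero_of_mul hd
  refine ⟨p.1 0 1 / p.1 1 1, p.1 0 0, p.1 1 1, left_ne_zero_of_mul hd, hb, ?_⟩
  apply Units.ext
  rw [Units.val_mul, unip_coe, torus_coe]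
  ext i j
  fin_cases i <;> fin_cases j <;> simp [Matrix.mul_apply, Fin.sum_univ_succ, h10, hb]

theorem inducingFactor_torus (η : Fin 2 → ZMod 2) (ν : Fin 2 → ℂ) {a b : ℝ} (ha : a ≠ 0)
    (hb : b ≠ 0) : inducingFactor η ν (torus a b ha hb) =
      signedPow (η 0) (-ν 0 - rho 2 0) a * signedPow (η 1) (-ν 1 - rho 2 1) b := by
  simp [inducingFactor, torus_coe]

theorem inducingFactor_unip (η : Fin 2 → ZMod 2) (ν : Fin 2 → ℂ) (s : ℝ) :
    inducingFactor η ν (unip s) = 1 := by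
  simp [inducingFactor, unip_coe, signedPow_one]

theorem inducingFactor_unip_mul_torus (η : Fin 2 → ZMod 2) (ν : Fin 2 → ℂ) (s : ℝ) {a b : ℝ}
    (ha : a ≠ 0) (hb : b ≠ 0) : inducingFactor η ν (unip s * torus a b ha hb) =
      signedPow (η 0) (-ν 0 - rho 2 0) a * signedPow (η 1) (-ν 1 - rho 2 1) b := by
  simp [inducingFactor, Matrix.mul_apply, torus_coe, unip_coe]

variable {ξ : Fin 3 → ZMod 2} {lam : Fin 3 → ℂ} {η : Fin 2 → ZMod 2} {ν : Fin 2 → ℂ}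

/-- Both leading minors equal `a`, so the middle character is evaluated at `1`. Hence `ξ 1` imposes
no condition, and `lam 1` enters only through the unipotent part. -/
theorem restrictAt_torus (f : principalSeries 3 ξ lam) {a b : ℝ} (ha : a ≠ 0) (hb : b ≠ 0) :
    restrictAt (torus a b ha hb) f = (signedPow (ξ 0) (-lam 0 - rho 3 0) a *
      signedPow (ξ 2) (-lam 2 - rho 3 2) b) • dilate a⁻¹ b (b / a) (restrictAt 1 f) := by
  apply Subtype.ext
  funext ⟨x, y, z⟩
  rw [restrictAt_eq (torus a b ha hb) f (m₁ := a) (m₂ := a) (d := a * b) (by simp [torus_coe])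
    (by simp [torus_coe]) (by simp [torus_coe]) ha ha]
  change _ = (signedPow (ξ 0) (-lam 0 - rho 3 0) a * signedPow (ξ 2) (-lam 2 - rho 3 2) b) *
    (restrictAt 1 f).1 (a⁻¹ * x, b * y, b / a * z)
  rw [div_self ha, signedPow_one, mul_div_cancel_left₀ _ ha]
  have e : (x / a, y * (a * b) / a,
      ((torus a b ha hb).1 1 0 + (torus a b ha hb).1 1 1 * z) / a) =
      (a⁻¹ * x, b * y, b / a * z) := by
    simp only [torus_coe]
    refine Prod.ext ?_ (Prod.ext ?_ ?_) <;> simp <;> field_simp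
  rw [e, mul_one]

theorem dilate_congr {φ ψ : Smooth3} (h : φ.1 =ᶠ[nhds 0] ψ.1) (a b c : ℝ) :
    (dilate a b c φ).1 =ᶠ[nhds 0] (dilate a b c ψ).1 := by
  have hc : Filter.Tendsto (diagCLM a b c) (nhds 0) (nhds 0) := by
    have := (diagCLM a b c).continuous.tendsto 0
    rwa [map_zero] at this
  exact hc.eventually h

theorem functionalOf_dilate {T : principalSeries 3 ξ lam →ₗ[ℂ] principalSeries 2 η ν}
    (hT : T ∈ DSBO1 ξ lam η ν) {a b : ℝ} (ha : a ≠ 0) (hb : b ≠ 0) (φ : Smooth3) :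
    signedPow (ξ 0) (-lam 0 - rho 3 0) a * signedPow (ξ 2) (-lam 2 - rho 3 2) b *
        functionalOf T (dilate a⁻¹ b (b / a) φ) =
      signedPow (η 0) (-ν 0 - rho 2 0) a * signedPow (η 1) (-ν 1 - rho 2 1) b *
        functionalOf T φ := by
  have h := functionalOf_restrictAt_mul hT (sectionOf ξ lam φ) (torus_mem a b ha hb)
  rw [restrictAt_torus, inducingFactor_torus, restrictAt_one_sectionOf, map_smul, smul_eq_mul,
    (isLocal_functionalOf hT).congr (dilate_congr (cutoff_mul_eventuallyEq φ) _ _ _),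
    (isLocal_functionalOf hT).congr (cutoff_mul_eventuallyEq φ)] at h
  exact h

/-- The torus element `diag(2, 1/2)` contracts all three coordinates at once. -/
theorem exists_homogeneous_functionalOf
    {T : principalSeries 3 ξ lam →ₗ[ℂ] principalSeries 2 η ν} (hT : T ∈ DSBO1 ξ lam η ν) :
    ∃ q : ℂ, q ≠ 0 ∧ ∀ φ, functionalOf T (dilate (1 / 2) (1 / 2) (1 / 4) φ) =
      q * functionalOf T φ := by
  have h2 : (2 : ℝ) ≠ 0 := two_ne_zero
  have h3 : (1 / 2 : ℝ) ≠ 0 := by norm_num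
  set u := signedPow (ξ 0) (-lam 0 - rho 3 0) 2 * signedPow (ξ 2) (-lam 2 - rho 3 2) (1 / 2)
  set w := signedPow (η 0) (-ν 0 - rho 2 0) 2 * signedPow (η 1) (-ν 1 - rho 2 1) (1 / 2)
  have hu : u ≠ 0 := mul_ne_zero (signedPow_ne_zero _ _ h2) (signedPow_ne_zero _ _ h3)
  have hw : w ≠ 0 := mul_ne_zero (signedPow_ne_zero _ _ h2) (signedPow_ne_zero _ _ h3)
  refine ⟨w / u, div_ne_zero hw hu, fun φ => ?_⟩
  have h := functionalOf_dilate hT h2 h3 φ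
  rw [show (2 : ℝ)⁻¹ = 1 / 2 by norm_num, show (1 / 2 : ℝ) / 2 = 1 / 4 by norm_num] at h
  change u * _ = w * _ at h
  field_simp
  linear_combination h

theorem signedPow_add_nat (ε : ZMod 2) (μ : ℂ) (n : ℕ) {x : ℝ} (hx : x ≠ 0) :
    signedPow (ε + n) (μ + n) x = signedPow ε μ x * (x : ℂ) ^ n := by
  have hne : ((|x| : ℝ) : ℂ) ≠ 0 := by exact_mod_cast (abs_pos.2 hx).ne'
  induction n with
  | zero => simp
  | succ n ih =>
    rw [pow_succ, ← mul_assoc, ← ih]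
    push_cast
    rw [← add_assoc, ← add_assoc]
    generalize ε + (n : ZMod 2) = ε'
    generalize μ + (n : ℂ) = μ'
    unfold signedPow
    rw [Complex.cpow_add _ _ hne, Complex.cpow_one]
    have hx' : (x : ℂ) = (Real.sign x : ℝ) * (|x| : ℝ) := by
      rw [← Complex.ofReal_mul]
      congr 1
      rcases hx.lt_or_gt with h | h
      · rw [Real.sign_of_neg h, abs_of_neg h]; ring
      · rw [Real.sign_of_pos h, abs_of_pos h]; ring
    have hs : ((Real.sign x : ℝ) : ℂ) * ((Real.sign x : ℝ) : ℂ) = 1 := by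
      rw [← Complex.ofReal_mul]
      rcases hx.lt_or_gt with h | h
      · rw [Real.sign_of_neg h]; simp
      · rw [Real.sign_of_pos h]; simp
    have h01 : ∀ ε : ZMod 2, ε = 0 ∨ ε = 1 := by decide
    rw [hx']
    rcases h01 ε' with rfl | rfl
    · simp
      ring
    · rw [if_pos (by decide), if_neg (by decide)]
      linear_combination (-((|x| : ℝ) : ℂ) ^ μ' * ((|x| : ℝ) : ℂ)) * hs

/-- The parity is read off at `-1`, the exponent from the derivative of `t ↦ exp(μ t)` at `0`. -/
theorem signedPow_injective {ε ε' : ZMod 2} {μ μ' : ℂ}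
    (h : ∀ x : ℝ, x ≠ 0 → signedPow ε μ x = signedPow ε' μ' x) : ε = ε' ∧ μ = μ' := by
  constructor
  · have h1 := h (-1) (by norm_num)
    unfold signedPow at h1
    rw [Real.sign_of_neg (by norm_num)] at h1
    have h01 : ∀ ε : ZMod 2, ε = 0 ∨ ε = 1 := by decide
    rcases h01 ε with rfl | rfl <;> rcases h01 ε' with rfl | rfl <;>
      first | rfl | (exfalso; norm_num at h1)
  · have h2 : ∀ t : ℝ, Complex.exp (μ * t) = Complex.exp (μ' * t) := by
      intro t
      have := h (Real.exp t) (Real.exp_pos t).ne'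
      rwa [signedPow_of_pos _ _ (Real.exp_pos t), signedPow_of_pos _ _ (Real.exp_pos t),
        Real.log_exp] at this
    have hd : ∀ μ : ℂ, HasDerivAt (fun t : ℝ => Complex.exp (μ * t)) μ 0 := by
      intro μ
      have h1 : HasDerivAt (fun t : ℝ => μ * (t : ℂ)) μ 0 := by
        simpa using ((hasDerivAt_id (0 : ℝ)).ofReal_comp).const_mul μ
      simpa using h1.cexp
    have h3 := hd μ
    rw [funext h2] at h3
    exact h3.unique (hd μ')

/-- A monomial is a torus eigenvector, so if `L` does not kill it, its character must match the
quotient of the inducing characters. Varying one diagonal entry at a time gives the exponent and the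
parity for that entry. -/
theorem weights_of_functionalOf_mono_ne_zero
    {T : principalSeries 3 ξ lam →ₗ[ℂ] principalSeries 2 η ν} (hT : T ∈ DSBO1 ξ lam η ν)
    {a b c : ℕ} (h : functionalOf T (mono a b c) ≠ 0) :
    ν 0 - lam 0 - 1 / 2 = ((a + c : ℕ) : ℂ) ∧ lam 2 - ν 1 - 1 / 2 = ((b + c : ℕ) : ℂ) ∧
      η 0 = ξ 0 + ((a + c : ℕ) : ZMod 2) ∧ η 1 = ξ 2 + ((b + c : ℕ) : ZMod 2) := by
  have h1 : ∀ x : ℝ, x ≠ 0 → signedPow (ξ 0) (-lam 0 - rho 3 0) x =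
      signedPow (η 0 + ((a + c : ℕ) : ZMod 2)) (-ν 0 - rho 2 0 + ((a + c : ℕ) : ℂ)) x := by
    intro x hx
    have h2 := functionalOf_dilate hT hx one_ne_zero (mono a b c)
    rw [dilate_mono, map_smul, smul_eq_mul, signedPow_one, signedPow_one] at h2
    have hx' : (x : ℂ) ≠ 0 := by exact_mod_cast hx
    have h3 := mul_right_cancel₀ h (show _ * _ = _ * _ by linear_combination h2 :
      (signedPow (ξ 0) (-lam 0 - rho 3 0) x *
        (((x⁻¹ : ℝ) : ℂ) ^ a * ((1 : ℝ) : ℂ) ^ b * ((1 / x : ℝ) : ℂ) ^ c)) *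
          functionalOf T (mono a b c) =
      signedPow (η 0) (-ν 0 - rho 2 0) x * functionalOf T (mono a b c))
    rw [signedPow_add_nat _ _ _ hx, ← h3]
    push_cast
    rw [pow_add]
    simp only [one_div, inv_pow, one_pow]
    field_simp
  have h1' : ∀ x : ℝ, x ≠ 0 → signedPow (η 1) (-ν 1 - rho 2 1) x =
      signedPow (ξ 2 + ((b + c : ℕ) : ZMod 2)) (-lam 2 - rho 3 2 + ((b + c : ℕ) : ℂ)) x := by
    intro x hx
    have h2 := functionalOf_dilate hT one_ne_zero hx (mono a b c)
    rw [dilate_mono, map_smul, smul_eq_mul, signedPow_one, signedPow_one] at h2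
    have h3 := mul_right_cancel₀ h (show _ * _ = _ * _ by linear_combination h2 :
      (signedPow (ξ 2) (-lam 2 - rho 3 2) x *
        ((((1 : ℝ)⁻¹ : ℝ) : ℂ) ^ a * (x : ℂ) ^ b * ((x / 1 : ℝ) : ℂ) ^ c)) *
          functionalOf T (mono a b c) =
      signedPow (η 1) (-ν 1 - rho 2 1) x * functionalOf T (mono a b c))
    rw [signedPow_add_nat _ _ _ hx, ← h3]
    push_cast
    rw [pow_add]
    simp
  obtain ⟨e1, e2⟩ := signedPow_injective h1
  obtain ⟨e3, e4⟩ := signedPow_injective h1'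
  simp only [rho] at e2 e4
  refine ⟨?_, ?_, ?_, e3⟩
  · norm_num at e2 ⊢
    linear_combination e2
  · norm_num at e4 ⊢
    linear_combination e4
  · rw [e1, add_assoc, CharTwo.add_self_eq_zero, add_zero]

theorem eq_zero_of_functionalOf_eq_zero
    {T : principalSeries 3 ξ lam →ₗ[ℂ] principalSeries 2 η ν} (hT : T ∈ DSBO1 ξ lam η ν)
    (h : functionalOf T = 0) : T = 0 := by
  refine LinearMap.ext fun f => Subtype.ext (funext fun k => ?_)
  rw [apply_eq_functionalOf hT, h]
  rfl

theorem DSBO1_eq_bot (h : ¬ ∃ n₁ n₂ : ℕ, ν 0 - lam 0 - 1 / 2 = (n₁ : ℂ) ∧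
    lam 2 - ν 1 - 1 / 2 = (n₂ : ℂ) ∧ η 0 = ξ 0 + (n₁ : ZMod 2) ∧ η 1 = ξ 2 + (n₂ : ZMod 2)) :
    DSBO1 ξ lam η ν = ⊥ := by
  refine (Submodule.eq_bot_iff _).2 fun T hT => eq_zero_of_functionalOf_eq_zero hT ?_
  obtain ⟨q, hq, hδ⟩ := exists_homogeneous_functionalOf hT
  obtain ⟨k, hk⟩ := exists_eq_sum_jets (isLocal_functionalOf hT) hq hδ
  have h0 : ∀ a b c, functionalOf T (mono a b c) = 0 := by
    intro a b c
    by_contra hne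
    exact h ⟨_, _, weights_of_functionalOf_mono_ne_zero hT hne⟩
  refine LinearMap.ext fun φ => ?_
  rw [hk k le_rfl φ]
  simp [h0]

end Borel

/-! ### The infinitesimal unipotent action -/

section Generator

/-- The vector field `-x z ∂_x - y (z - x y) ∂_y - z² ∂_z`, acting on `C^∞(ℝ³)`. -/
def unipField : Smooth3 →ₗ[ℂ] Smooth3 where
  toFun φ := ⟨fun v => fderiv ℝ φ.1 v
    (-(v.1 * v.2.2), -(v.2.1 * (v.2.2 - v.1 * v.2.1)), -(v.2.2 * v.2.2)), mem_smooth3.2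
    (((mem_smooth3.1 φ.2).fderiv_right (m := ∞) (by simp)).clm_apply (by fun_prop))⟩
  map_add' φ ψ := by
    apply Subtype.ext
    funext v
    have h1 := (mem_smooth3.1 φ.2).differentiable (by simp) v
    have h2 := (mem_smooth3.1 ψ.2).differentiable (by simp) v
    change fderiv ℝ (φ.1 + ψ.1) v _ = fderiv ℝ φ.1 v _ + fderiv ℝ ψ.1 v _
    rw [fderiv_add h1 h2]
    rfl
  map_smul' c φ := by
    apply Subtype.ext
    funext v
    have h1 := (mem_smooth3.1 φ.2).differentiable (by simp) v
    change fderiv ℝ (c • φ.1) v _ = c • fderiv ℝ φ.1 v _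
    rw [fderiv_const_smul h1]
    rfl

theorem unipField_apply (φ : Smooth3) (v : ℝ × ℝ × ℝ) : (unipField φ).1 v = fderiv ℝ φ.1 v
    (-(v.1 * v.2.2), -(v.2.1 * (v.2.2 - v.1 * v.2.1)), -(v.2.2 * v.2.2)) := rfl

theorem unipField_mul (φ ψ : Smooth3) :
    unipField (φ * ψ) = unipField φ * ψ + φ * unipField ψ := by
  apply Subtype.ext
  funext v
  have h1 := (mem_smooth3.1 φ.2).differentiable (by simp) v
  have h2 := (mem_smooth3.1 ψ.2).differentiable (by simp) v
  change fderiv ℝ (φ.1 * ψ.1) v _ = fderiv ℝ φ.1 v _ * ψ.1 v + φ.1 v * fderiv ℝ ψ.1 v _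
  rw [fderiv_mul h1 h2]
  simp
  ring

/-- Logarithmic derivatives add. Each coordinate is divisible into its image under the field, so
this evaluates the field on monomials. -/
theorem unipField_pow {φ ψ : Smooth3} (h : unipField φ = ψ * φ) (n : ℕ) :
    unipField (φ ^ n) = (n : ℂ) • (ψ * φ ^ n) := by
  induction n with
  | zero =>
    have h1 : unipField (1 * 1) = unipField 1 * 1 + 1 * unipField 1 := unipField_mul 1 1
    simp only [mul_one, one_mul] at h1
    simpa using h1
  | succ n ih =>
    rw [pow_succ, unipField_mul, ih, h]
    push_cast
    simp only [Algebra.smul_def, map_add, map_one]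
    ring

theorem unipField_coordX : unipField coordX = -coordZ * coordX := by
  apply Subtype.ext
  funext v
  have h : HasFDerivAt coordX.1 (Complex.ofRealCLM.comp (ContinuousLinearMap.fst ℝ ℝ (ℝ × ℝ))) v :=
    Complex.ofRealCLM.hasFDerivAt.comp v hasFDerivAt_fst
  rw [unipField_apply, h.fderiv]
  change ((-(v.1 * v.2.2) : ℝ) : ℂ) = -(v.2.2 : ℂ) * (v.1 : ℂ)
  push_cast
  ring

theorem unipField_coordY : unipField coordY = -(coordZ - coordX * coordY) * coordY := by
  apply Subtype.ext
  funext v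
  have h : HasFDerivAt coordY.1 (Complex.ofRealCLM.comp
      ((ContinuousLinearMap.fst ℝ ℝ ℝ).comp (ContinuousLinearMap.snd ℝ ℝ (ℝ × ℝ)))) v :=
    (Complex.ofRealCLM.comp
      ((ContinuousLinearMap.fst ℝ ℝ ℝ).comp (ContinuousLinearMap.snd ℝ ℝ (ℝ × ℝ)))).hasFDerivAt
  rw [unipField_apply, h.fderiv]
  change ((-(v.2.1 * (v.2.2 - v.1 * v.2.1)) : ℝ) : ℂ) =
    -((v.2.2 : ℂ) - (v.1 : ℂ) * (v.2.1 : ℂ)) * (v.2.1 : ℂ)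
  push_cast
  ring

theorem unipField_coordZ : unipField coordZ = -coordZ * coordZ := by
  apply Subtype.ext
  funext v
  have h : HasFDerivAt coordZ.1 (Complex.ofRealCLM.comp
      ((ContinuousLinearMap.snd ℝ ℝ ℝ).comp (ContinuousLinearMap.snd ℝ ℝ (ℝ × ℝ)))) v :=
    (Complex.ofRealCLM.comp
      ((ContinuousLinearMap.snd ℝ ℝ ℝ).comp (ContinuousLinearMap.snd ℝ ℝ (ℝ × ℝ)))).hasFDerivAt
  rw [unipField_apply, h.fderiv]
  change ((-(v.2.2 * v.2.2) : ℝ) : ℂ) = -(v.2.2 : ℂ) * (v.2.2 : ℂ)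
  push_cast
  ring

/-- The infinitesimal action of the upper triangular unipotent matrices in the coordinates
`(x, y, z)`, where `α, β, γ` are the exponents of the inducing character. -/
def generator (α β γ : ℂ) : Smooth3 →ₗ[ℂ] Smooth3 :=
  LinearMap.mulLeft ℂ (α • coordZ - β • (coordX * coordY) - γ • (coordZ - coordX * coordY)) +
    unipField

theorem generator_apply (α β γ : ℂ) (φ : Smooth3) : generator α β γ φ =
    (α • coordZ - β • (coordX * coordY) - γ • (coordZ - coordX * coordY)) * φ + unipField φ := rfl

/-- The logarithmic derivatives of `x, y, z` along the field are `-z`, `-(z - x y)`, `-z`. All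
multipliers thus lie in the span of `z` and `x y`, which have the same torus weight; this is why a
two-term recurrence results. -/
theorem generator_mono (α β γ : ℂ) (a b c : ℕ) : generator α β γ (mono a b c) =
    (α - γ - a - b - c) • mono a b (c + 1) + (γ - β + b) • mono (a + 1) (b + 1) c := by
  rw [generator_apply]
  simp only [mono]
  rw [unipField_mul, unipField_mul, unipField_pow unipField_coordX, unipField_pow unipField_coordY,
    unipField_pow unipField_coordZ]
  simp only [Algebra.smul_def, map_sub, map_add]
  ring

theorem generator_congr (α β γ : ℂ) {φ ψ : Smooth3} (h : φ.1 =ᶠ[nhds 0] ψ.1) :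
    (generator α β γ φ).1 =ᶠ[nhds 0] (generator α β γ ψ).1 := by
  filter_upwards [h, h.fderiv (𝕜 := ℝ)] with v h1 h2
  rw [generator_apply, generator_apply]
  change _ * φ.1 v + fderiv ℝ φ.1 v _ = _ * ψ.1 v + fderiv ℝ ψ.1 v _
  rw [h1, h2]

/-- With `x, y` of degree `1` and `z` of degree `2`, the generator raises the degree by `2`, whence
the factor `4 = 2²`. -/
theorem generator_dilate (α β γ : ℂ) (φ : Smooth3) :
    generator α β γ (dilate (1 / 2) (1 / 2) (1 / 4) φ) =
      (4 : ℂ) • dilate (1 / 2) (1 / 2) (1 / 4) (generator α β γ φ) := by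
  have hu : unipField (dilate (1 / 2) (1 / 2) (1 / 4) φ) =
      (4 : ℂ) • dilate (1 / 2) (1 / 2) (1 / 4) (unipField φ) := by
    apply Subtype.ext
    funext v
    have h1 := ((mem_smooth3.1 φ.2).differentiable (by simp)
      (diagCLM (1 / 2) (1 / 2) (1 / 4) v)).hasFDerivAt
    have h2 := (h1.comp v (diagCLM (1 / 2) (1 / 2) (1 / 4)).hasFDerivAt).fderiv
    rw [unipField_apply]
    change fderiv ℝ (φ.1 ∘ (diagCLM (1 / 2) (1 / 2) (1 / 4))) v _ = (4 : ℂ) * fderiv ℝ φ.1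
      (diagCLM (1 / 2) (1 / 2) (1 / 4) v) _
    rw [h2, ContinuousLinearMap.comp_apply]
    rw [show (4 : ℂ) = ((4 : ℝ) : ℂ) by norm_num, ← Complex.real_smul, ← map_smul]
    congr 1
    refine Prod.ext ?_ (Prod.ext ?_ ?_) <;> simp <;> ring
  rw [generator_apply, generator_apply, hu, map_add, smul_add, dilate_mul]
  congr 1
  have hX : dilate (1 / 2) (1 / 2) (1 / 4) coordX = (1 / 2 : ℂ) • coordX := by
    simpa [mono] using dilate_mono (1 / 2) (1 / 2) (1 / 4) 1 0 0
  have hY : dilate (1 / 2) (1 / 2) (1 / 4) coordY = (1 / 2 : ℂ) • coordY := by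
    simpa [mono] using dilate_mono (1 / 2) (1 / 2) (1 / 4) 0 1 0
  have hZ : dilate (1 / 2) (1 / 2) (1 / 4) coordZ = (1 / 4 : ℂ) • coordZ := by
    simpa [mono] using dilate_mono (1 / 2) (1 / 2) (1 / 4) 0 0 1
  rw [← smul_mul_assoc (4 : ℂ)]
  congr 1
  simp only [map_sub, map_smul, dilate_mul, hX, hY, hZ, smul_mul_smul_comm]
  module

variable {ξ : Fin 3 → ZMod 2} {lam : Fin 3 → ℂ} {η : Fin 2 → ZMod 2} {ν : Fin 2 → ℂ}

theorem hasDerivAt_signedPow_one (ε : ZMod 2) (μ : ℂ) : HasDerivAt (signedPow ε μ) μ 1 := by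
  have h1 : HasDerivAt (fun x : ℝ => Complex.exp (μ * (Real.log x : ℝ))) μ 1 := by
    have := (((Real.hasDerivAt_log one_ne_zero).ofReal_comp).const_mul μ).cexp
    simpa using this
  refine h1.congr_of_eventuallyEq ?_
  filter_upwards [lt_mem_nhds one_pos] with x hx
  exact signedPow_of_pos ε μ hx

theorem _root_.HasDerivAt.comp_of_eq_one {F : ℝ → ℂ} {F' : ℂ} (hF : HasDerivAt F F' 1) {g : ℝ → ℝ}
    {g' s : ℝ} (hg : HasDerivAt g g' s) (h1 : g s = 1) :
    HasDerivAt (fun s => F (g s)) (g' * F') s := by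
  rw [← h1] at hF
  exact hF.scomp s hg

/-- Differentiate `restrictAt_eq` at `s = 0`, where `m₁ = 1 + s z`, `m₂ = 1 + s z - s x y` and `d =
1`; for small `s` the minors do not vanish. A signed power has derivative `μ` at `1` whatever its
parity. -/
theorem hasDerivAt_restrictAt_unip (f : principalSeries 3 ξ lam) (v : ℝ × ℝ × ℝ) :
    HasDerivAt (fun s => (restrictAt (unip s) f).1 v)
      ((generator (-lam 0 - rho 3 0) (-lam 1 - rho 3 1) (-lam 2 - rho 3 2) (restrictAt 1 f)).1 v)
      0 := by
  obtain ⟨x, y, z⟩ := v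
  set α := -lam 0 - rho 3 0
  set β := -lam 1 - rho 3 1
  set γ := -lam 2 - rho 3 2
  set φ := restrictAt 1 f
  have hid := hasDerivAt_id (0 : ℝ)
  have d1 : HasDerivAt (fun s : ℝ => 1 + s * z) z 0 := by
    simpa using (hid.mul_const z).const_add 1
  have d2 : HasDerivAt (fun s : ℝ => 1 + s * z - s * x * y) (z - x * y) 0 := by
    exact (d1.sub ((hid.mul_const x).mul_const y)).congr_deriv (by simp)
  have n1 : (1 : ℝ) + 0 * z ≠ 0 := by simp
  have n2 : (1 : ℝ) + 0 * z - 0 * x * y ≠ 0 := by simp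
  have d3 : HasDerivAt (fun s : ℝ => (1 + s * z - s * x * y) / (1 + s * z)) (-(x * y)) 0 := by
    exact (d2.div d1 n1).congr_deriv (by simp)
  have d4 : HasDerivAt (fun s : ℝ => 1 / (1 + s * z - s * x * y)) (-(z - x * y)) 0 := by
    exact ((hasDerivAt_const (0 : ℝ) (1 : ℝ)).div d2 n2).congr_deriv (by simp)
  have s1 := (hasDerivAt_signedPow_one (ξ 0) α).comp_of_eq_one d1 (by simp)
  have s2 := (hasDerivAt_signedPow_one (ξ 1) β).comp_of_eq_one d3 (by simp)
  have s3 := (hasDerivAt_signedPow_one (ξ 2) γ).comp_of_eq_one d4 (by simp)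
  have c1 : HasDerivAt (fun s : ℝ => x / (1 + s * z)) (-(x * z)) 0 := by
    exact ((hasDerivAt_const (0 : ℝ) x).div d1 n1).congr_deriv (by simp)
  have c2 : HasDerivAt (fun s : ℝ => y * 1 / (1 + s * z - s * x * y)) (-(y * (z - x * y))) 0 := by
    exact ((hasDerivAt_const (0 : ℝ) (y * 1)).div d2 n2).congr_deriv (by simp)
  have c3 : HasDerivAt (fun s : ℝ => z / (1 + s * z)) (-(z * z)) 0 := by
    exact ((hasDerivAt_const (0 : ℝ) z).div d1 n1).congr_deriv (by simp)
  have p : HasDerivAt (fun s : ℝ =>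
      φ.1 (x / (1 + s * z), y * 1 / (1 + s * z - s * x * y), z / (1 + s * z)))
      (fderiv ℝ φ.1 (x, y, z) (-(x * z), -(y * (z - x * y)), -(z * z))) 0 := by
    have h := ((mem_smooth3.1 φ.2).differentiable (by simp) (x, y, z)).hasFDerivAt
    refine HasFDerivAt.comp_hasDerivAt (0 : ℝ) (l := φ.1) (l' := fderiv ℝ φ.1 (x, y, z))
      ?_ (c1.prodMk (c2.prodMk c3))
    simpa using h
  have tot := ((s1.mul s2).mul s3).mul p
  refine (tot.congr_of_eventuallyEq ?_).congr_deriv ?_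
  · filter_upwards [d1.continuousAt.eventually_ne n1, d2.continuousAt.eventually_ne n2] with s h1 h2
    rw [restrictAt_eq (unip s) f (x := x) (y := y) (z := z) (d := 1) (by simp [unip_coe])
      (by simp [unip_coe]) (by simp [unip_coe]) h1 h2]
    simp [unip_coe]
    rfl
  · rw [generator_apply]
    change _ = (α * (z : ℂ) - β * ((x : ℂ) * (y : ℂ)) - γ * ((z : ℂ) - (x : ℂ) * (y : ℂ))) *
      φ.1 (x, y, z) + fderiv ℝ φ.1 (x, y, z) (-(x * z), -(y * (z - x * y)), -(z * z))
    simp [signedPow_one]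
    left
    ring

end Generator

/-! ### Jets of smooth families -/

section JetParameters

theorem contDiffOn_jetFun {E : Type} [NormedAddCommGroup E] [NormedSpace ℝ E] {U : Set E}
    (hU : IsOpen U) {Ψ : E → ℝ × ℝ × ℝ → ℂ}
    (hΨ : ContDiffOn ℝ ∞ (fun p : E × (ℝ × ℝ × ℝ) => Ψ p.1 p.2) (U ×ˢ Set.univ)) (a b c : ℕ) :
    ContDiffOn ℝ ∞ (fun e => jetFun a b c (Ψ e)) U := by
  have h1 : ContDiffOn ℝ ∞ (fun p : (E × ℝ) × ℝ =>
      iteratedDeriv c (fun z => Ψ p.1.1 (p.1.2, p.2, z)) 0) ((U ×ˢ Set.univ) ×ˢ Set.univ) := by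
    refine contDiffOn_iteratedDeriv_param_at (E := (E × ℝ) × ℝ)
      (F := fun p z => Ψ p.1.1 (p.1.2, p.2, z)) ((hU.prod isOpen_univ).prod isOpen_univ) ?_ c 0
    refine hΨ.comp (f := fun p : ((E × ℝ) × ℝ) × ℝ => (p.1.1.1, (p.1.1.2, p.1.2, p.2)))
      (by fun_prop) ?_
    rintro p ⟨⟨⟨h, -⟩, -⟩, -⟩
    exact ⟨h, Set.mem_univ _⟩
  have h2 : ContDiffOn ℝ ∞ (fun p : E × ℝ =>
      iteratedDeriv b (fun y => iteratedDeriv c (fun z => Ψ p.1 (p.2, y, z)) 0) 0)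
      (U ×ˢ Set.univ) :=
    contDiffOn_iteratedDeriv_param_at (E := E × ℝ)
      (F := fun p y => iteratedDeriv c (fun z => Ψ p.1 (p.2, y, z)) 0)
      (hU.prod isOpen_univ) h1 b 0
  exact contDiffOn_iteratedDeriv_param_at
    (F := fun e x => iteratedDeriv b (fun y => iteratedDeriv c (fun z => Ψ e (x, y, z)) 0) 0)
    hU h2 a 0

/-- Joint smoothness lets the `s`-derivative pass through the three iterated derivatives in turn. -/
theorem hasDerivAt_jet {Φ : ℝ → Smooth3} {D : Smooth3} {s₀ : ℝ}
    (hΦ : ContDiff ℝ ∞ fun p : ℝ × (ℝ × ℝ × ℝ) => (Φ p.1).1 p.2)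
    (hD : ∀ v, HasDerivAt (fun s => (Φ s).1 v) (D.1 v) s₀) (a b c : ℕ) :
    HasDerivAt (fun s => jet a b c (Φ s)) (jet a b c D) s₀ := by
  have h1 : ContDiff ℝ ∞ fun p : (ℝ × ℝ) × ℝ =>
      iteratedDeriv c (fun z => (Φ p.1.1).1 (p.1.2, p.2, z)) 0 :=
    contDiff_iteratedDeriv_param_at (E := (ℝ × ℝ) × ℝ)
      (F := fun p z => (Φ p.1.1).1 (p.1.2, p.2, z))
      (hΦ.comp (f := fun p : ((ℝ × ℝ) × ℝ) × ℝ => (p.1.1.1, (p.1.1.2, p.1.2, p.2)))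
        (by fun_prop)) c 0
  have h2 : ContDiff ℝ ∞ fun p : ℝ × ℝ =>
      iteratedDeriv b (fun y => iteratedDeriv c (fun z => (Φ p.1).1 (p.2, y, z)) 0) 0 :=
    contDiff_iteratedDeriv_param_at (E := ℝ × ℝ)
      (F := fun p y => iteratedDeriv c (fun z => (Φ p.1).1 (p.2, y, z)) 0) h1 b 0
  have h3 : ContDiff ℝ ∞ fun s => jet a b c (Φ s) :=
    contDiff_iteratedDeriv_param_at
      (F := fun s x => iteratedDeriv b (fun y => iteratedDeriv c
        (fun z => (Φ s).1 (x, y, z)) 0) 0) h2 a 0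
  refine ((h3.differentiable (by simp) s₀).hasDerivAt).congr_deriv ?_
  refine (deriv_iteratedDeriv_comm (F := fun s x => iteratedDeriv b (fun y => iteratedDeriv c
        (fun z => (Φ s).1 (x, y, z)) 0) 0) h2 a s₀ 0).trans ?_
  rw [jet_apply, jetFun]
  congr 1
  funext x
  refine (deriv_iteratedDeriv_comm (F := fun s y => iteratedDeriv c
    (fun z => (Φ s).1 (x, y, z)) 0)
    (h1.comp (f := fun p : ℝ × ℝ => ((p.1, x), p.2)) (by fun_prop)) b s₀ 0).trans ?_
  congr 1
  funext y
  refine (deriv_iteratedDeriv_comm (F := fun s z => (Φ s).1 (x, y, z))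
    (hΦ.comp (f := fun p : ℝ × ℝ => (p.1, (x, y, p.2))) (by fun_prop)) c s₀ 0).trans ?_
  congr 1
  funext z
  exact (hD (x, y, z)).deriv

theorem jet_dilate (α β γ : ℝ) (a b c : ℕ) (φ : Smooth3) :
    jet a b c (dilate α β γ φ) = ((α : ℂ) ^ a * (β : ℂ) ^ b * (γ : ℂ) ^ c) * jet a b c φ := by
  have scale : ∀ (n : ℕ) (r : ℝ) {g : ℝ → ℂ}, ContDiff ℝ ∞ g →
      iteratedDeriv n (fun t => g (r * t)) 0 = (r : ℂ) ^ n * iteratedDeriv n g 0 := by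
    intro n r g hg
    rw [iteratedDeriv_comp_const_smul (hg.of_le (by exact_mod_cast le_top)) r]
    simp
  have hφ := mem_smooth3.1 φ.2
  simp only [jet_apply, jetFun, dilate_apply]
  simp only [fun x y => scale c γ (contDiff_slice_z hφ x y), iteratedDeriv_const_mul_field]
  simp only [fun x => scale b β (contDiff_slice_y hφ c x), iteratedDeriv_const_mul_field]
  rw [scale a α (contDiff_middle_jet hφ b c)]
  ring

end JetParameters

/-! ### Functionals of weight `(n₁, n₂)` and the recurrence -/

section Kernel

/-- The functional supported at the origin whose value at `x^(n₁-j) y^(n₂-j) z^j` is `d j` for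
`j ≤ min(n₁, n₂)`, and that vanishes on all other monomials. -/
def kernelFunctional (n₁ n₂ : ℕ) (d : ℕ → ℂ) : Smooth3 →ₗ[ℂ] ℂ :=
  ∑ j ∈ Finset.range (min n₁ n₂ + 1),
    (d j / (((n₁ - j).factorial : ℂ) * (n₂ - j).factorial * j.factorial)) •
      jet (n₁ - j) (n₂ - j) j

theorem kernelFunctional_apply (n₁ n₂ : ℕ) (d : ℕ → ℂ) (φ : Smooth3) :
    kernelFunctional n₁ n₂ d φ = ∑ j ∈ Finset.range (min n₁ n₂ + 1),
      d j / (((n₁ - j).factorial : ℂ) * (n₂ - j).factorial * j.factorial) *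
        jet (n₁ - j) (n₂ - j) j φ := by
  simp [kernelFunctional]

theorem isLocal_kernelFunctional (n₁ n₂ : ℕ) (d : ℕ → ℂ) :
    IsLocal (kernelFunctional n₁ n₂ d) := by
  intro φ hφ
  rw [kernelFunctional_apply]
  refine Finset.sum_eq_zero fun j _ => ?_
  rw [jet_congr (ψ := 0) hφ, map_zero, mul_zero]

theorem kernelFunctional_mono (n₁ n₂ : ℕ) (d : ℕ → ℂ) (a b c : ℕ) :
    kernelFunctional n₁ n₂ d (mono a b c) = if a + c = n₁ ∧ b + c = n₂ then d c else 0 := by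
  rw [kernelFunctional_apply]
  simp only [jet_mono]
  have hf : ∀ n : ℕ, (n.factorial : ℂ) ≠ 0 := fun n => by exact_mod_cast n.factorial_ne_zero
  split_ifs with h
  · rw [Finset.sum_eq_single c]
    · rw [if_pos (by omega)]
      exact div_mul_cancel₀ _ (mul_ne_zero (mul_ne_zero (hf _) (hf _)) (hf _))
    · intro j _ hj
      rw [if_neg (by omega), mul_zero]
    · intro hc
      rw [Finset.mem_range] at hc
      omega
  · refine Finset.sum_eq_zero fun j hj => ?_
    rw [Finset.mem_range] at hj
    rw [if_neg (by omega), mul_zero]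

/-- The relation `γ = α β` makes `α^(n₁-j) β^(n₂-j) γ^j` independent of `j`. -/
theorem kernelFunctional_dilate (n₁ n₂ : ℕ) (d : ℕ → ℂ) (α β γ : ℝ) (hγ : γ = α * β)
    (φ : Smooth3) : kernelFunctional n₁ n₂ d (dilate α β γ φ) =
      ((α : ℂ) ^ n₁ * (β : ℂ) ^ n₂) * kernelFunctional n₁ n₂ d φ := by
  rw [kernelFunctional_apply, kernelFunctional_apply, Finset.mul_sum]
  refine Finset.sum_congr rfl fun j hj => ?_
  rw [Finset.mem_range] at hj
  obtain ⟨a, rfl⟩ : ∃ a, n₁ = a + j := ⟨n₁ - j, by omega⟩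
  obtain ⟨b, rfl⟩ : ∃ b, n₂ = b + j := ⟨n₂ - j, by omega⟩
  rw [jet_dilate, hγ, Nat.add_sub_cancel, Nat.add_sub_cancel]
  push_cast
  ring

theorem hasDerivAt_kernelFunctional (n₁ n₂ : ℕ) (d : ℕ → ℂ) {Φ : ℝ → Smooth3} {D : Smooth3}
    {s₀ : ℝ} (hΦ : ContDiff ℝ ∞ fun p : ℝ × (ℝ × ℝ × ℝ) => (Φ p.1).1 p.2)
    (hD : ∀ v, HasDerivAt (fun s => (Φ s).1 v) (D.1 v) s₀) :
    HasDerivAt (fun s => kernelFunctional n₁ n₂ d (Φ s)) (kernelFunctional n₁ n₂ d D) s₀ := by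
  simp only [kernelFunctional_apply]
  exact HasDerivAt.fun_sum fun j _ => (hasDerivAt_jet hΦ hD _ _ _).const_mul _

/-- The recurrence for the coefficients of an invariant functional. -/
def solutionSpace (N : ℕ) (A B : ℂ) : Submodule ℂ (ℕ → ℂ) where
  carrier := {d | (∀ j, N < j → d j = 0) ∧ ∀ j < N, (A + j) * d (j + 1) = (B + j) * d j}
  add_mem' := by
    rintro d e ⟨h1, h2⟩ ⟨h3, h4⟩
    refine ⟨fun j hj => by simp [h1 j hj, h3 j hj], fun j hj => ?_⟩
    simp only [Pi.add_apply]
    linear_combination h2 j hj + h4 j hj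
  zero_mem' := ⟨fun _ _ => rfl, fun j _ => by simp⟩
  smul_mem' := by
    rintro c d ⟨h1, h2⟩
    refine ⟨fun j hj => by simp [h1 j hj], fun j hj => ?_⟩
    simp only [Pi.smul_apply, smul_eq_mul]
    linear_combination c * h2 j hj

theorem mem_solutionSpace {N : ℕ} {A B : ℂ} {d : ℕ → ℂ} : d ∈ solutionSpace N A B ↔
    (∀ j, N < j → d j = 0) ∧ ∀ j < N, (A + j) * d (j + 1) = (B + j) * d j := Iff.rfl

/-- The composite with the generator is again local and homogeneous, so `exists_eq_sum_jets` reduces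
its vanishing to monomials, where it is the recurrence. -/
theorem kernelFunctional_generator {n₁ n₂ : ℕ} {lam : Fin 3 → ℂ} {d : ℕ → ℂ}
    (hd : d ∈ solutionSpace (min n₁ n₂) (lam 2 - lam 0 - n₁ - n₂) (lam 2 - lam 1 - n₂))
    (φ : Smooth3) : kernelFunctional n₁ n₂ d
      (generator (-lam 0 - rho 3 0) (-lam 1 - rho 3 1) (-lam 2 - rho 3 2) φ) = 0 := by
  set G := generator (-lam 0 - rho 3 0) (-lam 1 - rho 3 1) (-lam 2 - rho 3 2)
  set L := (kernelFunctional n₁ n₂ d).comp G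
  have hloc : IsLocal L := by
    intro ψ hψ
    have h := isLocal_kernelFunctional n₁ n₂ d (G ψ)
    refine h ?_
    have h0 := generator_congr (-lam 0 - rho 3 0) (-lam 1 - rho 3 1) (-lam 2 - rho 3 2)
      (φ := ψ) (ψ := 0) hψ
    rwa [map_zero] at h0
  have hhom : ∀ ψ, L (dilate (1 / 2) (1 / 2) (1 / 4) ψ) =
      (4 * (((1 / 2 : ℝ) : ℂ) ^ n₁ * ((1 / 2 : ℝ) : ℂ) ^ n₂)) * L ψ := by
    intro ψ
    change kernelFunctional n₁ n₂ d (G _) = _ * kernelFunctional n₁ n₂ d (G ψ)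
    rw [generator_dilate, map_smul, kernelFunctional_dilate _ _ _ _ _ _ (by norm_num), smul_eq_mul]
    exact (mul_assoc _ _ _).symm
  have hmono : ∀ a b c, L (mono a b c) = 0 := by
    intro a b c
    change kernelFunctional n₁ n₂ d (G _) = 0
    rw [generator_mono, map_add, map_smul, map_smul, kernelFunctional_mono, kernelFunctional_mono]
    -- The two monomials produced by the generator have equal weight: both contribute or neither
    -- does.
    by_cases h : a + (c + 1) = n₁ ∧ b + (c + 1) = n₂
    · rw [if_pos h, if_pos (by omega)]
      obtain ⟨h1, h2⟩ := h
      have hr := (mem_solutionSpace.1 hd).2 c (by omega)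
      rw [← h1, ← h2] at hr
      push_cast at hr
      simp only [rho, smul_eq_mul]
      norm_num
      linear_combination hr
    · rw [if_neg h, if_neg (by omega)]
      simp
  obtain ⟨k, hk⟩ := exists_eq_sum_jets hloc (by simp) hhom
  have := hk k le_rfl φ
  simp only [hmono, mul_zero, Finset.sum_const_zero] at this
  exact this

end Kernel

/-! ### Operators correspond to solutions of the recurrence -/

section Operators

variable {ξ : Fin 3 → ZMod 2} {lam : Fin 3 → ℂ} {η : Fin 2 → ZMod 2} {ν : Fin 2 → ℂ}

theorem contDiff_restrictAt_unip (f : principalSeries 3 ξ lam) :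
    ContDiff ℝ ∞ fun p : ℝ × (ℝ × ℝ × ℝ) => (restrictAt (unip p.1) f).1 p.2 := by
  have hm : ContDiff ℝ ∞ fun s : ℝ => (fun i j => (unip s : Matrix (Fin 2) (Fin 2) ℝ) i j) := by
    refine contDiff_pi.2 fun i => contDiff_pi.2 fun j => ?_
    simp only [unip_coe]
    fin_cases i <;> fin_cases j <;> simp <;> fun_prop
  have h := (contDiffOn_family f).comp (s := Set.univ)
    (f := fun p : ℝ × (ℝ × ℝ × ℝ) => ((fun i j => (unip p.1 : Matrix (Fin 2) (Fin 2) ℝ) i j), p.2))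
    ((hm.comp contDiff_fst).prodMk contDiff_snd).contDiffOn
    (fun p _ => ⟨det_coe_ne_zero (unip p.1), Set.mem_univ p.2⟩)
  rw [contDiffOn_univ] at h
  convert h using 1
  funext p
  exact (extendZero_familyArray f.1 (unip p.1) p.2).symm

theorem hasDerivAt_kernelFunctional_unip (n₁ n₂ : ℕ) (d : ℕ → ℂ) (f : principalSeries 3 ξ lam) :
    HasDerivAt (fun s => kernelFunctional n₁ n₂ d (restrictAt (unip s) f))
      (kernelFunctional n₁ n₂ d (generator (-lam 0 - rho 3 0) (-lam 1 - rho 3 1)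
        (-lam 2 - rho 3 2) (restrictAt 1 f))) 0 :=
  hasDerivAt_kernelFunctional n₁ n₂ d (contDiff_restrictAt_unip f)
    (hasDerivAt_restrictAt_unip f)

/-- The one-parameter group law turns the derivative at `s` into the derivative at `0` for a
translated section, which vanishes. -/
theorem kernelFunctional_restrictAt_unip {n₁ n₂ : ℕ} {d : ℕ → ℂ}
    (hd : d ∈ solutionSpace (min n₁ n₂) (lam 2 - lam 0 - n₁ - n₂) (lam 2 - lam 1 - n₂))
    (f : principalSeries 3 ξ lam) (s : ℝ) :
    kernelFunctional n₁ n₂ d (restrictAt (unip s) f) =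
      kernelFunctional n₁ n₂ d (restrictAt 1 f) := by
  have hder : ∀ s, HasDerivAt (fun s => kernelFunctional n₁ n₂ d (restrictAt (unip s) f)) 0 s := by
    intro s
    have h := hasDerivAt_kernelFunctional_unip n₁ n₂ d (leftRegular 3 ξ lam (embed (unip s)⁻¹) f)
    rw [kernelFunctional_generator hd] at h
    have h' : HasDerivAt (fun t => kernelFunctional n₁ n₂ d
        (restrictAt (unip t) (leftRegular 3 ξ lam (embed (unip s)⁻¹) f))) 0 (s - s) := by
      rwa [sub_self]
    refine (h'.comp_sub_const s s).congr_of_eventuallyEq (Filter.Eventually.of_forall fun t => ?_)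
    beta_reduce
    rw [← restrictAt_mul, ← unip_add, add_sub_cancel]
  have hc := is_const_of_deriv_eq_zero (fun s => (hder s).differentiableAt)
    (fun s => (hder s).deriv) s 0
  simpa [unip_zero] using hc

variable {n₁ n₂ : ℕ}

theorem kernelFunctional_restrictAt_mul (h1 : ν 0 - lam 0 - 1 / 2 = (n₁ : ℂ))
    (h2 : lam 2 - ν 1 - 1 / 2 = (n₂ : ℂ)) (h3 : η 0 = ξ 0 + (n₁ : ZMod 2))
    (h4 : η 1 = ξ 2 + (n₂ : ZMod 2)) {d : ℕ → ℂ}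
    (hd : d ∈ solutionSpace (min n₁ n₂) (lam 2 - lam 0 - n₁ - n₂) (lam 2 - lam 1 - n₂))
    (f : principalSeries 3 ξ lam) (h : GLR 2) {p : GLR 2} (hp : p ∈ borel 2) :
    kernelFunctional n₁ n₂ d (restrictAt (h * p) f) =
      inducingFactor η ν p * kernelFunctional n₁ n₂ d (restrictAt h f) := by
  obtain ⟨s, a, b, ha, hb, rfl⟩ := exists_eq_unip_mul_torus hp
  have hh : restrictAt h f = restrictAt 1 (leftRegular 3 ξ lam (embed h⁻¹) f) := by
    rw [← restrictAt_mul, mul_one]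
  rw [restrictAt_mul, hh]
  generalize leftRegular 3 ξ lam (embed h⁻¹) f = f'
  have hu : restrictAt (unip s) f' =
      restrictAt 1 (leftRegular 3 ξ lam (embed (unip s)⁻¹) f') := by
    rw [← restrictAt_mul, mul_one]
  rw [restrictAt_mul, restrictAt_torus, ← hu, map_smul,
    kernelFunctional_dilate _ _ _ _ _ _ (by rw [div_eq_mul_inv, mul_comm]),
    kernelFunctional_restrictAt_unip hd, inducingFactor_unip_mul_torus, smul_eq_mul, ← mul_assoc]
  congr 1
  have e1 : signedPow (ξ 0) (-lam 0 - rho 3 0) a =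
      signedPow (η 0) (-ν 0 - rho 2 0) a * (a : ℂ) ^ n₁ := by
    rw [← signedPow_add_nat _ _ _ ha, h3, add_assoc, CharTwo.add_self_eq_zero, add_zero]
    congr 1
    simp only [rho]
    norm_num
    linear_combination h1
  have e2 : signedPow (η 1) (-ν 1 - rho 2 1) b =
      signedPow (ξ 2) (-lam 2 - rho 3 2) b * (b : ℂ) ^ n₂ := by
    rw [← signedPow_add_nat _ _ _ hb, h4]
    congr 1
    simp only [rho]
    norm_num
    linear_combination h2
  rw [e1, e2]
  have ha' : (a : ℂ) ≠ 0 := by exact_mod_cast ha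
  push_cast
  rw [inv_pow]
  field_simp

theorem isSmooth_kernelFunctional (n₁ n₂ : ℕ) (d : ℕ → ℂ) (f : principalSeries 3 ξ lam) :
    IsSmooth fun h : GLR 2 => kernelFunctional n₁ n₂ d (restrictAt h f) := by
  have key : ContDiffOn ℝ ∞ (fun A : Fin 2 → Fin 2 → ℝ => ∑ j ∈ Finset.range (min n₁ n₂ + 1),
      d j / (((n₁ - j).factorial : ℂ) * (n₂ - j).factorial * j.factorial) *
        jetFun (n₁ - j) (n₂ - j) j (fun v => extendZero f.1 (familyArray A v)))
      {A | (Matrix.of A).det ≠ 0} :=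
    ContDiffOn.sum fun j _ => contDiffOn_const.mul
      (contDiffOn_jetFun (isOpen_det_ne_zero 2) (contDiffOn_family f) _ _ _)
  refine key.congr fun A hA => ?_
  have hA : (Matrix.of A).det ≠ 0 := hA
  rw [extendZero, dif_pos hA, kernelFunctional_apply]
  refine Finset.sum_congr rfl fun j _ => ?_
  rw [jet_apply]
  congr 2
  funext v
  exact (extendZero_familyArray f.1 (Matrix.GeneralLinearGroup.mkOfDetNeZero (Matrix.of A) hA) v).symm

theorem exists_mem_DSBO1 (h1 : ν 0 - lam 0 - 1 / 2 = (n₁ : ℂ))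
    (h2 : lam 2 - ν 1 - 1 / 2 = (n₂ : ℂ)) (h3 : η 0 = ξ 0 + (n₁ : ZMod 2))
    (h4 : η 1 = ξ 2 + (n₂ : ZMod 2)) {d : ℕ → ℂ}
    (hd : d ∈ solutionSpace (min n₁ n₂) (lam 2 - lam 0 - n₁ - n₂) (lam 2 - lam 1 - n₂)) :
    ∃ T ∈ DSBO1 ξ lam η ν, ∀ f h, (T f).1 h = kernelFunctional n₁ n₂ d (restrictAt h f) := by
  let T : principalSeries 3 ξ lam →ₗ[ℂ] principalSeries 2 η ν :=
    { toFun := fun f => ⟨fun h => kernelFunctional n₁ n₂ d (restrictAt h f),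
        isSmooth_kernelFunctional n₁ n₂ d f, fun h p hp =>
          kernelFunctional_restrictAt_mul h1 h2 h3 h4 hd f h hp⟩
      map_add' := fun f g => by
        apply Subtype.ext
        funext h
        change kernelFunctional n₁ n₂ d (restrictAt h (f + g)) = kernelFunctional n₁ n₂ d
          (restrictAt h f) + kernelFunctional n₁ n₂ d (restrictAt h g)
        rw [map_add, map_add]
      map_smul' := fun c f => by
        apply Subtype.ext
        funext h
        change kernelFunctional n₁ n₂ d (restrictAt h (c • f)) = c • kernelFunctional n₁ n₂ d
          (restrictAt h f)
        rw [map_smul, map_smul] }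
  refine ⟨T, ⟨fun k => ?_, fun f => ?_⟩, fun f h => rfl⟩
  · refine LinearMap.ext fun f => Subtype.ext (funext fun h => ?_)
    change kernelFunctional n₁ n₂ d (restrictAt h (leftRegular 3 ξ lam (embed k) f)) =
      kernelFunctional n₁ n₂ d (restrictAt (k⁻¹ * h) f)
    rw [restrictAt_mul, inv_inv]
  -- By continuity of `p1` it suffices to treat points `h` with `T f(h) ≠ 0`; there the germ of `f`
  -- cannot vanish.
  · refine (image_closure_subset_closure_image continuous_p1).trans ?_
    refine closure_minimal ?_ isClosed_closure
    rintro _ ⟨_, ⟨h, hh, rfl⟩, rfl⟩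
    by_contra hne
    exact hh (isLocal_kernelFunctional n₁ n₂ d _ (restrictAt_eventuallyEq_zero f h hne))

/-- The value of the kernel of `T` at the monomial `x^(n₁-j) y^(n₂-j) z^j`. -/
def kernelCoeff (ξ : Fin 3 → ZMod 2) (lam : Fin 3 → ℂ) (η : Fin 2 → ZMod 2) (ν : Fin 2 → ℂ)
    (n₁ n₂ : ℕ) : DSBO1 ξ lam η ν →ₗ[ℂ] (ℕ → ℂ) where
  -- Beyond `min n₁ n₂` the truncated subtractions would name a monomial of the wrong weight;
  -- `solutionSpace` demands the value `0` there.
  toFun T := fun j => if j ≤ min n₁ n₂ then functionalOf T.1 (mono (n₁ - j) (n₂ - j) j) else 0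
  map_add' S T := by
    funext j
    simp only [Pi.add_apply]
    split_ifs
    · rfl
    · simp
  map_smul' c T := by
    funext j
    simp only [Pi.smul_apply]
    split_ifs
    · rfl
    · simp

theorem functionalOf_eq_kernelFunctional (h1 : ν 0 - lam 0 - 1 / 2 = (n₁ : ℂ))
    (h2 : lam 2 - ν 1 - 1 / 2 = (n₂ : ℂ)) (T : DSBO1 ξ lam η ν) :
    functionalOf T.1 = kernelFunctional n₁ n₂ (kernelCoeff ξ lam η ν n₁ n₂ T) := by
  obtain ⟨q, hq, hδ⟩ := exists_homogeneous_functionalOf T.2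
  obtain ⟨k₀, hk⟩ := exists_eq_sum_jets (isLocal_functionalOf T.2) hq hδ
  have hz : ∀ a b c, ¬ (a + c = n₁ ∧ b + c = n₂) → functionalOf T.1 (mono a b c) = 0 := by
    intro a b c hne
    by_contra h
    obtain ⟨e1, e2, -, -⟩ := weights_of_functionalOf_mono_ne_zero T.2 h
    rw [h1] at e1
    rw [h2] at e2
    exact hne ⟨by exact_mod_cast e1.symm, by exact_mod_cast e2.symm⟩
  refine LinearMap.ext fun φ => ?_
  -- The cut-off is raised so that the box of exponents contains every monomial of weight `(n₁,
  -- n₂)`.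
  rw [hk (max k₀ (n₁ + n₂ + 1)) (le_max_left _ _) φ, kernelFunctional_apply]
  have hK : n₁ + n₂ + 1 ≤ max k₀ (n₁ + n₂ + 1) := le_max_right _ _
  generalize max k₀ (n₁ + n₂ + 1) = K at hK
  symm
  refine Finset.sum_subset_zero_on_sdiff (Finset.range_subset_range.2 (by omega)) ?_ ?_
  · intro c hc
    simp only [Finset.mem_sdiff, Finset.mem_range] at hc
    refine Finset.sum_eq_zero fun b _ => Finset.sum_eq_zero fun a _ => ?_
    rw [hz a b c (by omega), mul_zero]
  · intro c hc
    rw [Finset.mem_range] at hc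
    rw [Finset.sum_eq_single (n₂ - c), Finset.sum_eq_single (n₁ - c)]
    · have : kernelCoeff ξ lam η ν n₁ n₂ T c =
          functionalOf T.1 (mono (n₁ - c) (n₂ - c) c) := if_pos (by omega)
      rw [this]
      ring
    · intro a _ ha
      rw [hz a _ c (by omega), mul_zero]
    · intro h
      rw [Finset.mem_range] at h
      omega
    · intro b _ hb
      refine Finset.sum_eq_zero fun a _ => ?_
      rw [hz a b c (by omega), mul_zero]
    · intro h
      rw [Finset.mem_range] at h
      omega

/-- Test unipotent invariance on `x^(n₁-j-1) y^(n₂-j-1) z^j`, whose image under the generator has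
weight `(n₁, n₂)`. The functional is constant along the unipotent orbit, so its derivative at `0`,
which is the recurrence at `j`, vanishes. -/
theorem kernelCoeff_mem (h1 : ν 0 - lam 0 - 1 / 2 = (n₁ : ℂ))
    (h2 : lam 2 - ν 1 - 1 / 2 = (n₂ : ℂ)) (T : DSBO1 ξ lam η ν) :
    kernelCoeff ξ lam η ν n₁ n₂ T ∈
      solutionSpace (min n₁ n₂) (lam 2 - lam 0 - n₁ - n₂) (lam 2 - lam 1 - n₂) := by
  refine ⟨fun j hj => if_neg (by omega), fun j hj => ?_⟩
  have hL := functionalOf_eq_kernelFunctional h1 h2 T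
  set d := kernelCoeff ξ lam η ν n₁ n₂ T with hd
  obtain ⟨a, b, ha, hb⟩ : ∃ a b : ℕ, a + (j + 1) = n₁ ∧ b + (j + 1) = n₂ :=
    ⟨n₁ - (j + 1), n₂ - (j + 1), by omega, by omega⟩
  set f := sectionOf ξ lam (mono a b j)
  have hconst : ∀ s, kernelFunctional n₁ n₂ d (restrictAt (unip s) f) =
      kernelFunctional n₁ n₂ d (restrictAt 1 f) := by
    intro s
    rw [← hL, functionalOf_restrictAt_mul T.2 f (unip_mem s), inducingFactor_unip, one_mul]
  have hder := hasDerivAt_kernelFunctional_unip n₁ n₂ d f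
  simp only [hconst] at hder
  have h0 := hder.unique (hasDerivAt_const _ _)
  rw [restrictAt_one_sectionOf, (isLocal_kernelFunctional n₁ n₂ d).congr
    (generator_congr _ _ _ (cutoff_mul_eventuallyEq _)), generator_mono, map_add, map_smul,
    map_smul, kernelFunctional_mono, kernelFunctional_mono, if_pos ⟨ha, hb⟩,
    if_pos (by omega)] at h0
  rw [← ha, ← hb]
  push_cast
  simp only [rho, smul_eq_mul] at h0
  norm_num at h0
  linear_combination h0

theorem exists_equiv_solutionSpace (h1 : ν 0 - lam 0 - 1 / 2 = (n₁ : ℂ))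
    (h2 : lam 2 - ν 1 - 1 / 2 = (n₂ : ℂ)) (h3 : η 0 = ξ 0 + (n₁ : ZMod 2))
    (h4 : η 1 = ξ 2 + (n₂ : ZMod 2)) :
    ∃ e : DSBO1 ξ lam η ν ≃ₗ[ℂ]
      solutionSpace (min n₁ n₂) (lam 2 - lam 0 - n₁ - n₂) (lam 2 - lam 1 - n₂),
      ∀ (T : DSBO1 ξ lam η ν) (f : principalSeries 3 ξ lam) (h : GLR 2),
        (T.1 f).1 h = kernelFunctional n₁ n₂ (e T).1 (restrictAt h f) := by
  let g := (kernelCoeff ξ lam η ν n₁ n₂).codRestrict _ (kernelCoeff_mem h1 h2)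
  have hinj : Function.Injective g := by
    intro S T hST
    have h0 : kernelCoeff ξ lam η ν n₁ n₂ S = kernelCoeff ξ lam η ν n₁ n₂ T :=
      congrArg Subtype.val hST
    refine Subtype.ext (LinearMap.ext fun f => Subtype.ext (funext fun h => ?_))
    rw [apply_eq_functionalOf S.2, apply_eq_functionalOf T.2,
      functionalOf_eq_kernelFunctional h1 h2, functionalOf_eq_kernelFunctional h1 h2, h0]
  have hsurj : Function.Surjective g := by
    rintro ⟨d, hd⟩
    obtain ⟨T, hT, hTd⟩ := exists_mem_DSBO1 h1 h2 h3 h4 hd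
    refine ⟨⟨T, hT⟩, Subtype.ext (funext fun j => ?_)⟩
    change (if j ≤ min n₁ n₂ then functionalOf T (mono (n₁ - j) (n₂ - j) j) else 0) = d j
    split_ifs with hj
    · change (T (sectionOf ξ lam _)).1 1 = _
      rw [hTd, restrictAt_one_sectionOf, (isLocal_kernelFunctional n₁ n₂ d).congr
        (cutoff_mul_eventuallyEq _), kernelFunctional_mono, if_pos (by omega)]
    · exact (hd.1 j (by omega)).symm
  refine ⟨LinearEquiv.ofBijective g ⟨hinj, hsurj⟩, fun T f h => ?_⟩
  rw [apply_eq_functionalOf T.2, functionalOf_eq_kernelFunctional h1 h2]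
  rfl

end Operators

/-! ### Pochhammer identities and solution of the recurrence -/

section Recurrence

theorem poch_zero (a : ℂ) : poch a 0 = 1 := by simp [poch]

theorem poch_succ (a : ℂ) (j : ℕ) : poch a (j + 1) = poch a j * (a + j) := by
  simp [poch, Finset.prod_range_succ]

theorem poch_ne_zero {a : ℂ} {j : ℕ} (h : ∀ i < j, a + i ≠ 0) : poch a j ≠ 0 :=
  Finset.prod_ne_zero_iff.2 fun i hi => h i (Finset.mem_range.1 hi)

theorem pochStar_succ {a : ℂ} {j : ℕ} (h : a + j ≠ 0) :
    pochStar a (j + 1) = pochStar a j * (a + j) := by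
  simp [pochStar, Finset.prod_range_succ, h]

theorem pochStar_ne_zero (a : ℂ) (j : ℕ) : pochStar a j ≠ 0 := by
  refine Finset.prod_ne_zero_iff.2 fun i _ => ?_
  split_ifs with h
  · exact one_ne_zero
  · exact h

theorem poch_neg_mul_factorial {n j : ℕ} (h : j ≤ n) :
    poch (-n) j * ((n - j).factorial : ℂ) = (-1) ^ j * n.factorial := by
  induction j with
  | zero => simp [poch_zero]
  | succ j ih =>
    have h1 := ih (by omega)
    obtain ⟨m, rfl⟩ : ∃ m, n = m + (j + 1) := ⟨n - (j + 1), by omega⟩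
    rw [show m + (j + 1) - j = m + 1 by omega, Nat.factorial_succ] at h1
    rw [show m + (j + 1) - (j + 1) = m by omega, poch_succ, pow_succ]
    push_cast at h1 ⊢
    linear_combination -h1

/-- A delta coefficient times the value of its derivative on the matching monomial. By `(-n)_j
(n-j)! = (-1)^j n!` the outcome is `P / Q` times a constant independent of `j`. -/
theorem coefficient_mul {n₁ n₂ j : ℕ} (h₁ : j ≤ n₁) (h₂ : j ≤ n₂) (P Q : ℂ) :
    (-1) ^ j * (poch (-n₁) j * poch (-n₂) j * P) / (Q * (j.factorial : ℂ)) *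
        ((-1) ^ (n₁ - j + (n₂ - j) + j) *
          (((n₁ - j).factorial : ℂ) * (n₂ - j).factorial * j.factorial)) =
      ((-1) ^ (n₁ + n₂) * n₁.factorial * n₂.factorial) * (P / Q) := by
  have e₁ := poch_neg_mul_factorial h₁
  have e₂ := poch_neg_mul_factorial h₂
  have hj : (j.factorial : ℂ) ≠ 0 := by exact_mod_cast j.factorial_ne_zero
  have hs : (-1 : ℂ) ^ j * (-1) ^ (n₁ - j + (n₂ - j) + j) * (-1) ^ j * (-1) ^ j =
      (-1) ^ (n₁ + n₂) := by
    rw [← pow_add, ← pow_add, ← pow_add]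
    rw [show j + (n₁ - j + (n₂ - j) + j) + j + j = n₁ + n₂ + 2 * j by omega, pow_add, pow_mul]
    simp
  calc _ = (-1) ^ j * (-1) ^ (n₁ - j + (n₂ - j) + j) *
        (poch (-n₁) j * ((n₁ - j).factorial : ℂ)) * (poch (-n₂) j * ((n₂ - j).factorial : ℂ)) *
        (P / Q) := by
        rw [mul_comm Q, ← mul_assoc ((-1) ^ j), mul_div_mul_comm]
        generalize P / Q = R
        field_simp
    _ = _ := by
        rw [e₁, e₂, ← hs]
        ring

variable {N : ℕ} {A B : ℂ} {d : ℕ → ℂ}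

theorem eq_zero_upward (hd : d ∈ solutionSpace N A B) {m M : ℕ} (hM : M ≤ N) (hm : d m = 0)
    (hA : ∀ j, m ≤ j → j < M → A + j ≠ 0) {j : ℕ} (h1 : m ≤ j) (h2 : j ≤ M) : d j = 0 := by
  induction j, h1 using Nat.le_induction with
  | base => exact hm
  | succ j hj ih =>
    have h3 := hd.2 j (by omega)
    rw [ih (by omega), mul_zero] at h3
    exact (mul_eq_zero.1 h3).resolve_left (hA j hj (by omega))

/-- The recurrence at `l` degenerates to `(B + l) d_l = 0`, and the nonzero factors `B + k` carry
the vanishing downwards. -/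
theorem eq_zero_downward (hd : d ∈ solutionSpace N A B) {l : ℕ} (hl : l < N) (hA : A + l = 0)
    (hB : ∀ k ≤ l, B + k ≠ 0) {j : ℕ} (hj : j ≤ l) : d j = 0 := by
  obtain ⟨i, rfl⟩ : ∃ i, l = j + i := ⟨l - j, by omega⟩
  induction i generalizing j with
  | zero =>
    have h := hd.2 j hl
    rw [show A + (j : ℂ) = 0 from hA, zero_mul] at h
    exact (mul_eq_zero.1 h.symm).resolve_left (hB j le_rfl)
  | succ i ih =>
    have h := hd.2 j (by omega)
    have h1 : d (j + 1) = 0 := by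
      have e : j + (i + 1) = j + 1 + i := by omega
      exact ih (j := j + 1) (by rw [← e]; exact hl) (by rw [← e]; exact hA)
        (by rw [← e]; exact hB) (by omega)
    rw [h1, mul_zero] at h
    exact (mul_eq_zero.1 h.symm).resolve_left (hB j hj)

theorem add_ne_zero_of_ne {A : ℂ} {l j : ℕ} (h : A + l = 0) (hj : j ≠ l) : A + j ≠ 0 := by
  intro h'
  have : (j : ℂ) = l := by linear_combination h' - h
  exact hj (by exact_mod_cast this)

/-- The solution may jump from zero at `l` to any value at `l + 1`, because that value is multiplied
by `A + l = 0`. -/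
theorem mem_solutionSpace_upper {l : ℕ} (hA : A + l = 0) {P Q : ℕ → ℂ} (K : ℂ)
    (hQ : ∀ j, Q j ≠ 0) (hP' : ∀ j, l < j → P (j + 1) = P j * (B + j))
    (hQ' : ∀ j, l < j → Q (j + 1) = Q j * (A + j)) :
    (fun j => if j ∈ Finset.Icc (l + 1) N then K * (P j / Q j) else 0) ∈ solutionSpace N A B := by
  refine ⟨fun j hj => if_neg (by rw [Finset.mem_Icc]; omega), fun j hj => ?_⟩
  simp only [Finset.mem_Icc]
  rcases lt_trichotomy j l with h | h | h
  · rw [if_neg (by omega), if_neg (by omega), mul_zero, mul_zero]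
  · rw [h, hA, zero_mul, if_neg (by omega), mul_zero]
  · rw [if_pos (by omega), if_pos (by omega), hP' j h, hQ' j h]
    have h1 := add_ne_zero_of_ne hA h.ne'
    have h2 := hQ j
    field_simp

/-- The solution may stop at `k` either because the recurrence ends there or because `B + k = 0`;
the alternative serves both the generic and the two-dimensional case. -/
theorem mem_solutionSpace_lower {k : ℕ} (hk : k ≤ N) (hB : k = N ∨ B + k = 0) {P Q : ℕ → ℂ} (K : ℂ)
    (hA : ∀ j < k, A + j ≠ 0) (hQ : ∀ j ≤ k, Q j ≠ 0)
    (hP' : ∀ j < k, P (j + 1) = P j * (B + j))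
    (hQ' : ∀ j < k, Q (j + 1) = Q j * (A + j)) :
    (fun j => if j ∈ Finset.Icc 0 k then K * (P j / Q j) else 0) ∈ solutionSpace N A B := by
  refine ⟨fun j hj => if_neg (by rw [Finset.mem_Icc]; omega), fun j hj => ?_⟩
  simp only [Finset.mem_Icc]
  rcases lt_trichotomy j k with h | h | h
  · rw [if_pos (by omega), if_pos (by omega), hP' j h, hQ' j h]
    have h1 := hA j h
    have h2 := hQ j h.le
    field_simp
  · have hB' : B + j = 0 := by
      rw [h]
      exact hB.resolve_left (by omega)
    rw [if_neg (by omega), hB', zero_mul, mul_zero]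
  · rw [if_neg (by omega), if_neg (by omega), mul_zero, mul_zero]

theorem exists_basis_one {V : Type*} [AddCommGroup V] [Module ℂ V] (S : Submodule ℂ V) {v : V}
    (hv : v ∈ S) (hv0 : v ≠ 0) (h : ∀ w ∈ S, ∃ c : ℂ, w = c • v) :
    ∃ b : Module.Basis (Fin 1) ℂ S, (b 0).1 = v := by
  have hne : (⟨v, hv⟩ : S) ≠ 0 := fun h0 => hv0 (congrArg Subtype.val h0)
  have hli : LinearIndependent ℂ (fun _ : Fin 1 => (⟨v, hv⟩ : S)) :=
    LinearIndependent.of_subsingleton 0 hne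
  have hsp : ⊤ ≤ Submodule.span ℂ (Set.range fun _ : Fin 1 => (⟨v, hv⟩ : S)) := by
    rintro ⟨w, hw⟩ -
    obtain ⟨c, rfl⟩ := h w hw
    have hm : (⟨v, hv⟩ : S) ∈ Submodule.span ℂ (Set.range fun _ : Fin 1 => (⟨v, hv⟩ : S)) :=
      Submodule.subset_span (Set.mem_range_self 0)
    exact Submodule.smul_mem _ c hm
  exact ⟨Module.Basis.mk hli hsp, by rw [Module.Basis.mk_apply]⟩

theorem exists_basis_two {V : Type*} [AddCommGroup V] [Module ℂ V] (S : Submodule ℂ V) {v w : V}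
    (hv : v ∈ S) (hw : w ∈ S) (hli : ∀ s t : ℂ, s • v + t • w = 0 → s = 0 ∧ t = 0)
    (h : ∀ u ∈ S, ∃ s t : ℂ, u = s • v + t • w) :
    ∃ b : Module.Basis (Fin 2) ℂ S, (b 0).1 = v ∧ (b 1).1 = w := by
  have hli' : LinearIndependent ℂ ![(⟨v, hv⟩ : S), ⟨w, hw⟩] := by
    refine LinearIndependent.pair_iff.2 fun s t hst => hli s t ?_
    exact congrArg Subtype.val hst
  have hsp : ⊤ ≤ Submodule.span ℂ (Set.range ![(⟨v, hv⟩ : S), ⟨w, hw⟩]) := by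
    rintro ⟨u, hu⟩ -
    obtain ⟨s, t, rfl⟩ := h u hu
    have hm (i : Fin 2) : ![(⟨v, hv⟩ : S), ⟨w, hw⟩] i ∈
        Submodule.span ℂ (Set.range ![(⟨v, hv⟩ : S), ⟨w, hw⟩]) :=
      Submodule.subset_span (Set.mem_range_self i)
    exact Submodule.add_mem _ (Submodule.smul_mem _ s (hm 0)) (Submodule.smul_mem _ t (hm 1))
  refine ⟨Module.Basis.mk hli' hsp, ?_, ?_⟩ <;> rw [Module.Basis.mk_apply] <;> rfl

theorem exists_basis_generic {K : ℂ} (hK : K ≠ 0) (hA : ∀ l < N, A + l ≠ 0) :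
    ∃ b : Module.Basis (Fin 1) ℂ (solutionSpace N A B), (b 0).1 =
      fun j => if j ∈ Finset.Icc 0 N then K * (poch B j / poch A j) else 0 := by
  have hv := mem_solutionSpace_lower (N := N) (A := A) (B := B) le_rfl (Or.inl rfl)
    (P := poch B) (Q := poch A) K hA
    (fun j hj => poch_ne_zero fun i hi => hA i (by omega)) (fun j _ => poch_succ B j)
    (fun j _ => poch_succ A j)
  set v : ℕ → ℂ := fun j => if j ∈ Finset.Icc 0 N then K * (poch B j / poch A j) else 0 with hvdef
  have hv0 : v 0 = K := by simp [hvdef, poch_zero]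
  refine exists_basis_one _ hv (fun h0 => hK ?_) fun w hw => ⟨w 0 / K, ?_⟩
  · rw [← hv0, h0]; rfl
  have hr := sub_mem hw (Submodule.smul_mem _ (w 0 / K) hv)
  have hr0 : (w - (w 0 / K) • v) 0 = 0 := by
    simp only [Pi.sub_apply, Pi.smul_apply, smul_eq_mul, hv0]
    field_simp
    ring
  rw [← sub_eq_zero]
  funext j
  rcases le_or_gt j N with hj | hj
  · exact eq_zero_upward hr le_rfl hr0 (fun i _ hi => hA i hi) (Nat.zero_le _) hj
  · exact hr.1 j hj

/-- Here `d_(l+1)` is the only free parameter. The proposed vector is nonzero there since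
`(B)_(l+1)` has no vanishing factor, although `(B)_j` may vanish for larger `j`. -/
theorem exists_basis_upper {K : ℂ} (hK : K ≠ 0) {l : ℕ} (hl : l < N) (hA : A + l = 0)
    (hB : ∀ k ≤ l, B + k ≠ 0) :
    ∃ b : Module.Basis (Fin 1) ℂ (solutionSpace N A B), (b 0).1 =
      fun j => if j ∈ Finset.Icc (l + 1) N then K * (poch B j / pochStar A j) else 0 := by
  have hv := mem_solutionSpace_upper (N := N) (B := B) hA (P := poch B) (Q := pochStar A) K
    (pochStar_ne_zero A) (fun j _ => poch_succ B j)
    (fun j hj => pochStar_succ (add_ne_zero_of_ne hA hj.ne'))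
  set v : ℕ → ℂ := fun j => if j ∈ Finset.Icc (l + 1) N then K * (poch B j / pochStar A j) else 0
    with hvdef
  have hv0 : v (l + 1) ≠ 0 := by
    rw [hvdef]
    simp only
    rw [if_pos (Finset.mem_Icc.2 ⟨le_rfl, hl⟩)]
    exact mul_ne_zero hK (div_ne_zero (poch_ne_zero fun i hi => hB i (by omega))
      (pochStar_ne_zero _ _))
  refine exists_basis_one _ hv (fun h0 => hv0 (congrFun h0 _)) fun w hw =>
    ⟨w (l + 1) / v (l + 1), ?_⟩
  have hr := sub_mem hw (Submodule.smul_mem _ (w (l + 1) / v (l + 1)) hv)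
  have hr0 : (w - (w (l + 1) / v (l + 1)) • v) (l + 1) = 0 := by
    simp only [Pi.sub_apply, Pi.smul_apply, smul_eq_mul]
    field_simp
    ring
  rw [← sub_eq_zero]
  funext j
  rcases le_or_gt j l with hj | hj
  · exact eq_zero_downward hr hl hA hB hj
  rcases le_or_gt j N with hj' | hj'
  · exact eq_zero_upward hr le_rfl hr0 (fun i hi _ => add_ne_zero_of_ne hA (by omega)) hj hj'
  · exact hr.1 j hj'

/-- A solution is determined by `d_0` and `d_(l+1)`, and the two vectors are dual to these up to
scalars. Since `(B)_j` vanishes for `j > k`, the upper block needs `pochStar B`; its omitted factor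
lies below the block, so the recurrence there is unaffected. -/
theorem exists_basis_pair {K : ℂ} (hK : K ≠ 0) {k l : ℕ} (hkl : k ≤ l) (hl : l < N)
    (hA : A + l = 0) (hB : B + k = 0) :
    ∃ b : Module.Basis (Fin 2) ℂ (solutionSpace N A B), ((b 0).1 =
      fun j => if j ∈ Finset.Icc (l + 1) N then K * (pochStar B j / pochStar A j) else 0) ∧
      (b 1).1 = fun j => if j ∈ Finset.Icc 0 k then K * (poch B j / poch A j) else 0 := by
  have hv := mem_solutionSpace_upper (N := N) (B := B) hA (P := pochStar B) (Q := pochStar A) K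
    (pochStar_ne_zero A) (fun j hj => pochStar_succ (add_ne_zero_of_ne hB (by omega)))
    (fun j hj => pochStar_succ (add_ne_zero_of_ne hA hj.ne'))
  have hA' : ∀ j < l, A + j ≠ 0 := fun j hj => add_ne_zero_of_ne hA hj.ne
  have hw := mem_solutionSpace_lower (N := N) (A := A) (B := B) (by omega : k ≤ N) (Or.inr hB)
    (P := poch B) (Q := poch A) K (fun j hj => hA' j (by omega))
    (fun j hj => poch_ne_zero fun i hi => hA' i (by omega)) (fun j _ => poch_succ B j)
    (fun j _ => poch_succ A j)
  set v : ℕ → ℂ := fun j =>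
    if j ∈ Finset.Icc (l + 1) N then K * (pochStar B j / pochStar A j) else 0 with hvdef
  set w : ℕ → ℂ := fun j => if j ∈ Finset.Icc 0 k then K * (poch B j / poch A j) else 0 with hwdef
  have hv1 : v (l + 1) ≠ 0 := by
    rw [hvdef]
    simp only
    rw [if_pos (Finset.mem_Icc.2 ⟨le_rfl, hl⟩)]
    exact mul_ne_zero hK (div_ne_zero (pochStar_ne_zero _ _) (pochStar_ne_zero _ _))
  have hv0 : v 0 = 0 := if_neg (by rw [Finset.mem_Icc]; omega)
  have hw1 : w (l + 1) = 0 := if_neg (by rw [Finset.mem_Icc]; omega)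
  have hw0 : w 0 = K := by simp [hwdef, poch_zero]
  refine exists_basis_two _ hv hw (fun s t hst => ?_) fun u hu =>
    ⟨u (l + 1) / v (l + 1), u 0 / K, ?_⟩
  · have e0 := congrFun hst 0
    have e1 := congrFun hst (l + 1)
    simp only [Pi.add_apply, Pi.smul_apply, smul_eq_mul, hv0, hw0, hw1, mul_zero, zero_add,
      add_zero, Pi.zero_apply] at e0 e1
    exact ⟨(mul_eq_zero.1 e1).resolve_right hv1, (mul_eq_zero.1 e0).resolve_right hK⟩
  have hr := sub_mem hu (add_mem (Submodule.smul_mem _ (u (l + 1) / v (l + 1)) hv)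
    (Submodule.smul_mem _ (u 0 / K) hw))
  have hr1 : (u - ((u (l + 1) / v (l + 1)) • v + (u 0 / K) • w)) (l + 1) = 0 := by
    simp only [Pi.sub_apply, Pi.add_apply, Pi.smul_apply, smul_eq_mul, hw1]
    field_simp
    ring
  have hr0 : (u - ((u (l + 1) / v (l + 1)) • v + (u 0 / K) • w)) 0 = 0 := by
    simp only [Pi.sub_apply, Pi.add_apply, Pi.smul_apply, smul_eq_mul, hw0, hv0]
    field_simp
    ring
  rw [← sub_eq_zero]
  funext j
  rcases le_or_gt j l with hj | hj
  · exact eq_zero_upward hr hl.le hr0 (fun i _ hi => hA' i hi) (Nat.zero_le _) hj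
  rcases le_or_gt j N with hj' | hj'
  · exact eq_zero_upward hr le_rfl hr1 (fun i hi _ => add_ne_zero_of_ne hA (by omega)) hj hj'
  · exact hr.1 j hj'

end Recurrence

/-! ### From functionals to distribution kernels -/

section Kernels

variable {ξ : Fin 3 → ZMod 2} {lam : Fin 3 → ℂ} {η : Fin 2 → ZMod 2} {ν : Fin 2 → ℂ}

theorem hasKernel_of_kernelFunctional {n₁ n₂ : ℕ}
    {T : principalSeries 3 ξ lam →ₗ[ℂ] principalSeries 2 η ν} {d : ℕ → ℂ}
    (hT : ∀ f h, (T f).1 h = kernelFunctional n₁ n₂ d (restrictAt h f)) {J : Finset ℕ}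
    (hJ : ∀ j ∈ J, j ≤ min n₁ n₂) {P Q : ℕ → ℂ}
    (hd : d = fun j => if j ∈ J then
      ((-1) ^ (n₁ + n₂) * n₁.factorial * n₂.factorial) * (P j / Q j) else 0) :
    HasKernel T (deltaSum n₁ n₂ J fun j => (-1) ^ j * (poch (-n₁) j * poch (-n₂) j * P j) /
      (Q j * (j.factorial : ℂ))) := by
  intro f h
  rw [hT, kernelFunctional_apply, deltaSum]
  symm
  refine Finset.sum_subset_zero_on_sdiff
    (fun j hj => Finset.mem_range.2 (by have := hJ j hj; omega)) (fun j hj => ?_) fun j hj => ?_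
  · rw [Finset.mem_sdiff] at hj
    rw [hd]
    simp [hj.2]
  · have hjN := hJ j hj
    have e := coefficient_mul (n₁ := n₁) (n₂ := n₂) (j := j) (by omega) (by omega) (P j) (Q j)
    rw [hd]
    simp only
    rw [if_pos hj, ← e]
    have hf : ∀ n : ℕ, (n.factorial : ℂ) ≠ 0 := fun n => by exact_mod_cast n.factorial_ne_zero
    rw [← mul_assoc _ ((-1 : ℂ) ^ _),
      mul_div_cancel_right₀ _ (mul_ne_zero (mul_ne_zero (hf _) (hf _)) (hf _))]
    exact (mul_assoc _ _ _).symm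

end Kernels

end SymBreak

end

/-! ### The classification, by transport of bases from the solution space -/

theorem proposition5p1 (ξ : Fin 3 → ZMod 2) (lam : Fin 3 → ℂ) (η : Fin 2 → ZMod 2)
    (ν : Fin 2 → ℂ) :
    (∀ n₁ n₂ N : ℕ, ν 0 - lam 0 - 1 / 2 = (n₁ : ℂ) → lam 2 - ν 1 - 1 / 2 = (n₂ : ℂ) →
      N = min n₁ n₂ → η 0 = ξ 0 + (n₁ : ZMod 2) → η 1 = ξ 2 + (n₂ : ZMod 2) →
      -- case (1)
      ((¬ ∃ k₀ l₀ : ℕ, k₀ ≤ l₀ ∧ l₀ < N ∧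
          lam 0 - lam 2 + n₁ + n₂ - l₀ = 0 ∧ lam 1 - lam 2 + n₂ - k₀ = 0) →
        Module.rank ℂ (SymBreak.DSBO1 ξ lam η ν) = 1 ∧
        ((∀ l : ℕ, l < N → lam 0 - lam 2 + n₁ + n₂ - l ≠ 0) →
          ∃ b : Module.Basis (Fin 1) ℂ (SymBreak.DSBO1 ξ lam η ν),
            SymBreak.HasKernel (b 0).1
              (SymBreak.deltaSum n₁ n₂ (Finset.Icc 0 N) fun j =>
                (-1) ^ j * (SymBreak.poch (-n₁) j * SymBreak.poch (-n₂) j *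
                    SymBreak.poch (lam 2 - lam 1 - n₂) j) /
                  (SymBreak.poch (lam 2 - lam 0 - n₁ - n₂) j * (j.factorial : ℂ)))) ∧
        (∀ l₀ : ℕ, l₀ < N → lam 0 - lam 2 + n₁ + n₂ - l₀ = 0 →
          ∃ b : Module.Basis (Fin 1) ℂ (SymBreak.DSBO1 ξ lam η ν),
            SymBreak.HasKernel (b 0).1
              (SymBreak.deltaSum n₁ n₂ (Finset.Icc (l₀ + 1) N) fun j =>
                (-1) ^ j * (SymBreak.poch (-n₁) j * SymBreak.poch (-n₂) j *
                    SymBreak.poch (lam 2 - lam 1 - n₂) j) /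
                  (SymBreak.pochStar (lam 2 - lam 0 - n₁ - n₂) j * (j.factorial : ℂ))))) ∧
      -- case (2)
      (∀ k₀ l₀ : ℕ, k₀ ≤ l₀ → l₀ < N →
        lam 0 - lam 2 + n₁ + n₂ - l₀ = 0 → lam 1 - lam 2 + n₂ - k₀ = 0 →
        Module.rank ℂ (SymBreak.DSBO1 ξ lam η ν) = 2 ∧
        ∃ b : Module.Basis (Fin 2) ℂ (SymBreak.DSBO1 ξ lam η ν),
          SymBreak.HasKernel (b 0).1
            (SymBreak.deltaSum n₁ n₂ (Finset.Icc (l₀ + 1) N) fun j =>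
              (-1) ^ j * (SymBreak.poch (-n₁) j * SymBreak.poch (-n₂) j *
                  SymBreak.pochStar (lam 2 - lam 1 - n₂) j) /
                (SymBreak.pochStar (lam 2 - lam 0 - n₁ - n₂) j * (j.factorial : ℂ))) ∧
          SymBreak.HasKernel (b 1).1
            (SymBreak.deltaSum n₁ n₂ (Finset.Icc 0 k₀) fun j =>
              (-1) ^ j * (SymBreak.poch (-n₁) j * SymBreak.poch (-n₂) j *
                  SymBreak.poch (lam 2 - lam 1 - n₂) j) /
                (SymBreak.poch (lam 2 - lam 0 - n₁ - n₂) j * (j.factorial : ℂ))))) ∧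
    -- case (3)
    ((¬ ∃ n₁ n₂ : ℕ, ν 0 - lam 0 - 1 / 2 = (n₁ : ℂ) ∧ lam 2 - ν 1 - 1 / 2 = (n₂ : ℂ) ∧
        η 0 = ξ 0 + (n₁ : ZMod 2) ∧ η 1 = ξ 2 + (n₂ : ZMod 2)) →
      Module.rank ℂ (SymBreak.DSBO1 ξ lam η ν) = 0) := by
  refine ⟨?_, fun h => ?_⟩
  · rintro n₁ n₂ N h1 h2 rfl h3 h4
    obtain ⟨e, he⟩ := SymBreak.exists_equiv_solutionSpace h1 h2 h3 h4
    -- Scaling the solutions by this constant makes the transported basis have exactly the stated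
    -- kernels.
    have hK : ((-1 : ℂ) ^ (n₁ + n₂) * n₁.factorial * n₂.factorial) ≠ 0 :=
      mul_ne_zero (mul_ne_zero (pow_ne_zero _ (by norm_num))
        (by exact_mod_cast n₁.factorial_ne_zero)) (by exact_mod_cast n₂.factorial_ne_zero)
    have hs : ∀ s f h, (((e.symm s).1 f).1 h : ℂ) =
        SymBreak.kernelFunctional n₁ n₂ s.1 (SymBreak.restrictAt h f) := by
      intro s f h
      rw [he, e.apply_symm_apply]
    have hA : ∀ l : ℕ, lam 0 - lam 2 + n₁ + n₂ - l = 0 ↔ lam 2 - lam 0 - n₁ - n₂ + l = 0 :=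
      fun l => ⟨fun h => by linear_combination -h, fun h => by linear_combination -h⟩
    have hB : ∀ k : ℕ, lam 1 - lam 2 + n₂ - k = 0 ↔ lam 2 - lam 1 - n₂ + k = 0 :=
      fun l => ⟨fun h => by linear_combination -h, fun h => by linear_combination -h⟩
    simp only [ne_eq, hA, hB]
    refine ⟨fun hno => ?_, fun k₀ l₀ hkl hl hAl hBk => ?_⟩
    · have gen : (∀ l : ℕ, l < min n₁ n₂ → ¬ lam 2 - lam 0 - n₁ - n₂ + l = 0) →
          ∃ b : Module.Basis (Fin 1) ℂ (SymBreak.DSBO1 ξ lam η ν),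
            SymBreak.HasKernel (b 0).1
              (SymBreak.deltaSum n₁ n₂ (Finset.Icc 0 (min n₁ n₂)) fun j =>
                (-1) ^ j * (SymBreak.poch (-n₁) j * SymBreak.poch (-n₂) j *
                    SymBreak.poch (lam 2 - lam 1 - n₂) j) /
                  (SymBreak.poch (lam 2 - lam 0 - n₁ - n₂) j * (j.factorial : ℂ))) := by
        intro hl
        obtain ⟨b, hb⟩ := SymBreak.exists_basis_generic (B := lam 2 - lam 1 - n₂) hK hl
        refine ⟨b.map e.symm, ?_⟩
        rw [Module.Basis.map_apply]
        exact SymBreak.hasKernel_of_kernelFunctional (hs _)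
          (fun j hj => (Finset.mem_Icc.1 hj).2) hb
      have up : ∀ l₀ : ℕ, l₀ < min n₁ n₂ → lam 2 - lam 0 - n₁ - n₂ + l₀ = 0 →
          ∃ b : Module.Basis (Fin 1) ℂ (SymBreak.DSBO1 ξ lam η ν),
            SymBreak.HasKernel (b 0).1
              (SymBreak.deltaSum n₁ n₂ (Finset.Icc (l₀ + 1) (min n₁ n₂)) fun j =>
                (-1) ^ j * (SymBreak.poch (-n₁) j * SymBreak.poch (-n₂) j *
                    SymBreak.poch (lam 2 - lam 1 - n₂) j) /
                  (SymBreak.pochStar (lam 2 - lam 0 - n₁ - n₂) j * (j.factorial : ℂ))) := by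
        intro l₀ hl hl0
        obtain ⟨b, hb⟩ := SymBreak.exists_basis_upper (B := lam 2 - lam 1 - n₂) hK hl hl0
          (fun k hk hk0 => hno ⟨k, l₀, hk, hl, hl0, hk0⟩)
        refine ⟨b.map e.symm, ?_⟩
        rw [Module.Basis.map_apply]
        exact SymBreak.hasKernel_of_kernelFunctional (hs _)
          (fun j hj => (Finset.mem_Icc.1 hj).2) hb
      refine ⟨?_, gen, up⟩
      by_cases hl : ∀ l : ℕ, l < min n₁ n₂ → ¬ lam 2 - lam 0 - n₁ - n₂ + l = 0
      · obtain ⟨b, -⟩ := gen hl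
        simpa using rank_eq_card_basis b
      · push Not at hl
        obtain ⟨l₀, hl, hl0⟩ := hl
        obtain ⟨b, -⟩ := up l₀ hl hl0
        simpa using rank_eq_card_basis b
    · obtain ⟨b, hb0, hb1⟩ := SymBreak.exists_basis_pair hK hkl hl hAl hBk
      refine ⟨by simpa using rank_eq_card_basis (b.map e.symm), b.map e.symm, ?_, ?_⟩
      · rw [Module.Basis.map_apply]
        exact SymBreak.hasKernel_of_kernelFunctional (hs _)
          (fun j hj => (Finset.mem_Icc.1 hj).2) hb0
      · rw [Module.Basis.map_apply]
        exact SymBreak.hasKernel_of_kernelFunctional (hs _)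
          (fun j hj => by have := (Finset.mem_Icc.1 hj).2; omega) hb1
  · rw [SymBreak.DSBO1_eq_bot h]
    exact rank_bot ℂ _
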